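/- Fix $\alpha>-1$ and let $dA_\alpha(z)=\frac{\alpha+1}{\pi}(2\,\mathrm{Im}\,z)^\alpha\,dx\,dy$ on the upper half plane $\mathbb{R}^2_+=\{\mathrm{Im}\,z>0\}$. Let $$P_\alpha f(z)=i^{2+\alpha}\int_{\mathbb{R}^2_+}\frac{f(w)}{(z-\overline w)^{2+\alpha}}\,dA_\alpha(w),\qquad P_\alpha^+f(z)=\int_{\mathbb{R}^2_+}\frac{f(w)}{|z-\overline w|^{2+\alpha}}\,dA_\alpha(w),$$ and $[b,T]f=b\,Tf-T(bf)$. Let $\mathcal D=\mathcal D^1\cup\mathcal D^2$, where $\mathcal D^1,\mathcal D^2$ are adjacent dyadic systems on $\mathbb{R}$: there is $\kappa$ such that every bounded interval $J$ is contained in some $I\in\mathcal D$ with $|I|\le\kappa|J|$. For an interval $I$ put $Q_I=\{x+iy: x\in I,\ 0<y<|I|\}$. A weight is a measurable, almost everywhere positive and finite function; $\mu\in\mathcal B_2$ means $$[\mu]_{\mathcal B_2}=\sup_{I\in\mathcal D}\Big(\frac1{A_\alpha(Q_I)}\int_{Q_I}\mu\,dA_\alpha\Big)\Big(\frac1{A_\alpha(Q_I)}\int_{Q_I}\mu^{-1}\,dA_\alpha\Big)<\infty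 .$$ For a weight $\nu$ put $\nu(E)=\int_E\nu\,dA_\alpha$. For $b\in L^1_{loc}(\mathbb{R}^2_+,dA_\alpha)$ let $$\|b\|_{\mathrm{BMO}_\nu}=\sup_{I\in\mathcal D}\frac1{\nu(Q_I)}\int_{Q_I}|b-b_{Q_I}|\,dA_\alpha\in[0,\infty],$$ where $b_{Q_I}$ is the $A_\alpha$-average of $b$ over $Q_I$ (the supremum is $\infty$ if $b$ is not integrable over some $Q_I$); $b\in\mathrm{BMO}_\nu$ means that this is finite, and $\mathrm{BMOA}_\nu$ is the set of holomorphic $b\in\mathrm{BMO}_\nu$, with $\|b\|_{\mathrm{BMOA}_\nu}=\|b\|_{\mathrm{BMO}_\nu}$. $L^2_\alpha(\mu)$ is the $L^2$ space of $\mu\,dA_\alpha$. For $b\in L^1_{loc}$ and $T\in\{P_\alpha,P_\alpha^+\}$ the commutator $[b,T]$ is defined on bounded measurable functions $f$ with compact support in $\mathbb{R}^2_+$; let $\|[b,T]\|\in[0,\infty]$ be the least $N$ such that $\|[b,T]f\|_{L^2_\alpha(\lambda)}\le N\|f\|_{L^2_\alpha(\mu)}$ for all such $f$, and call $[b,T]$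 bounded from $L^2_\alpha(\mu)$ to $L^2_\alpha(\lambda)$ if it is finite. **Theorem.** Let $\mu,\lambda\in\mathcal B_2$, $\nu=\mu^{1/2}\lambda^{-1/2}$ and $T\in\{P_\alpha,P_\alpha^+\}$. There is a constant $C<\infty$, depending only on $\alpha$, $\kappa$ and an upper bound for $[\mu]_{\mathcal B_2}$ and $[\lambda]_{\mathcal B_2}$, with the following properties. 1. Let $b\in L^1_{loc}(\mathbb{R}^2_+,dA_\alpha)$ be holomorphic. Then $[b,T]$ is bounded from $L^2_\alpha(\mu)$ to $L^2_\alpha(\lambda)$ if and only if $b\in\mathrm{BMOA}_\nu$, and $$\|b\|_{\mathrm{BMO}_\nu}\le C\,\|[b,T]\|,\qquad \|[b,T]\|\le C\,\|b\|_{\mathrm{BMO}_\nu}.$$ If $b\in\mathrm{BMOA}_\nu$, then for every $f\in L^2_\alpha(\mu)$ the integrals defining $[b,T]f(z)$ converge absolutely for almost every $z$, and $[b,T]f\in L^2_\alpha(\lambda)$ with $\|[b,T]f\|_{L^2_\alpha(\lambda)}\le\|[b,T]\|\,\|f\|_{L^2_\alpha(\mu)}$. 2. For every $b\in L^1_{loc}(\mathbb{R}^2_+,dA_\alpha)$,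 holomorphic or not, $\|b\|_{\mathrm{BMO}_\nu}\le C\,\|[b,T]\|$. -/

import Mathlib

open MeasureTheory
open scoped ENNReal NNReal

/-- The upper half plane, as a subset of `ℂ`. -/
def upperHalf : Set ℂ := {z | 0 < z.im}

/-- The measure `dA_α = π⁻¹ (α + 1) (2 Im z)^α dx dy` on the upper half plane. -/
noncomputable def areaMeasure (α : ℝ) : Measure ℂ :=
  (volume.restrict upperHalf).withDensity
    (fun z => ENNReal.ofReal (1 / Real.pi * (α + 1) * (2 * z.im) ^ α))

/-- A dyadic system on `ℝ`: for every `k : ℤ` the line is partitioned into half-open intervals of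
length `2^(-k)`, with end points in `offset k + 2^(-k) ℤ`; every interval of generation `k` is the
union of two intervals of generation `k + 1`. -/
structure DyadicSystem where
  offset : ℤ → ℝ
  nested : ∀ k : ℤ, ∃ n : ℤ, offset k = offset (k + 1) + n * (2 : ℝ) ^ (-(k + 1))

/-- The intervals of a dyadic system; the pair `(s, t)` stands for `[s, t)`. -/
def DyadicSystem.intervals (D : DyadicSystem) : Set (ℝ × ℝ) :=
  {I | ∃ k m : ℤ, I = (D.offset k + m * (2 : ℝ) ^ (-k), D.offset k + (m + 1) * (2 : ℝ) ^ (-k))}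

/-- Two dyadic systems are adjacent (with constant `κ`) if every bounded interval `[s, t]` lies in
an interval of one of the two systems whose length is at most `κ (t - s)`. -/
def AdjacentSystems (κ : ℝ) (D₁ D₂ : DyadicSystem) : Prop :=
  ∀ s t : ℝ, s < t → ∃ I ∈ D₁.intervals ∪ D₂.intervals,
    Set.Icc s t ⊆ Set.Ico I.1 I.2 ∧ I.2 - I.1 ≤ κ * (t - s)

/-- The Carleson box `Q_I = {x + i y : x ∈ I, 0 < y < |I|}` over `I = [I.1, I.2)`. -/
def carlesonBox (I : ℝ × ℝ) : Set ℂ :=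
  {z | z.re ∈ Set.Ico I.1 I.2 ∧ z.im ∈ Set.Ioo 0 (I.2 - I.1)}

/-- A weight: measurable and almost everywhere positive (and finite). -/
def IsWeight (α : ℝ) (μ : ℂ → ℝ) : Prop :=
  AEMeasurable μ (areaMeasure α) ∧ ∀ᵐ z ∂(areaMeasure α), 0 < μ z

/-- `μ(E) = ∫_E μ dA_α`. -/
noncomputable def weightMass (α : ℝ) (μ : ℂ → ℝ) (E : Set ℂ) : ℝ≥0∞ :=
  ∫⁻ z in E, ENNReal.ofReal (μ z) ∂(areaMeasure α)

/-- The characteristic `[μ]_{B₂}` over the Carleson boxes of the family `𝒟` of intervals. -/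
noncomputable def b2Const (α : ℝ) (𝒟 : Set (ℝ × ℝ)) (μ : ℂ → ℝ) : ℝ≥0∞ :=
  ⨆ I ∈ 𝒟,
    (weightMass α μ (carlesonBox I) / areaMeasure α (carlesonBox I)) *
    (weightMass α (fun z => (μ z)⁻¹) (carlesonBox I) / areaMeasure α (carlesonBox I))

/-- The measure `μ dA_α`, so that `L²_α(μ)` is the `L²` space of `weightedMeasure α μ`. -/
noncomputable def weightedMeasure (α : ℝ) (μ : ℂ → ℝ) : Measure ℂ :=
  (areaMeasure α).withDensity (fun z => ENNReal.ofReal (μ z))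

/-- The weight `ν = μ^{1/2} λ^{-1/2}`. -/
noncomputable def bloomWeight (μ lam : ℂ → ℝ) : ℂ → ℝ :=
  fun z => μ z ^ (1 / 2 : ℝ) * lam z ^ (-(1 / 2) : ℝ)

/-- `sup_I ν(Q_I)⁻¹ ∫_{Q_I} |b - b_{Q_I}| dA_α`, in `[0, ∞]`.  It is `∞` for a measurable `b` that
is not integrable over some `Q_I`. -/
noncomputable def bmoNorm (α : ℝ) (𝒟 : Set (ℝ × ℝ)) (ν : ℂ → ℝ) (b : ℂ → ℂ) : ℝ≥0∞ :=
  ⨆ I ∈ 𝒟,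
    (∫⁻ z in carlesonBox I, ‖b z - ⨍ w in carlesonBox I, b w ∂(areaMeasure α)‖ₑ ∂(areaMeasure α)) /
      weightMass α ν (carlesonBox I)

/-- The weighted space `BMO_ν` of the upper half plane. -/
def MemBMO (α : ℝ) (𝒟 : Set (ℝ × ℝ)) (ν : ℂ → ℝ) (b : ℂ → ℂ) : Prop :=
  LocallyIntegrableOn b upperHalf (areaMeasure α) ∧ bmoNorm α 𝒟 ν b < ∞

/-- The weighted space `BMOA_ν`: the holomorphic members of `BMO_ν`. -/
def MemBMOA (α : ℝ) (𝒟 : Set (ℝ × ℝ)) (ν : ℂ → ℝ) (b : ℂ → ℂ) : Prop :=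
  MemBMO α 𝒟 ν b ∧ DifferentiableOn ℂ b upperHalf

/-- The kernel `i^{2+α} / (z - w̄)^{2+α}` of the Bergman projection `P_α` (principal branch; for
`z, w` in the upper half plane, `z - w̄` lies there too). -/
noncomputable def bergmanKernel (α : ℝ) (z w : ℂ) : ℂ :=
  Complex.I ^ ((2 + α : ℝ) : ℂ) / (z - (starRingEnd ℂ) w) ^ ((2 + α : ℝ) : ℂ)

/-- The kernel `1 / |z - w̄|^{2+α}` of the positive operator `P_α⁺`. -/
noncomputable def berezinKernel (α : ℝ) (z w : ℂ) : ℂ :=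
  ((1 / ‖z - (starRingEnd ℂ) w‖ ^ (2 + α) : ℝ) : ℂ)

/-- The integral operator `f ↦ ∫ k(·, w) f(w) dA_α(w)`: this is `P_α` for `k = bergmanKernel α` and
`P_α⁺` for `k = berezinKernel α`. -/
noncomputable def integralOperator (α : ℝ) (k : ℂ → ℂ → ℂ) (f : ℂ → ℂ) (z : ℂ) : ℂ :=
  ∫ w, k z w * f w ∂(areaMeasure α)

/-- The commutator `[b, T] f = b T f - T (b f)` of multiplication by `b` with the integral operator
`T` of kernel `k`. -/
noncomputable def commutatorOp (α : ℝ) (k : ℂ → ℂ → ℂ) (b f : ℂ → ℂ) (z : ℂ) : ℂ :=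
  b z * integralOperator α k f z - integralOperator α k (fun w => b w * f w) z

/-- Bounded measurable functions supported in a compact subset of the upper half plane.  They form
a dense subspace of `L²_α(μ)`, on which the commutators with a locally integrable `b` are defined by
absolutely convergent integrals. -/
def IsTestFunction (f : ℂ → ℂ) : Prop :=
  Measurable f ∧ (∃ M : ℝ, ∀ z, ‖f z‖ ≤ M) ∧
    ∃ S : Set ℂ, IsCompact S ∧ S ⊆ upperHalf ∧ ∀ z, z ∉ S → f z = 0

/-- The norm in `[0, ∞]` of the densely defined operator `[b, T] : L²_α(μ) → L²_α(λ)`; the commutator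
is bounded if and only if it is finite. -/
noncomputable def commutatorNorm (α : ℝ) (k : ℂ → ℂ → ℂ) (b : ℂ → ℂ) (μ lam : ℂ → ℝ) : ℝ≥0∞ :=
  sInf {N : ℝ≥0∞ | ∀ f : ℂ → ℂ, IsTestFunction f →
    eLpNorm (commutatorOp α k b f) 2 (weightedMeasure α lam) ≤
      N * eLpNorm f 2 (weightedMeasure α μ)}

/-- For every `f ∈ L²_α(μ)` the integrals that define `[b, T] f` converge absolutely at almost every
point, `[b, T] f` belongs to `L²_α(λ)`, and its norm is at most `N` times that of `f`. -/
def CommutatorBoundedOnL2 (α : ℝ) (k : ℂ → ℂ → ℂ) (b : ℂ → ℂ) (μ lam : ℂ → ℝ) (N : ℝ≥0∞) : Prop :=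
  ∀ f : ℂ → ℂ, MemLp f 2 (weightedMeasure α μ) →
    (∀ᵐ z ∂(areaMeasure α), Integrable (fun w => k z w * f w) (areaMeasure α) ∧
      Integrable (fun w => k z w * (b w * f w)) (areaMeasure α)) ∧
    MemLp (commutatorOp α k b f) 2 (weightedMeasure α lam) ∧
    eLpNorm (commutatorOp α k b f) 2 (weightedMeasure α lam) ≤
      N * eLpNorm f 2 (weightedMeasure α μ)

/-! Only the modulus of the kernel matters for the upper bound, and only its almost constancy on
distant boxes for the lower bound; so the two operators are treated together, through
`HasBergmanModulus` and `IsAlmostConstantFar`.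

Upper bound. For holomorphic `b` with `M = ‖b‖_{BMO_ν}`, the kernel of the commutator is dominated
pointwise by that of `P_α⁺ ν P_α⁺`: `|b z - b v| |z - v̄|^{-(2+α)} ≤ C M ∫ |z - ū|^{-(2+α)} ν(u) |u
- v̄|^{-(2+α)} dA_α(u)` (`exists_enorm_sub_mul_kernel_le`). To see this, join `z` to `v` by boxes
above `z` of size `2^k Im z`, up to size about `|z - v̄|`, and likewise above `v`. The mean value
property starts the chain, the oscillation condition bounds every link by a `ν`-average over a box,
and a geometric sum turns these averages into the integral. Since `ν² λ = μ`, multiplication by `ν`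
is isometric from `L²(μ)` to `L²(λ)`, so boundedness of `P_α⁺` on both spaces suffices
(`HasBergmanModulus.commutator_bound`). That boundedness (`exists_lintegral_positiveOp_sq_le`)
follows by dominating `P_α⁺` by the positive dyadic operators of the two adjacent systems and
estimating their bilinear forms with two Carleson embeddings, one for each of the reciprocal
weights.

Lower bound, for arbitrary `b`. Given a box `Q_I`, translate it horizontally by a large multiple of
its side to a box `Q_{I'}`. There the kernel is nearly a constant of known modulus, so testing the
commutator on the indicators of the two boxes, with duality between `L²(λ)` and `L²(λ⁻¹)`, controls
`∫∫ |b z - b w|` over `Q_I × Q_{I'}`. The variation of the kernel produces a fraction of the same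
double integral, which is absorbed after truncating the boxes away from the real line to make it
finite. The factor `(μ(Q_J) λ⁻¹(Q_J))^{1/2}` coming from a common larger box `Q_J` is bounded by a
multiple of `ν(Q_I)` (`IntermediateWeight.mass_mul_mass_le`); see
`exists_bmoNorm_le_commutatorNorm`.

The bound on all of `L²_α(μ)` with the norm computed on test functions follows by truncation,
dominated convergence and Fatou (`commutatorBoundedOnL2_of_integrable`). -/

/-! ### The area measure of rectangles and Carleson boxes. -/

theorem measurableSet_upperHalf : MeasurableSet upperHalf :=
  measurableSet_lt measurable_const Complex.measurable_im

theorem measurableSet_carlesonBox (I : ℝ × ℝ) : MeasurableSet (carlesonBox I) :=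
  (Complex.measurable_re measurableSet_Ico).inter (Complex.measurable_im measurableSet_Ioo)

instance areaMeasure_sFinite (α : ℝ) : SFinite (areaMeasure α) := by
  unfold areaMeasure; infer_instance

theorem measurable_areaDensity (α : ℝ) :
    Measurable fun z : ℂ => ENNReal.ofReal (1 / Real.pi * (α + 1) * (2 * z.im) ^ α) := by
  fun_prop

theorem areaMeasure_compl_upperHalf (α : ℝ) : areaMeasure α upperHalfᶜ = 0 := by
  have h : (volume.restrict upperHalf) upperHalfᶜ = 0 := by
    rw [Measure.restrict_apply measurableSet_upperHalf.compl]; simp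
  exact withDensity_absolutelyContinuous _ _ h

theorem ae_mem_upperHalf (α : ℝ) : ∀ᵐ z ∂(areaMeasure α), z ∈ upperHalf :=
  areaMeasure_compl_upperHalf α

/-- The half-open rectangle `[s, t) × (u, v)`. -/
def rectangle (s t u v : ℝ) : Set ℂ := {z | z.re ∈ Set.Ico s t ∧ z.im ∈ Set.Ioo u v}

theorem measurableSet_rectangle (s t u v : ℝ) : MeasurableSet (rectangle s t u v) :=
  (Complex.measurable_re measurableSet_Ico).inter (Complex.measurable_im measurableSet_Ioo)

theorem carlesonBox_eq_rectangle (I : ℝ × ℝ) :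
    carlesonBox I = rectangle I.1 I.2 0 (I.2 - I.1) := rfl

theorem lintegral_Ioo_area_density {α : ℝ} (hα : -1 < α) {u v : ℝ} (hu : 0 ≤ u) (huv : u ≤ v) :
    ∫⁻ y in Set.Ioo u v, ENNReal.ofReal (1 / Real.pi * (α + 1) * (2 * y) ^ α) =
      ENNReal.ofReal (2 ^ α / Real.pi * (v ^ (α + 1) - u ^ (α + 1))) := by
  have hint : IntervalIntegrable (fun y : ℝ => y ^ α) volume u v :=
    intervalIntegral.intervalIntegrable_rpow' hα
  have h1 : ∫ y in Set.Ioo u v, 1 / Real.pi * (α + 1) * (2 : ℝ) ^ α * y ^ α =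
      2 ^ α / Real.pi * (v ^ (α + 1) - u ^ (α + 1)) := by
    rw [← integral_Ioc_eq_integral_Ioo, ← intervalIntegral.integral_of_le huv,
      intervalIntegral.integral_const_mul, integral_rpow (Or.inl hα)]
    have : α + 1 ≠ 0 := by linarith
    field_simp
  rw [← h1, ofReal_integral_eq_lintegral_ofReal]
  · refine setLIntegral_congr_fun measurableSet_Ioo fun y hy => ?_
    have hy0 : 0 ≤ y := hu.trans hy.1.le
    rw [Real.mul_rpow zero_le_two hy0]
    ring_nf
  · have := (intervalIntegrable_iff_integrableOn_Ioo_of_le huv).1 hint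
    exact this.const_mul _
  · refine (ae_restrict_iff' measurableSet_Ioo).2 (Filter.Eventually.of_forall fun y hy => ?_)
    have hy0 : 0 ≤ y := hu.trans hy.1.le
    have : 0 < α + 1 := by linarith
    simp only [Pi.zero_apply]
    positivity

theorem areaMeasure_rectangle {α : ℝ} (hα : -1 < α) (s t : ℝ) {u v : ℝ}
    (hu : 0 ≤ u) (huv : u ≤ v) :
    areaMeasure α (rectangle s t u v) =
      ENNReal.ofReal (t - s) *
        ENNReal.ofReal (2 ^ α / Real.pi * (v ^ (α + 1) - u ^ (α + 1))) := by
  have hsub : rectangle s t u v ∩ upperHalf = rectangle s t u v :=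
    Set.inter_eq_left.2 fun z hz => lt_of_le_of_lt hu hz.2.1
  have hpre : rectangle s t u v =
      Complex.measurableEquivRealProd ⁻¹' (Set.Ico s t ×ˢ Set.Ioo u v) := by
    ext z; simp [rectangle]
  have hm : Measurable fun p : ℝ × ℝ =>
      ENNReal.ofReal (1 / Real.pi * (α + 1) * (2 * p.2) ^ α) := by fun_prop
  have hm' : Measurable fun y : ℝ =>
      ENNReal.ofReal (1 / Real.pi * (α + 1) * (2 * y) ^ α) := by fun_prop
  rw [areaMeasure, withDensity_apply _ (measurableSet_rectangle s t u v),
    Measure.restrict_restrict (measurableSet_rectangle s t u v), hsub, hpre]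
  have h := Complex.volume_preserving_equiv_real_prod.setLIntegral_comp_preimage
    (measurableSet_Ico.prod measurableSet_Ioo : MeasurableSet (Set.Ico s t ×ˢ Set.Ioo u v)) hm
  simp only [Complex.measurableEquivRealProd_apply] at h
  rw [h, Measure.volume_eq_prod, ← Measure.prod_restrict]
  have h2 := lintegral_prod_mul (μ := volume.restrict (Set.Ico s t))
    (ν := volume.restrict (Set.Ioo u v)) (f := fun _ => 1) aemeasurable_const hm'.aemeasurable
  simp only [one_mul, lintegral_one, Measure.restrict_apply_univ, Real.volume_Ico] at h2
  rw [h2, lintegral_Ioo_area_density hα hu huv]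

/-- The constant `a` with `A_α(Q_I) = a |I|^(2+α)`. -/
noncomputable def boxConst (α : ℝ) : ℝ := 2 ^ α / Real.pi

theorem boxConst_pos (α : ℝ) : 0 < boxConst α := by
  unfold boxConst; positivity

theorem areaMeasure_carlesonBox {α : ℝ} (hα : -1 < α) {I : ℝ × ℝ} (hI : I.1 < I.2) :
    areaMeasure α (carlesonBox I) =
      ENNReal.ofReal (boxConst α * (I.2 - I.1) ^ (2 + α)) := by
  have hL : 0 < I.2 - I.1 := sub_pos.2 hI
  rw [carlesonBox_eq_rectangle, areaMeasure_rectangle hα _ _ le_rfl hL.le,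
    ← ENNReal.ofReal_mul hL.le, Real.zero_rpow (by linarith : α + 1 ≠ 0),
    show (2 + α) = (α + 1) + 1 by ring, Real.rpow_add_one hL.ne' (α + 1), boxConst]
  congr 1; ring

theorem areaMeasure_carlesonBox_ne_zero {α : ℝ} (hα : -1 < α) {I : ℝ × ℝ} (hI : I.1 < I.2) :
    areaMeasure α (carlesonBox I) ≠ 0 := by
  have hL : 0 < I.2 - I.1 := sub_pos.2 hI
  have := boxConst_pos α
  rw [areaMeasure_carlesonBox hα hI]
  simp only [ne_eq, ENNReal.ofReal_eq_zero, not_le]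
  positivity

theorem areaMeasure_carlesonBox_ne_top {α : ℝ} (hα : -1 < α) {I : ℝ × ℝ} (hI : I.1 < I.2) :
    areaMeasure α (carlesonBox I) ≠ ∞ := by
  rw [areaMeasure_carlesonBox hα hI]; exact ENNReal.ofReal_ne_top

/-- The upper half of the Carleson box over `I`. -/
def boxTop (I : ℝ × ℝ) : Set ℂ :=
  {z | z.re ∈ Set.Ico I.1 I.2 ∧ z.im ∈ Set.Ico ((I.2 - I.1) / 2) (I.2 - I.1)}

theorem measurableSet_boxTop (I : ℝ × ℝ) : MeasurableSet (boxTop I) :=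
  (Complex.measurable_re measurableSet_Ico).inter (Complex.measurable_im measurableSet_Ico)

/-- By homogeneity the top half carries the fixed fraction `1 - 2^{-(α+1)}` of the box, positive
because `α > -1`. This allows the tops, which are disjoint for different dyadic boxes of one system,
to stand in for the overlapping boxes. -/
theorem exists_areaMeasure_carlesonBox_le_boxTop {α : ℝ} (hα : -1 < α) :
    ∃ C : ℝ≥0, ∀ I : ℝ × ℝ, I.1 < I.2 →
      areaMeasure α (carlesonBox I) ≤ C * areaMeasure α (boxTop I) := by
  have h1 : 0 < 1 - (1 / 2 : ℝ) ^ (α + 1) := by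
    have := Real.rpow_lt_one (x := 1 / 2) (by norm_num) (by norm_num)
      (by linarith : 0 < α + 1)
    linarith
  refine ⟨((1 - (1 / 2 : ℝ) ^ (α + 1))⁻¹).toNNReal, fun I hI => ?_⟩
  change _ ≤ ENNReal.ofReal _ * _
  have hL : 0 < I.2 - I.1 := sub_pos.2 hI
  have hsub : rectangle I.1 I.2 ((I.2 - I.1) / 2) (I.2 - I.1) ⊆ boxTop I :=
    fun z hz => ⟨hz.1, hz.2.1.le, hz.2.2⟩
  refine le_trans ?_ (mul_le_mul_right (measure_mono hsub) _)
  rw [areaMeasure_rectangle hα _ _ (by positivity) (by linarith),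
    areaMeasure_carlesonBox hα hI, ← ENNReal.ofReal_mul hL.le,
    ← ENNReal.ofReal_mul (inv_nonneg.2 h1.le)]
  refine ENNReal.ofReal_le_ofReal (le_of_eq ?_)
  have e1 : (I.2 - I.1) ^ (2 + α) = (I.2 - I.1) ^ (α + 1) * (I.2 - I.1) := by
    rw [show (2 + α) = (α + 1) + 1 by ring, Real.rpow_add_one hL.ne' (α + 1)]
  have e2 : ((I.2 - I.1) / 2) ^ (α + 1) = (I.2 - I.1) ^ (α + 1) * (1 / 2) ^ (α + 1) := by
    rw [← Real.mul_rpow hL.le (by norm_num)]; congr 1; ring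
  rw [e1, e2, boxConst]
  field_simp

/-! ### Cauchy–Schwarz for integrals and sums in `[0, ∞]`. -/

section CauchySchwarz

variable {X : Type*} [MeasurableSpace X]

theorem lintegral_mul_sq_le (τ : Measure X) {f g : X → ℝ≥0∞} (hf : AEMeasurable f τ)
    (hg : AEMeasurable g τ) :
    (∫⁻ x, f x * g x ∂τ) ^ 2 ≤ (∫⁻ x, f x ^ 2 ∂τ) * ∫⁻ x, g x ^ 2 ∂τ := by
  have h := ENNReal.lintegral_mul_le_Lp_mul_Lq τ Real.HolderConjugate.two_two hf hg
  simp only [Pi.mul_apply, ENNReal.rpow_two] at h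
  calc _ ≤ ((∫⁻ x, f x ^ 2 ∂τ) ^ (1 / 2 : ℝ) * (∫⁻ x, g x ^ 2 ∂τ) ^ (1 / 2 : ℝ)) ^ 2 := by gcongr
    _ = _ := by
      rw [mul_pow, ← ENNReal.rpow_two, ← ENNReal.rpow_two, ← ENNReal.rpow_mul, ← ENNReal.rpow_mul]
      norm_num

theorem lintegral_sq_le (τ : Measure X) {f : X → ℝ≥0∞} (hf : AEMeasurable f τ) :
    (∫⁻ x, f x ∂τ) ^ 2 ≤ τ Set.univ * ∫⁻ x, f x ^ 2 ∂τ := by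
  have h := lintegral_mul_sq_le τ (f := fun _ => 1) aemeasurable_const hf
  simpa using h

theorem ENNReal.tsum_mul_sq_le {ι : Type*} (f g : ι → ℝ≥0∞) :
    (∑' i, f i * g i) ^ 2 ≤ (∑' i, f i ^ 2) * ∑' i, g i ^ 2 := by
  let _ : MeasurableSpace ι := ⊤
  have h := lintegral_mul_sq_le (Measure.count : Measure ι) (f := f) (g := g)
    measurable_from_top.aemeasurable measurable_from_top.aemeasurable
  simpa only [lintegral_count] using h

end CauchySchwarz

/-! ### Dyadic intervals and the tree of their boxes. -/

/-- The interval of generation `k` and position `m` of a dyadic system. -/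
noncomputable def DyadicSystem.interval (D : DyadicSystem) (k m : ℤ) : ℝ × ℝ :=
  (D.offset k + m * (2 : ℝ) ^ (-k), D.offset k + (m + 1) * (2 : ℝ) ^ (-k))

theorem DyadicSystem.interval_length (D : DyadicSystem) (k m : ℤ) :
    (D.interval k m).2 - (D.interval k m).1 = (2 : ℝ) ^ (-k) := by
  simp only [interval]; ring

theorem DyadicSystem.interval_lt (D : DyadicSystem) (k m : ℤ) :
    (D.interval k m).1 < (D.interval k m).2 := by
  rw [← sub_pos, D.interval_length]; positivity

theorem DyadicSystem.lt_of_mem_intervals {D : DyadicSystem} {I : ℝ × ℝ} (hI : I ∈ D.intervals) :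
    I.1 < I.2 := by
  obtain ⟨k, m, rfl⟩ := hI
  exact D.interval_lt k m

theorem DyadicSystem.mem_interval_iff (D : DyadicSystem) (k m : ℤ) (x : ℝ) :
    x ∈ Set.Ico (D.interval k m).1 (D.interval k m).2 ↔
      ⌊(x - D.offset k) / (2 : ℝ) ^ (-k)⌋ = m := by
  have h : (0 : ℝ) < 2 ^ (-k) := by positivity
  rw [Int.floor_eq_iff, le_div_iff₀ h, div_lt_iff₀ h]
  simp only [interval, Set.mem_Ico]
  constructor <;> rintro ⟨h1, h2⟩ <;> constructor <;> linarith

theorem DyadicSystem.pairwise_disjoint_carlesonBox (D : DyadicSystem) (k : ℤ) :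
    Pairwise (Function.onFun Disjoint fun m => carlesonBox (D.interval k m)) := by
  intro m m' hne
  refine Set.disjoint_left.2 fun z hz hz' => hne ?_
  rw [← (D.mem_interval_iff k m z.re).1 hz.1, ← (D.mem_interval_iff k m' z.re).1 hz'.1]

theorem DyadicSystem.tsum_measure_carlesonBox_le (D : DyadicSystem) (k : ℤ) (τ : Measure ℂ) :
    ∑' m, τ (carlesonBox (D.interval k m)) ≤ τ Set.univ := by
  rw [← measure_iUnion (D.pairwise_disjoint_carlesonBox k) fun m => measurableSet_carlesonBox _]
  exact measure_mono (Set.subset_univ _)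

/-- A box is its top half together with the boxes over the two halves of its base. The formula is
for all measures at once, so that measures with a density also give the splitting of integrals; the
shift `n` serves the whole generation. -/
theorem DyadicSystem.exists_children (D : DyadicSystem) (k : ℤ) :
    ∃ n : ℤ, ∀ (τ : Measure ℂ) (m : ℤ), τ (carlesonBox (D.interval k m)) =
      τ (boxTop (D.interval k m)) + τ (carlesonBox (D.interval (k + 1) (n + 2 * m))) +
        τ (carlesonBox (D.interval (k + 1) (n + 2 * m + 1))) := by
  obtain ⟨n, hn⟩ := D.nested k
  refine ⟨n, fun τ m => ?_⟩
  have h2 : (2 : ℝ) ^ (-k) = 2 * 2 ^ (-(k + 1)) := by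
    rw [show -k = -(k + 1) + 1 by ring, zpow_add₀ two_ne_zero]; ring
  have hp : (0 : ℝ) < 2 ^ (-(k + 1)) := by positivity
  set h : ℝ := 2 ^ (-(k + 1)) with hh
  have e : carlesonBox (D.interval k m) =
      boxTop (D.interval k m) ∪ carlesonBox (D.interval (k + 1) (n + 2 * m)) ∪
        carlesonBox (D.interval (k + 1) (n + 2 * m + 1)) := by
    ext z
    simp only [carlesonBox, boxTop, Set.mem_ofPred_eq, Set.mem_union, D.interval_length]
    simp only [DyadicSystem.interval, Set.mem_Ico, Set.mem_Ioo, ← hh, h2, hn]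
    push_cast
    constructor
    · rintro ⟨⟨h1, h3⟩, h4, h5⟩
      rcases le_or_gt h z.im with h6 | h6
      · left; left; exact ⟨⟨h1, h3⟩, by linarith, h5⟩
      · rcases lt_or_ge z.re (D.offset (k + 1) + (n + 2 * m + 1) * h) with h7 | h7
        · left; right; exact ⟨⟨by linarith, h7⟩, h4, h6⟩
        · right; exact ⟨⟨h7, by linarith⟩, h4, h6⟩
    · rintro ((⟨⟨h1, h3⟩, h4, h5⟩ | ⟨⟨h1, h3⟩, h4, h5⟩) | ⟨⟨h1, h3⟩, h4, h5⟩)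
      · exact ⟨⟨h1, h3⟩, by linarith, h5⟩
      · exact ⟨⟨by linarith, by linarith⟩, h4, by linarith⟩
      · exact ⟨⟨by linarith, by linarith⟩, h4, by linarith⟩
  have d1 : ∀ m', Disjoint (boxTop (D.interval k m)) (carlesonBox (D.interval (k + 1) m')) := by
    refine fun m' => Set.disjoint_left.2 fun z hz hz' => ?_
    have h1 := hz.2.1
    have h3 := hz'.2.2
    rw [D.interval_length] at h1 h3
    rw [h2] at h1
    linarith
  have d2 := D.pairwise_disjoint_carlesonBox (k + 1)
    (show n + 2 * m ≠ n + 2 * m + 1 by omega)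
  rw [e, measure_union (Set.disjoint_union_left.2 ⟨d1 _, d2⟩) (measurableSet_carlesonBox _),
    measure_union (d1 _) (measurableSet_carlesonBox _)]

theorem tsum_children (n : ℤ) (h : ℤ → ℝ≥0∞) :
    ∑' m, (h (n + 2 * m) + h (n + 2 * m + 1)) = ∑' m, h m := by
  let e : ℤ ⊕ ℤ → ℤ := Sum.elim (fun m => n + 2 * m) fun m => n + 2 * m + 1
  have he : Function.Bijective e := by
    constructor
    · rintro (a | a) (b | b) hab <;> simp only [e, Sum.elim_inl, Sum.elim_inr] at hab
      · congr 1; omega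
      · omega
      · omega
      · congr 1; omega
    · intro m
      rcases Int.even_or_odd' (m - n) with ⟨j, hj | hj⟩
      · exact ⟨Sum.inl j, by simp only [e, Sum.elim_inl]; omega⟩
      · exact ⟨Sum.inr j, by simp only [e, Sum.elim_inr]; omega⟩
  rw [ENNReal.tsum_add, ← (Equiv.ofBijective e he).tsum_eq h,
    Summable.tsum_sum ENNReal.summable ENNReal.summable]
  rfl

/-! ### The Carleson embedding theorem. -/

/-- Cauchy–Schwarz with masses `t/4, S₁/2, S₂/2` against `4X, 2X₁, 2X₂` bounds `(a + F₁ + F₂)²`.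
With `S = t + S₁ + S₂` these masses add up to `(2S - t)/4`, and `(2S + t)(2S - t)/4 = S² - t²/4 ≤
S²`. Here `t, S₁, S₂` are the masses of the top and of the two children, and `a, F₁, F₂` the
integrals over them. -/
theorem embedding_node_inequality_real {t S₁ S₂ a F₁ F₂ X X₁ X₂ : ℝ} (ht : 0 ≤ t) (hS₁ : 0 ≤ S₁)
    (hS₂ : 0 ≤ S₂) (ha : 0 ≤ a) (hF₁ : 0 ≤ F₁) (hF₂ : 0 ≤ F₂) (hX : 0 ≤ X) (hX₁ : 0 ≤ X₁)
    (hX₂ : 0 ≤ X₂) (h : a ^ 2 ≤ t * X) (h₁ : F₁ ^ 2 ≤ S₁ * X₁) (h₂ : F₂ ^ 2 ≤ S₂ * X₂) :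
    (t + 2 * (t + S₁ + S₂)) * (a + F₁ + F₂) ^ 2 ≤
      (t + S₁ + S₂) ^ 2 * (4 * X + 2 * X₁ + 2 * X₂) := by
  have cross : ∀ {p q x y X Y : ℝ}, 0 ≤ p → 0 ≤ q → 0 ≤ x → 0 ≤ y → 0 ≤ X → 0 ≤ Y →
      x ^ 2 ≤ p * X → y ^ 2 ≤ q * Y → 2 * (x * y) ≤ p * Y + q * X := by
    intro p q x y X Y hp hq hx hy hX hY h1 h2
    have h3 : (2 * (x * y)) ^ 2 ≤ (p * Y + q * X) ^ 2 := by
      have h4 : x ^ 2 * y ^ 2 ≤ (p * X) * (q * Y) := mul_le_mul h1 h2 (sq_nonneg _) (by positivity)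
      nlinarith [sq_nonneg (p * Y - q * X)]
    exact le_of_sq_le_sq h3 (by positivity)
  have c1 := cross (p := t / 4) (q := S₁ / 2) (X := 4 * X) (Y := 2 * X₁) (by positivity)
    (by positivity) ha hF₁ (by positivity) (by positivity) (by linarith) (by linarith)
  have c2 := cross (p := t / 4) (q := S₂ / 2) (X := 4 * X) (Y := 2 * X₂) (by positivity)
    (by positivity) ha hF₂ (by positivity) (by positivity) (by linarith) (by linarith)
  have c3 := cross (p := S₁ / 2) (q := S₂ / 2) (X := 2 * X₁) (Y := 2 * X₂) (by positivity)
    (by positivity) hF₁ hF₂ (by positivity) (by positivity) (by linarith) (by linarith)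
  set Y := 4 * X + 2 * X₁ + 2 * X₂ with hY
  have hY0 : 0 ≤ Y := by positivity
  have key : (a + F₁ + F₂) ^ 2 ≤ (t / 4 + S₁ / 2 + S₂ / 2) * Y := by
    rw [hY]; nlinarith
  calc _ ≤ (t + 2 * (t + S₁ + S₂)) * ((t / 4 + S₁ / 2 + S₂ / 2) * Y) := by gcongr
    _ = ((t + S₁ + S₂) ^ 2 - t ^ 2 / 4) * Y := by ring
    _ ≤ _ := mul_le_mul_of_nonneg_right (by nlinarith [sq_nonneg t]) hY0

theorem embedding_node_inequality {t S₁ S₂ a F₁ F₂ X X₁ X₂ : ℝ≥0∞} (ht : t ≠ ∞) (hS₁ : S₁ ≠ ∞)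
    (hS₂ : S₂ ≠ ∞) (h : a ^ 2 ≤ t * X) (h₁ : F₁ ^ 2 ≤ S₁ * X₁) (h₂ : F₂ ^ 2 ≤ S₂ * X₂) :
    t * ((a + F₁ + F₂) / (t + S₁ + S₂)) ^ 2 + 2 * ((a + F₁ + F₂) ^ 2 / (t + S₁ + S₂)) ≤
      4 * X + 2 * X₁ + 2 * X₂ := by
  by_cases hX : X = ∞
  · simp [hX]
  by_cases hX₁ : X₁ = ∞
  · simp [hX₁]
  by_cases hX₂ : X₂ = ∞
  · simp [hX₂]
  have fin : ∀ {x s y : ℝ≥0∞}, s ≠ ∞ → y ≠ ∞ → x ^ 2 ≤ s * y → x ≠ ∞ := by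
    rintro x s y hs hy hx rfl
    exact ENNReal.mul_ne_top hs hy (top_le_iff.1 (by simpa using hx))
  have ha := fin ht hX h
  have hF₁ := fin hS₁ hX₁ h₁
  have hF₂ := fin hS₂ hX₂ h₂
  lift t to ℝ≥0 using ht
  lift S₁ to ℝ≥0 using hS₁
  lift S₂ to ℝ≥0 using hS₂
  lift a to ℝ≥0 using ha
  lift F₁ to ℝ≥0 using hF₁
  lift F₂ to ℝ≥0 using hF₂
  lift X to ℝ≥0 using hX
  lift X₁ to ℝ≥0 using hX₁
  lift X₂ to ℝ≥0 using hX₂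
  norm_cast at h h₁ h₂
  have hr := embedding_node_inequality_real t.2 S₁.2 S₂.2 a.2 F₁.2 F₂.2 X.2 X₁.2 X₂.2
    (mod_cast h) (mod_cast h₁) (mod_cast h₂)
  -- For a box of mass zero all integrals vanish as well, so the quotients are `0 / 0 = 0`.
  by_cases hS : t + S₁ + S₂ = 0
  · have h0 : t = 0 ∧ S₁ = 0 ∧ S₂ = 0 := by
      simpa [add_eq_zero, and_assoc] using hS
    obtain ⟨rfl, rfl, rfl⟩ := h0
    simp only [zero_mul, nonpos_iff_eq_zero, pow_eq_zero_iff, ne_eq, OfNat.ofNat_ne_zero,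
      not_false_eq_true] at h h₁ h₂
    subst h h₁ h₂
    simp
  · have e : ∀ x : ℝ≥0, (x : ℝ≥0∞) / ((t + S₁ + S₂ : ℝ≥0) : ℝ≥0∞) =
        ((x / (t + S₁ + S₂) : ℝ≥0) : ℝ≥0∞) := fun x => (ENNReal.coe_div hS).symm
    have goal : t * ((a + F₁ + F₂) / (t + S₁ + S₂)) ^ 2 +
        2 * ((a + F₁ + F₂) ^ 2 / (t + S₁ + S₂)) ≤ 4 * X + 2 * X₁ + 2 * X₂ := by
      rw [← NNReal.coe_le_coe]
      push_cast
      have hS' : 0 < (t + S₁ + S₂ : ℝ) := by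
        have := pos_iff_ne_zero.2 hS
        exact_mod_cast this
      have e2 : (t : ℝ) * ((a + F₁ + F₂) / (t + S₁ + S₂)) ^ 2 +
          2 * ((a + F₁ + F₂) ^ 2 / (t + S₁ + S₂)) =
          ((t + 2 * (t + S₁ + S₂)) * (a + F₁ + F₂) ^ 2) / (t + S₁ + S₂) ^ 2 := by
        field_simp
      rw [e2, div_le_iff₀ (by positivity), mul_comm (4 * (X : ℝ) + 2 * X₁ + 2 * X₂)]
      exact hr
    have := ENNReal.coe_le_coe.2 goal
    push_cast at this
    rw [ENNReal.coe_div hS, ENNReal.coe_div hS] at this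
    push_cast at this
    exact this

section Embedding

variable (D : DyadicSystem) (σ : Measure ℂ) (φ : ℂ → ℝ≥0∞)

theorem setLIntegral_sq_le (hφ : AEMeasurable φ σ) (E : Set ℂ) :
    (∫⁻ z in E, φ z ∂σ) ^ 2 ≤ σ E * ∫⁻ z in E, φ z ^ 2 ∂σ := by
  simpa using lintegral_sq_le (σ.restrict E) hφ.restrict

theorem ENNReal.sq_div_le_of_sq_le_mul {x s y : ℝ≥0∞} (h : x ^ 2 ≤ s * y) :
    x ^ 2 / s ≤ y :=
  ENNReal.div_le_of_le_mul' h

/-- A Bellman function argument. The potential `2 (∫_Q φ)² / σ(Q)` is added so that the induction on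
the number of generations closes: by the node inequality, one generation of the sum plus the
potential of a box is paid for by `4 ∫ φ²` over its top and the potentials of its children. -/
theorem DyadicSystem.sum_embedding_le (hσ : ∀ k m, σ (carlesonBox (D.interval k m)) ≠ ∞)
    (hφ : AEMeasurable φ σ) (n : ℕ) : ∀ k : ℤ,
    ∑ j ∈ Finset.range n, ∑' m, σ (boxTop (D.interval (k + j) m)) *
        ((∫⁻ z in carlesonBox (D.interval (k + j) m), φ z ∂σ) /
          σ (carlesonBox (D.interval (k + j) m))) ^ 2 +
      ∑' m, 2 * ((∫⁻ z in carlesonBox (D.interval k m), φ z ∂σ) ^ 2 /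
          σ (carlesonBox (D.interval k m))) ≤
      4 * ∑' m, ∫⁻ z in carlesonBox (D.interval k m), φ z ^ 2 ∂σ := by
  induction n with
  | zero =>
    intro k
    rw [Finset.sum_range_zero, zero_add, ← ENNReal.tsum_mul_left]
    refine ENNReal.tsum_le_tsum fun m => ?_
    calc _ ≤ 2 * ∫⁻ z in carlesonBox (D.interval k m), φ z ^ 2 ∂σ := by
          gcongr
          exact ENNReal.sq_div_le_of_sq_le_mul (setLIntegral_sq_le σ φ hφ _)
      _ ≤ _ := by gcongr; norm_num
  | succ n ih =>
    intro k
    obtain ⟨N, hN⟩ := D.exists_children k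
    have hF := hN (σ.withDensity φ)
    have hZ := hN (σ.withDensity fun z => φ z ^ 2)
    simp only [withDensity_apply, measurableSet_carlesonBox, measurableSet_boxTop] at hF hZ
    set E : ℤ → ℝ≥0∞ := fun k => ∑' m, σ (boxTop (D.interval k m)) *
        ((∫⁻ z in carlesonBox (D.interval k m), φ z ∂σ) /
          σ (carlesonBox (D.interval k m))) ^ 2 with hE
    set V : ℤ → ℤ → ℝ≥0∞ := fun k m => 2 * ((∫⁻ z in carlesonBox (D.interval k m), φ z ∂σ) ^ 2 /
          σ (carlesonBox (D.interval k m))) with hV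
    set W : ℤ → ℤ → ℝ≥0∞ := fun k m => ∫⁻ z in carlesonBox (D.interval k m), φ z ^ 2 ∂σ with hW
    have ih1 : ∑ j ∈ Finset.range n, E (k + 1 + j) + ∑' m, V (k + 1) m ≤
      4 * ∑' m, W (k + 1) m := ih (k + 1)
    change ∑ j ∈ Finset.range (n + 1), E (k + j) + ∑' m, V k m ≤ 4 * ∑' m, W k m
    have node : E k + ∑' m, V k m ≤
        4 * ∑' m, (∫⁻ z in boxTop (D.interval k m), φ z ^ 2 ∂σ) +
          ∑' m, (V (k + 1) (N + 2 * m) + V (k + 1) (N + 2 * m + 1)) := by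
      rw [hE, ← ENNReal.tsum_add, ← ENNReal.tsum_mul_left, ← ENNReal.tsum_add]
      refine ENNReal.tsum_le_tsum fun m => ?_
      have hc : ∀ E : Set ℂ, σ E ≠ ∞ → (∫⁻ z in E, φ z ∂σ) ^ 2 ≤
          σ E * ((∫⁻ z in E, φ z ∂σ) ^ 2 / σ E) := by
        intro E hE
        by_cases h0 : σ E = 0
        · simp [setLIntegral_measure_zero _ _ h0]
        · rw [ENNReal.mul_div_cancel h0 hE]
      have htop : σ (boxTop (D.interval k m)) ≠ ∞ := by
        have := hσ k m
        rw [hN] at this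
        simp only [ne_eq, ENNReal.add_eq_top, not_or] at this
        exact this.1.1
      simp only [hV]
      rw [hN σ m, hF m, ← add_assoc]
      exact embedding_node_inequality htop (hσ _ _) (hσ _ _) (setLIntegral_sq_le σ φ hφ _)
        (hc _ (hσ _ _)) (hc _ (hσ _ _))
    have split : ∑' m, W k m = ∑' m, (∫⁻ z in boxTop (D.interval k m), φ z ^ 2 ∂σ) +
        ∑' m, (W (k + 1) (N + 2 * m) + W (k + 1) (N + 2 * m + 1)) := by
      rw [← ENNReal.tsum_add]
      refine tsum_congr fun m => ?_
      simp only [hW]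
      rw [hZ m, add_assoc]
    rw [tsum_children] at node split
    rw [split, mul_add, Finset.sum_range_succ']
    have shift : ∑ j ∈ Finset.range n, E (k + ((j + 1 : ℕ) : ℤ)) =
        ∑ j ∈ Finset.range n, E (k + 1 + j) := by
      refine Finset.sum_congr rfl fun j _ => ?_
      congr 1; push_cast; ring
    rw [shift, Nat.cast_zero, add_zero, add_assoc]
    calc _ ≤ ∑ j ∈ Finset.range n, E (k + 1 + j) +
          (4 * ∑' m, (∫⁻ z in boxTop (D.interval k m), φ z ^ 2 ∂σ) + ∑' m, V (k + 1) m) := by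
          gcongr
      _ = 4 * ∑' m, (∫⁻ z in boxTop (D.interval k m), φ z ^ 2 ∂σ) +
          (∑ j ∈ Finset.range n, E (k + 1 + j) + ∑' m, V (k + 1) m) := by ring
      _ ≤ _ := by gcongr

/-- The Carleson embedding of `L²(σ)` for the Carleson boxes of a dyadic system. -/
theorem DyadicSystem.tsum_embedding_le (hσ : ∀ k m, σ (carlesonBox (D.interval k m)) ≠ ∞)
    (hφ : AEMeasurable φ σ) :
    ∑' p : ℤ × ℤ, σ (boxTop (D.interval p.1 p.2)) *
        ((∫⁻ z in carlesonBox (D.interval p.1 p.2), φ z ∂σ) /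
          σ (carlesonBox (D.interval p.1 p.2))) ^ 2 ≤ 4 * ∫⁻ z, φ z ^ 2 ∂σ := by
  rw [ENNReal.tsum_prod (f := fun k m => σ (boxTop (D.interval k m)) *
        ((∫⁻ z in carlesonBox (D.interval k m), φ z ∂σ) /
          σ (carlesonBox (D.interval k m))) ^ 2), ENNReal.tsum_eq_iSup_sum]
  refine iSup_le fun s => ?_
  set E : ℤ → ℝ≥0∞ := fun k => ∑' m, σ (boxTop (D.interval k m)) *
        ((∫⁻ z in carlesonBox (D.interval k m), φ z ∂σ) /
          σ (carlesonBox (D.interval k m))) ^ 2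
  obtain ⟨a, ha⟩ := s.bddBelow
  obtain ⟨b, hb⟩ := s.bddAbove
  -- A finite set of generations lies in a finite run starting at `a`, to which the induction
  -- applies with a constant independent of its length.
  have hs : s ⊆ (Finset.range (b - a + 1).toNat).image fun j : ℕ => a + (j : ℤ) := by
    intro k hk
    have h1 := ha hk
    have h2 := hb hk
    exact Finset.mem_image.2 ⟨(k - a).toNat, Finset.mem_range.2 (by omega), by omega⟩
  calc ∑ k ∈ s, E k ≤ ∑ k ∈ (Finset.range (b - a + 1).toNat).image fun j : ℕ => a + (j : ℤ), E k :=
        Finset.sum_le_sum_of_subset hs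
    _ = ∑ j ∈ Finset.range (b - a + 1).toNat, E (a + j) :=
        Finset.sum_image fun i _ j _ hij => by simpa using hij
    _ ≤ 4 * ∑' m, ∫⁻ z in carlesonBox (D.interval a m), φ z ^ 2 ∂σ :=
        le_self_add.trans (D.sum_embedding_le σ φ hσ hφ _ a)
    _ ≤ _ := by
        have h := D.tsum_measure_carlesonBox_le a (σ.withDensity fun z => φ z ^ 2)
        simp only [withDensity_apply, measurableSet_carlesonBox, MeasurableSet.univ,
          Measure.restrict_univ] at h
        gcongr

end Embedding

/-! ### Weighted `L²` bounds by duality. -/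

instance areaMeasure_sigmaFinite (α : ℝ) : SigmaFinite (areaMeasure α) := by
  exact SigmaFinite.withDensity_ofReal (μ := volume.restrict upperHalf)
    fun z : ℂ => 1 / Real.pi * (α + 1) * (2 * z.im) ^ α

section Duality

variable {X : Type*} [MeasurableSpace X]

/-- Formally one tests with `g = h u` and cancels one factor `∫ h² u`. Cancelling requires that
factor to be finite, so `h` is cut at height `n` and restricted to a set of finite measure on which
`u ≤ n`; Fatou then removes the cut. The relation `u u' = 1` in `[0, ∞]` forces both factors to be
finite and nonzero. -/
theorem lintegral_sq_mul_le_of_duality {τ : Measure X} [SigmaFinite τ] {u u' h : X → ℝ≥0∞}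
    (hu : AEMeasurable u τ) (huu' : ∀ᵐ x ∂τ, u x * u' x = 1) (hh : AEMeasurable h τ) {C : ℝ≥0∞}
    (H : ∀ g : X → ℝ≥0∞, AEMeasurable g τ →
      (∫⁻ x, g x * h x ∂τ) ^ 2 ≤ C * ∫⁻ x, g x ^ 2 * u' x ∂τ) :
    ∫⁻ x, h x ^ 2 * u x ∂τ ≤ C := by
  set E : ℕ → Set X := fun n => {x | hu.mk u x ≤ n} ∩ spanningSets τ n with hE
  have hEm : ∀ n, MeasurableSet (E n) := fun n =>
    (measurableSet_le hu.measurable_mk measurable_const).inter (measurableSet_spanningSets τ n)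
  set J : ℕ → X → ℝ≥0∞ := fun n => (E n).indicator fun x => min (h x) n ^ 2 * u x with hJ
  have hJm : ∀ n, AEMeasurable (J n) τ := fun n =>
    (((hh.min aemeasurable_const).pow_const 2).mul hu).indicator (hEm n)
  have bound : ∀ n, ∫⁻ x, J n x ∂τ ≤ C := by
    intro n
    have hfin : ∫⁻ x, J n x ∂τ ≠ ∞ := by
      refine ne_top_of_le_ne_top (b := (n : ℝ≥0∞) ^ 2 * n * τ (spanningSets τ n)) ?_ ?_
      · exact ENNReal.mul_ne_top (ENNReal.mul_ne_top (by simp) (by simp))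
          (measure_spanningSets_lt_top τ n).ne
      · calc _ ≤ ∫⁻ x, (spanningSets τ n).indicator (fun _ => (n : ℝ≥0∞) ^ 2 * n) x ∂τ := by
              refine lintegral_mono_ae ?_
              filter_upwards [hu.ae_eq_mk] with x hx
              by_cases hxE : x ∈ E n
              · simp only [hJ, Set.indicator_of_mem hxE, Set.indicator_of_mem hxE.2]
                have h1 : u x ≤ n := by rw [hx]; exact hxE.1
                gcongr
                exact min_le_right _ _
              · simp [hJ, Set.indicator_of_notMem hxE]
          _ = _ := by
              rw [lintegral_indicator_const (measurableSet_spanningSets τ n)]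
    have hg := H ((E n).indicator fun x => min (h x) n * u x)
      (((hh.min aemeasurable_const).mul hu).indicator (hEm n))
    have h1 : ∫⁻ x, J n x ∂τ ≤
        ∫⁻ x, ((E n).indicator fun x => min (h x) n * u x) x * h x ∂τ := by
      refine lintegral_mono fun x => ?_
      by_cases hxE : x ∈ E n
      · simp only [hJ, Set.indicator_of_mem hxE]
        calc _ = min (h x) n * u x * min (h x) n := by ring
          _ ≤ _ := by gcongr; exact min_le_left _ _
      · simp [hJ, Set.indicator_of_notMem hxE]
    have h2 : ∫⁻ x, ((E n).indicator fun x => min (h x) n * u x) x ^ 2 * u' x ∂τ =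
        ∫⁻ x, J n x ∂τ := by
      refine lintegral_congr_ae ?_
      filter_upwards [huu'] with x hx
      by_cases hxE : x ∈ E n
      · simp only [hJ, Set.indicator_of_mem hxE]
        calc _ = min (h x) n ^ 2 * u x * (u x * u' x) := by ring
          _ = _ := by rw [hx, mul_one]
      · simp [hJ, Set.indicator_of_notMem hxE]
    rw [h2] at hg
    have h3 : (∫⁻ x, J n x ∂τ) * ∫⁻ x, J n x ∂τ ≤ C * ∫⁻ x, J n x ∂τ := by
      rw [← sq]
      exact (by gcongr : (∫⁻ x, J n x ∂τ) ^ 2 ≤ _).trans hg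
    by_cases h0 : ∫⁻ x, J n x ∂τ = 0
    · rw [h0]; exact zero_le
    · exact (ENNReal.mul_le_mul_iff_left h0 hfin).1 h3
  have lim : ∀ᵐ x ∂τ, h x ^ 2 * u x ≤ Filter.liminf (fun n => J n x) Filter.atTop := by
    filter_upwards [huu', hu.ae_eq_mk] with x hx hx'
    have hu0 : u x ≠ ∞ := by
      intro h1
      rw [h1] at hx
      by_cases h2 : u' x = 0 <;> simp_all [ENNReal.top_mul]
    have ht : Filter.Tendsto (fun n : ℕ => min (h x) (n : ℝ≥0∞) ^ 2 * u x) Filter.atTop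
        (nhds (h x ^ 2 * u x)) := by
      refine ENNReal.Tendsto.mul_const ?_ (Or.inr hu0)
      have h1 : Filter.Tendsto (fun n : ℕ => min (h x) (n : ℝ≥0∞)) Filter.atTop
          (nhds (min (h x) ∞)) := tendsto_const_nhds.min ENNReal.tendsto_nat_nhds_top
      rw [min_top_right] at h1
      exact ENNReal.Tendsto.pow h1
    rw [← ht.liminf_eq]
    refine Filter.liminf_le_liminf ?_
    obtain ⟨n₁, hn₁⟩ := ENNReal.exists_nat_gt hu0
    have hmem : x ∈ ⋃ n, spanningSets τ n := by rw [iUnion_spanningSets]; trivial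
    obtain ⟨n₂, hn₂⟩ := Set.mem_iUnion.1 hmem
    filter_upwards [Filter.eventually_ge_atTop (max n₁ n₂)] with n hn
    have hxE : x ∈ E n := by
      refine ⟨?_, monotone_spanningSets τ (le_of_max_le_right hn) hn₂⟩
      change hu.mk u x ≤ n
      rw [← hx']
      exact hn₁.le.trans (by exact_mod_cast le_of_max_le_left hn)
    simp [hJ, Set.indicator_of_mem hxE]
  calc _ ≤ ∫⁻ x, Filter.liminf (fun n => J n x) Filter.atTop ∂τ := lintegral_mono_ae lim
    _ ≤ Filter.liminf (fun n => ∫⁻ x, J n x ∂τ) Filter.atTop := lintegral_liminf_le' hJm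
    _ ≤ C := Filter.liminf_le_of_le (by isBoundedDefault) fun b hb => by
        obtain ⟨n, hn⟩ := hb.exists
        exact hn.trans (bound n)

end Duality

/-! ### Reciprocal `B₂` weights and the positive dyadic form. -/

/-- A pair of reciprocal weights satisfying the `B₂` condition over the boxes of `𝒟`. -/
structure DualWeights (α : ℝ) (𝒟 : Set (ℝ × ℝ)) (K : ℝ≥0) (u u' : ℂ → ℝ≥0∞) : Prop where
  left : AEMeasurable u (areaMeasure α)
  right : AEMeasurable u' (areaMeasure α)
  mul_eq_one : ∀ᵐ z ∂(areaMeasure α), u z * u' z = 1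
  bound : ∀ I ∈ 𝒟, ((∫⁻ z in carlesonBox I, u z ∂(areaMeasure α)) / areaMeasure α (carlesonBox I)) *
    ((∫⁻ z in carlesonBox I, u' z ∂(areaMeasure α)) / areaMeasure α (carlesonBox I)) ≤ K

namespace DualWeights

variable {α : ℝ} {𝒟 : Set (ℝ × ℝ)} {K : ℝ≥0} {u u' : ℂ → ℝ≥0∞}

theorem symm (h : DualWeights α 𝒟 K u u') : DualWeights α 𝒟 K u' u :=
  ⟨h.right, h.left, h.mul_eq_one.mono fun z hz => by rwa [mul_comm], fun I hI => by
    rw [mul_comm]; exact h.bound I hI⟩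

theorem mono {𝒟' : Set (ℝ × ℝ)} (h : DualWeights α 𝒟 K u u') (h' : 𝒟' ⊆ 𝒟) :
    DualWeights α 𝒟' K u u' :=
  ⟨h.left, h.right, h.mul_eq_one, fun I hI => h.bound I (h' hI)⟩

theorem area_sq_le (h : DualWeights α 𝒟 K u u') (E : Set ℂ) :
    areaMeasure α E ^ 2 ≤ (∫⁻ z in E, u z ∂(areaMeasure α)) * ∫⁻ z in E, u' z ∂(areaMeasure α) := by
  have h1 := lintegral_mul_sq_le ((areaMeasure α).restrict E)
    (f := fun z => u z ^ (1 / 2 : ℝ)) (g := fun z => u' z ^ (1 / 2 : ℝ))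
    (h.left.restrict.pow_const _) (h.right.restrict.pow_const _)
  have e : ∀ x : ℝ≥0∞, (x ^ (1 / 2 : ℝ)) ^ 2 = x := fun x => by
    rw [← ENNReal.rpow_two, ← ENNReal.rpow_mul]; norm_num
  simp only [e] at h1
  refine le_trans (le_of_eq ?_) h1
  congr 1
  rw [← setLIntegral_one]
  refine lintegral_congr_ae (ae_restrict_of_ae ?_)
  filter_upwards [h.mul_eq_one] with z hz
  rw [← ENNReal.mul_rpow_of_nonneg _ _ (by norm_num), hz, ENNReal.one_rpow]

theorem mass_ne_zero (hα : -1 < α) (h : DualWeights α 𝒟 K u u') {I : ℝ × ℝ}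
    (hI : I.1 < I.2) : ∫⁻ z in carlesonBox I, u z ∂(areaMeasure α) ≠ 0 := by
  intro h0
  rw [lintegral_eq_zero_iff' h.left.restrict] at h0
  have h1 : ∀ᵐ z ∂(areaMeasure α).restrict (carlesonBox I), False := by
    filter_upwards [h0, ae_restrict_of_ae h.mul_eq_one] with z hz hz'
    simp_all
  simp only [Filter.eventually_false_iff_eq_bot, ae_eq_bot, Measure.restrict_eq_zero] at h1
  exact areaMeasure_carlesonBox_ne_zero hα hI h1

theorem mul_mass_le (hα : -1 < α) (h : DualWeights α 𝒟 K u u') {I : ℝ × ℝ} (hI : I.1 < I.2)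
    (hI' : I ∈ 𝒟) : (∫⁻ z in carlesonBox I, u z ∂(areaMeasure α)) *
      (∫⁻ z in carlesonBox I, u' z ∂(areaMeasure α)) ≤ K * areaMeasure α (carlesonBox I) ^ 2 := by
  have h0 := areaMeasure_carlesonBox_ne_zero hα hI
  have h1 := areaMeasure_carlesonBox_ne_top hα hI
  have hb := h.bound I hI'
  set A := areaMeasure α (carlesonBox I)
  set U := ∫⁻ z in carlesonBox I, u z ∂(areaMeasure α)
  set U' := ∫⁻ z in carlesonBox I, u' z ∂(areaMeasure α)
  calc U * U' = (U / A * A) * (U' / A * A) := by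
        rw [ENNReal.div_mul_cancel h0 h1, ENNReal.div_mul_cancel h0 h1]
    _ = (U / A * (U' / A)) * A ^ 2 := by ring
    _ ≤ _ := by gcongr

/-- The reciprocal weight has nonzero mass on the box, so an infinite mass here would make the
bounded product of the two masses infinite. -/
theorem mass_ne_top (hα : -1 < α) (h : DualWeights α 𝒟 K u u') {I : ℝ × ℝ} (hI : I.1 < I.2)
    (hI' : I ∈ 𝒟) : ∫⁻ z in carlesonBox I, u z ∂(areaMeasure α) ≠ ∞ := by
  intro h0
  have h1 := h.mul_mass_le hα hI hI'
  rw [h0, ENNReal.top_mul (h.symm.mass_ne_zero hα hI), top_le_iff] at h1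
  exact ENNReal.mul_ne_top (by simp) (ENNReal.pow_ne_top (areaMeasure_carlesonBox_ne_top hα hI)) h1

end DualWeights

theorem setLIntegral_withDensity_weight {α : ℝ} {u f : ℂ → ℝ≥0∞}
    (hu : AEMeasurable u (areaMeasure α)) (hf : AEMeasurable f (areaMeasure α)) {E : Set ℂ}
    (hE : MeasurableSet E) :
    ∫⁻ z in E, f z ∂(areaMeasure α).withDensity u = ∫⁻ z in E, u z * f z ∂(areaMeasure α) := by
  rw [restrict_withDensity hE, lintegral_withDensity_eq_lintegral_mul₀ hu.restrict hf.restrict]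
  rfl

/-- The bilinear form of the positive dyadic operator is bounded on `L²(u) × L²(u')`. -/
theorem exists_dyadicForm_sq_le {α : ℝ} (hα : -1 < α) (K : ℝ≥0) :
    ∃ C : ℝ≥0, ∀ (D : DyadicSystem) (u u' f g : ℂ → ℝ≥0∞), DualWeights α D.intervals K u u' →
      AEMeasurable f (areaMeasure α) → AEMeasurable g (areaMeasure α) →
      (∑' p : ℤ × ℤ, (∫⁻ z in carlesonBox (D.interval p.1 p.2), f z ∂(areaMeasure α)) *
        (∫⁻ z in carlesonBox (D.interval p.1 p.2), g z ∂(areaMeasure α)) /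
          areaMeasure α (carlesonBox (D.interval p.1 p.2))) ^ 2 ≤
      C * ((∫⁻ z, f z ^ 2 * u z ∂(areaMeasure α)) * ∫⁻ z, g z ^ 2 * u' z ∂(areaMeasure α)) := by
  obtain ⟨C₀, hC₀⟩ := exists_areaMeasure_carlesonBox_le_boxTop hα
  refine ⟨(K * C₀) ^ 2 * 16, fun D u u' f g hw hf hg => ?_⟩
  set A := areaMeasure α
  have emb : ∀ {v v' φ : ℂ → ℝ≥0∞}, DualWeights α D.intervals K v v' → AEMeasurable φ A →
      ∑' p : ℤ × ℤ, (((∫⁻ z in boxTop (D.interval p.1 p.2), v' z ∂A) ^ (1 / 2 : ℝ)) *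
        ((∫⁻ z in carlesonBox (D.interval p.1 p.2), φ z ∂A) /
          ∫⁻ z in carlesonBox (D.interval p.1 p.2), v' z ∂A)) ^ 2 ≤
      4 * ∫⁻ z, φ z ^ 2 * v z ∂A := by
    intro v v' φ hv hφ
    have hm : AEMeasurable (fun z => φ z * v z) A := hφ.mul hv.left
    have hac := withDensity_absolutelyContinuous A v'
    -- Embedding for the measure `v' dA_α` and the function `φ v`: since `v v' = 1`, its integrals
    -- over boxes are those of `φ dA_α`, and its square integral is `∫ φ² v dA_α`.
    have h := D.tsum_embedding_le (A.withDensity v') (fun z => φ z * v z)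
      (fun k m => by
        rw [withDensity_apply _ (measurableSet_carlesonBox _)]
        exact hv.symm.mass_ne_top hα (D.interval_lt k m) ⟨k, m, rfl⟩)
      (hm.mono_ac hac)
    have e1 : ∀ I : ℝ × ℝ, ∫⁻ z in carlesonBox I, φ z * v z ∂(A.withDensity v') =
        ∫⁻ z in carlesonBox I, φ z ∂A := by
      intro I
      rw [setLIntegral_withDensity_weight hv.right hm (measurableSet_carlesonBox I)]
      refine lintegral_congr_ae (ae_restrict_of_ae ?_)
      filter_upwards [hv.mul_eq_one] with z hz
      rw [mul_comm, mul_assoc, hz, mul_one]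
    have e2 : ∫⁻ z, (φ z * v z) ^ 2 ∂(A.withDensity v') = ∫⁻ z, φ z ^ 2 * v z ∂A := by
      rw [lintegral_withDensity_eq_lintegral_mul₀ hv.right (hm.pow_const 2)]
      refine lintegral_congr_ae ?_
      filter_upwards [hv.mul_eq_one] with z hz
      simp only [Pi.mul_apply]
      calc _ = φ z ^ 2 * v z * (v z * v' z) := by ring
        _ = _ := by rw [hz, mul_one]
    simp only [e1, e2, withDensity_apply, measurableSet_carlesonBox, measurableSet_boxTop] at h
    refine le_trans (le_of_eq ?_) h
    refine tsum_congr fun p => ?_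
    rw [mul_pow]
    congr 1
    rw [← ENNReal.rpow_two, ← ENNReal.rpow_mul]; norm_num
  have hf' := emb hw hf
  have hg' := emb hw.symm hg
  set a : ℤ × ℤ → ℝ≥0∞ := fun p => (((∫⁻ z in boxTop (D.interval p.1 p.2), u' z ∂A) ^ (1 / 2 : ℝ)) *
        ((∫⁻ z in carlesonBox (D.interval p.1 p.2), f z ∂A) /
          ∫⁻ z in carlesonBox (D.interval p.1 p.2), u' z ∂A))
  set b : ℤ × ℤ → ℝ≥0∞ := fun p => (((∫⁻ z in boxTop (D.interval p.1 p.2), u z ∂A) ^ (1 / 2 : ℝ)) *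
        ((∫⁻ z in carlesonBox (D.interval p.1 p.2), g z ∂A) /
          ∫⁻ z in carlesonBox (D.interval p.1 p.2), u z ∂A))
  have term : ∀ p : ℤ × ℤ, (∫⁻ z in carlesonBox (D.interval p.1 p.2), f z ∂A) *
        (∫⁻ z in carlesonBox (D.interval p.1 p.2), g z ∂A) /
          A (carlesonBox (D.interval p.1 p.2)) ≤ (K * C₀) * (a p * b p) := by
    intro p
    have hI := D.interval_lt p.1 p.2
    have hI' : D.interval p.1 p.2 ∈ D.intervals := ⟨p.1, p.2, rfl⟩
    have hA0 := areaMeasure_carlesonBox_ne_zero hα hI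
    have hA1 := areaMeasure_carlesonBox_ne_top hα hI
    have hU0 := hw.mass_ne_zero hα hI
    have hU1 := hw.mass_ne_top hα hI hI'
    have hV0 := hw.symm.mass_ne_zero hα hI
    have hV1 := hw.symm.mass_ne_top hα hI hI'
    have hUV := hw.mul_mass_le hα hI hI'
    have hT := hC₀ _ hI
    have hT2 := hw.area_sq_le (boxTop (D.interval p.1 p.2))
    simp only [a, b]
    set F := ∫⁻ z in carlesonBox (D.interval p.1 p.2), f z ∂A
    set G := ∫⁻ z in carlesonBox (D.interval p.1 p.2), g z ∂A
    set U := ∫⁻ z in carlesonBox (D.interval p.1 p.2), u z ∂A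
    set V := ∫⁻ z in carlesonBox (D.interval p.1 p.2), u' z ∂A
    set Q := A (carlesonBox (D.interval p.1 p.2))
    set T := A (boxTop (D.interval p.1 p.2))
    set tu := ∫⁻ z in boxTop (D.interval p.1 p.2), u z ∂A
    set tv := ∫⁻ z in boxTop (D.interval p.1 p.2), u' z ∂A
    have hT3 : T ≤ tv ^ (1 / 2 : ℝ) * tu ^ (1 / 2 : ℝ) := by
      rw [← ENNReal.mul_rpow_of_nonneg _ _ (by norm_num), mul_comm tv]
      calc T = (T ^ 2) ^ (1 / 2 : ℝ) := by
            rw [← ENNReal.rpow_two, ← ENNReal.rpow_mul]; norm_num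
        _ ≤ _ := by gcongr
    -- The `B₂` condition gives `U V / Q ≤ K Q`; then `Q` is replaced by the area of the top, which
    -- Cauchy–Schwarz splits between the two embeddings.
    calc F * G / Q = (F / V) * (G / U) * ((U * V) / Q) := by
          nth_rewrite 1 [← ENNReal.div_mul_cancel hV0 hV1 (b := F),
            ← ENNReal.div_mul_cancel hU0 hU1 (b := G)]
          simp only [div_eq_mul_inv]; ring
      _ ≤ (F / V) * (G / U) * (K * Q) := by
          gcongr
          refine ENNReal.div_le_of_le_mul (hUV.trans (le_of_eq ?_))
          rw [sq, mul_assoc]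
      _ ≤ (F / V) * (G / U) * (K * (C₀ * (tv ^ (1 / 2 : ℝ) * tu ^ (1 / 2 : ℝ)))) := by
          gcongr
          exact hT.trans (by gcongr)
      _ = _ := by ring
  calc _ ≤ (∑' p, ((K * C₀ : ℝ≥0∞) * (a p * b p))) ^ 2 := by
        gcongr with p; exact term p
    _ = (K * C₀) ^ 2 * (∑' p, a p * b p) ^ 2 := by rw [ENNReal.tsum_mul_left, mul_pow]
    _ ≤ (K * C₀) ^ 2 * ((∑' p, a p ^ 2) * ∑' p, b p ^ 2) := by
        gcongr; exact ENNReal.tsum_mul_sq_le a b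
    _ ≤ (K * C₀) ^ 2 * ((4 * ∫⁻ z, f z ^ 2 * u z ∂A) * (4 * ∫⁻ z, g z ^ 2 * u' z ∂A)) := by
        gcongr
    _ = _ := by push_cast; ring

/-! ### The positive operator `P_α⁺` on weighted `L²`. -/

/-- The modulus `|z - w̄|^{-(2+α)}` of the Bergman kernel. -/
noncomputable def kernelModulus (α : ℝ) (z w : ℂ) : ℝ≥0∞ :=
  ENNReal.ofReal (‖z - (starRingEnd ℂ) w‖ ^ (-(2 + α)))

/-- The positive operator `P_α⁺` acting on functions with values in `[0, ∞]`. -/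
noncomputable def positiveOp (α : ℝ) (f : ℂ → ℝ≥0∞) (z : ℂ) : ℝ≥0∞ :=
  ∫⁻ w, kernelModulus α z w * f w ∂(areaMeasure α)

theorem measurable_kernelModulus (α : ℝ) :
    Measurable (Function.uncurry (kernelModulus α)) := by
  unfold kernelModulus Function.uncurry
  have : Measurable fun w : ℂ => (starRingEnd ℂ) w := Complex.continuous_conj.measurable
  fun_prop

theorem measurable_kernelModulus_right (α : ℝ) (z : ℂ) : Measurable (kernelModulus α z) :=
  (measurable_kernelModulus α).comp measurable_prodMk_left

theorem positiveOp_congr {α : ℝ} {f g : ℂ → ℝ≥0∞} (h : f =ᵐ[areaMeasure α] g) :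
    positiveOp α f = positiveOp α g := by
  funext z
  exact lintegral_congr_ae (h.mono fun w hw => by simp only [hw])

theorem measurable_positiveOp {α : ℝ} {f : ℂ → ℝ≥0∞} (hf : AEMeasurable f (areaMeasure α)) :
    Measurable (positiveOp α f) := by
  rw [positiveOp_congr hf.ae_eq_mk]
  exact ((measurable_kernelModulus α).mul
    (hf.measurable_mk.comp measurable_snd)).lintegral_prod_right'

theorem im_add_im_le_norm_sub_conj (z w : ℂ) : z.im + w.im ≤ ‖z - (starRingEnd ℂ) w‖ := by
  have h := Complex.abs_im_le_norm (z - (starRingEnd ℂ) w)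
  simp only [Complex.sub_im, Complex.conj_im, sub_neg_eq_add] at h
  exact (le_abs_self _).trans h

theorem abs_re_sub_re_le_norm_sub_conj (z w : ℂ) :
    |z.re - w.re| ≤ ‖z - (starRingEnd ℂ) w‖ := by
  simpa using Complex.abs_re_le_norm (z - (starRingEnd ℂ) w)

theorem norm_sub_conj_le (z w : ℂ) :
    ‖z - (starRingEnd ℂ) w‖ ≤ |z.re - w.re| + |z.im + w.im| := by
  simpa using Complex.norm_le_abs_re_add_abs_im (z - (starRingEnd ℂ) w)

theorem norm_sub_conj_comm (z w : ℂ) :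
    ‖z - (starRingEnd ℂ) w‖ = ‖w - (starRingEnd ℂ) z‖ := by
  rw [← Complex.norm_conj, map_sub, Complex.conj_conj, norm_sub_rev]

theorem kernelModulus_comm (α : ℝ) (z w : ℂ) : kernelModulus α z w = kernelModulus α w z := by
  simp only [kernelModulus, norm_sub_conj_comm]

theorem norm_sub_conj_pos {z w : ℂ} (hz : z ∈ upperHalf) (hw : w ∈ upperHalf) :
    0 < ‖z - (starRingEnd ℂ) w‖ :=
  (add_pos hz hw).trans_le (im_add_im_le_norm_sub_conj z w)

theorem AdjacentSystems.one_lt {κ : ℝ} {D₁ D₂ : DyadicSystem} (h : AdjacentSystems κ D₁ D₂) :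
    1 < κ := by
  obtain ⟨I, -, h1, h2⟩ := h 0 1 one_pos
  have h3 := (h1 (Set.left_mem_Icc.2 zero_le_one)).1
  have h4 := (h1 (Set.right_mem_Icc.2 zero_le_one)).2
  linarith

/-- Two points of the upper half plane lie in a common box of size comparable to `|z - w̄|`. -/
theorem AdjacentSystems.exists_box_kernel_le {α κ : ℝ} (hα : -1 < α) {D₁ D₂ : DyadicSystem}
    (h : AdjacentSystems κ D₁ D₂) {z w : ℂ} (hz : z ∈ upperHalf) (hw : w ∈ upperHalf) :
    ∃ I ∈ D₁.intervals ∪ D₂.intervals, z ∈ carlesonBox I ∧ w ∈ carlesonBox I ∧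
      kernelModulus α z w ≤
        ENNReal.ofReal (κ ^ (2 + α) * boxConst α) / areaMeasure α (carlesonBox I) := by
  set d := ‖z - (starRingEnd ℂ) w‖ with hd
  have hd0 : 0 < d := norm_sub_conj_pos hz hw
  have him := im_add_im_le_norm_sub_conj z w
  have hre := abs_le.1 (abs_re_sub_re_le_norm_sub_conj z w)
  have hz' : 0 < z.im := hz
  have hw' : 0 < w.im := hw
  rw [← hd] at him hre
  -- An interval of length `d = |z - w̄|` contains both real parts, and `d` is at least the sum of
  -- the imaginary parts, so any box above a covering interval is high enough for both points.
  obtain ⟨I, hI, hsub, hlen⟩ := h (min z.re w.re) (min z.re w.re + d) (by linarith)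
  have h1 := hsub (Set.left_mem_Icc.2 (by linarith))
  have h2 := hsub (Set.right_mem_Icc.2 (by linarith))
  have hL : d < I.2 - I.1 := by linarith [h1.1, h2.2]
  have hI0 : I.1 < I.2 := by linarith
  have hmin : z.re ≤ min z.re w.re + d ∧ w.re ≤ min z.re w.re + d := by
    rcases min_cases z.re w.re with h | h <;> constructor <;> linarith
  refine ⟨I, hI, ⟨hsub ⟨min_le_left _ _, hmin.1⟩, hz', by linarith⟩,
    ⟨hsub ⟨min_le_right _ _, hmin.2⟩, hw', by linarith⟩, ?_⟩
  have hκ := h.one_lt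
  have ha := boxConst_pos α
  have hL0 : 0 < I.2 - I.1 := by linarith
  rw [areaMeasure_carlesonBox hα hI0, ← ENNReal.ofReal_div_of_pos (by positivity), kernelModulus]
  refine ENNReal.ofReal_le_ofReal ?_
  rw [← hd, Real.rpow_neg hd0.le, le_div_iff₀ (by positivity), inv_mul_le_iff₀ (by positivity)]
  have : (I.2 - I.1) ^ (2 + α) ≤ d ^ (2 + α) * κ ^ (2 + α) := by
    rw [← Real.mul_rpow hd0.le (by linarith)]
    exact Real.rpow_le_rpow hL0.le (by linarith) (by linarith)
  calc _ ≤ boxConst α * (d ^ (2 + α) * κ ^ (2 + α)) := by gcongr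
    _ = _ := by ring

/-- The positive dyadic operator associated with the Carleson boxes of a dyadic system. -/
noncomputable def dyadicOp (α : ℝ) (D : DyadicSystem) (f : ℂ → ℝ≥0∞) (z : ℂ) : ℝ≥0∞ :=
  ∑' p : ℤ × ℤ, (carlesonBox (D.interval p.1 p.2)).indicator (fun _ =>
    (∫⁻ w in carlesonBox (D.interval p.1 p.2), f w ∂(areaMeasure α)) /
      areaMeasure α (carlesonBox (D.interval p.1 p.2))) z

theorem measurable_dyadicOp (α : ℝ) (D : DyadicSystem) (f : ℂ → ℝ≥0∞) :
    Measurable (dyadicOp α D f) :=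
  Measurable.tsum fun _ => measurable_const.indicator (measurableSet_carlesonBox _)

theorem lintegral_mul_dyadicOp {α : ℝ} (D : DyadicSystem) {f g : ℂ → ℝ≥0∞}
    (hg : AEMeasurable g (areaMeasure α)) :
    ∫⁻ z, g z * dyadicOp α D f z ∂(areaMeasure α) =
      ∑' p : ℤ × ℤ, (∫⁻ z in carlesonBox (D.interval p.1 p.2), f z ∂(areaMeasure α)) *
        (∫⁻ z in carlesonBox (D.interval p.1 p.2), g z ∂(areaMeasure α)) /
          areaMeasure α (carlesonBox (D.interval p.1 p.2)) := by
  simp only [dyadicOp, ← ENNReal.tsum_mul_left]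
  rw [lintegral_tsum fun p => hg.fun_mul
    (measurable_const.indicator (measurableSet_carlesonBox _)).aemeasurable]
  refine tsum_congr fun p => ?_
  have : ∀ z, g z * (carlesonBox (D.interval p.1 p.2)).indicator (fun _ =>
      (∫⁻ w in carlesonBox (D.interval p.1 p.2), f w ∂(areaMeasure α)) /
      areaMeasure α (carlesonBox (D.interval p.1 p.2))) z =
      (carlesonBox (D.interval p.1 p.2)).indicator (fun z => g z *
      ((∫⁻ w in carlesonBox (D.interval p.1 p.2), f w ∂(areaMeasure α)) /
      areaMeasure α (carlesonBox (D.interval p.1 p.2)))) z := by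
    intro z
    by_cases hz : z ∈ carlesonBox (D.interval p.1 p.2) <;> simp [hz]
  simp only [this]
  rw [lintegral_indicator (measurableSet_carlesonBox _), lintegral_mul_const'' _ hg.restrict]
  simp only [div_eq_mul_inv]; ring

/-- For each `w` a single box already dominates the kernel; adding all boxes of both systems removes
the dependence of that box on `w`. -/
theorem AdjacentSystems.positiveOp_le {α κ : ℝ} (hα : -1 < α) {D₁ D₂ : DyadicSystem}
    (h : AdjacentSystems κ D₁ D₂) {f : ℂ → ℝ≥0∞} (hf : AEMeasurable f (areaMeasure α)) {z : ℂ}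
    (hz : z ∈ upperHalf) :
    positiveOp α f z ≤ ENNReal.ofReal (κ ^ (2 + α) * boxConst α) *
      (dyadicOp α D₁ f z + dyadicOp α D₂ f z) := by
  set C := ENNReal.ofReal (κ ^ (2 + α) * boxConst α)
  set A := areaMeasure α
  set q : (ℝ × ℝ) → ℂ → ℝ≥0∞ := fun I w =>
    (carlesonBox I).indicator 1 z * (A (carlesonBox I))⁻¹ * (carlesonBox I).indicator f w with hq
  have hqm : ∀ I, AEMeasurable (q I) A := fun I =>
    (hf.indicator (measurableSet_carlesonBox I)).const_mul _
  have hint : ∀ D : DyadicSystem, ∫⁻ w, ∑' p : ℤ × ℤ, q (D.interval p.1 p.2) w ∂A =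
      dyadicOp α D f z := by
    intro D
    rw [lintegral_tsum fun p => hqm _]
    refine tsum_congr fun p => ?_
    simp only [hq]
    rw [lintegral_const_mul'' _ (hf.indicator (measurableSet_carlesonBox _)),
      lintegral_indicator (measurableSet_carlesonBox _)]
    by_cases hz : z ∈ carlesonBox (D.interval p.1 p.2)
    · simp [hz, div_eq_mul_inv, mul_comm, A]
    · simp [hz]
  calc positiveOp α f z ≤ ∫⁻ w, C * (∑' p : ℤ × ℤ, q (D₁.interval p.1 p.2) w +
          ∑' p : ℤ × ℤ, q (D₂.interval p.1 p.2) w) ∂A := by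
        refine lintegral_mono_ae ?_
        filter_upwards [ae_mem_upperHalf α] with w hw
        obtain ⟨I, hI, hzI, hwI, hk⟩ := h.exists_box_kernel_le hα hz hw
        have hqI : kernelModulus α z w * f w ≤ C * q I w := by
          simp only [hq, Set.indicator_of_mem hzI, Set.indicator_of_mem hwI, Pi.one_apply, one_mul]
          calc _ ≤ C / A (carlesonBox I) * f w := by gcongr
            _ = _ := by rw [div_eq_mul_inv, mul_assoc]
        refine hqI.trans ?_
        gcongr
        rcases hI with ⟨k, m, rfl⟩ | ⟨k, m, rfl⟩
        · exact (ENNReal.le_tsum (f := fun p : ℤ × ℤ => q (D₁.interval p.1 p.2) w) (k, m)).trans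
            le_self_add
        · exact (ENNReal.le_tsum (f := fun p : ℤ × ℤ => q (D₂.interval p.1 p.2) w) (k, m)).trans
            le_add_self
    _ = _ := by
        rw [lintegral_const_mul'' _ (by
          exact (AEMeasurable.tsum fun p => hqm _).add
            (AEMeasurable.tsum fun p => hqm _)),
          lintegral_add_left' (AEMeasurable.tsum fun p => hqm _), hint, hint]

/-- `P_α⁺` is bounded on `L²(u)` for `u ∈ B₂`. -/
theorem exists_lintegral_positiveOp_sq_le {α : ℝ} (hα : -1 < α) (κ : ℝ) (K : ℝ≥0) :
    ∃ C : ℝ≥0, ∀ D₁ D₂ : DyadicSystem, AdjacentSystems κ D₁ D₂ → ∀ u u' f : ℂ → ℝ≥0∞,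
      DualWeights α (D₁.intervals ∪ D₂.intervals) K u u' → AEMeasurable f (areaMeasure α) →
      ∫⁻ z, positiveOp α f z ^ 2 * u z ∂(areaMeasure α) ≤
        C * ∫⁻ z, f z ^ 2 * u z ∂(areaMeasure α) := by
  obtain ⟨C₀, hC₀⟩ := exists_dyadicForm_sq_le hα K
  refine ⟨(κ ^ (2 + α) * boxConst α).toNNReal ^ 2 * (4 * C₀), fun D₁ D₂ h u u' f hw hf => ?_⟩
  refine lintegral_sq_mul_le_of_duality hw.left hw.mul_eq_one
    (measurable_positiveOp hf).aemeasurable fun g hg => ?_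
  have key : ∀ D : DyadicSystem, D.intervals ⊆ D₁.intervals ∪ D₂.intervals →
      (∫⁻ z, g z * dyadicOp α D f z ∂(areaMeasure α)) ^ 2 ≤
      C₀ * ((∫⁻ z, f z ^ 2 * u z ∂(areaMeasure α)) * ∫⁻ z, g z ^ 2 * u' z ∂(areaMeasure α)) := by
    intro D hD
    rw [lintegral_mul_dyadicOp D hg]
    exact hC₀ D u u' f g (hw.mono hD) hf hg
  have k1 := key D₁ Set.subset_union_left
  have k2 := key D₂ Set.subset_union_right
  have hle : ∫⁻ z, g z * positiveOp α f z ∂(areaMeasure α) ≤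
      ENNReal.ofReal (κ ^ (2 + α) * boxConst α) *
        ((∫⁻ z, g z * dyadicOp α D₁ f z ∂(areaMeasure α)) +
          ∫⁻ z, g z * dyadicOp α D₂ f z ∂(areaMeasure α)) := by
    rw [← lintegral_add_left' (hg.fun_mul (measurable_dyadicOp α D₁ f).aemeasurable),
      ← lintegral_const_mul'' _ ((hg.fun_mul (measurable_dyadicOp α D₁ f).aemeasurable).fun_add
        (hg.fun_mul (measurable_dyadicOp α D₂ f).aemeasurable))]
    refine lintegral_mono_ae ?_
    filter_upwards [ae_mem_upperHalf α] with z hz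
    calc _ ≤ g z * (ENNReal.ofReal (κ ^ (2 + α) * boxConst α) *
          (dyadicOp α D₁ f z + dyadicOp α D₂ f z)) := by
          gcongr; exact h.positiveOp_le hα hf hz
      _ = _ := by ring
  set X₁ := ∫⁻ z, g z * dyadicOp α D₁ f z ∂(areaMeasure α)
  set X₂ := ∫⁻ z, g z * dyadicOp α D₂ f z ∂(areaMeasure α)
  set Y := C₀ * ((∫⁻ z, f z ^ 2 * u z ∂(areaMeasure α)) * ∫⁻ z, g z ^ 2 * u' z ∂(areaMeasure α))
  have hsum : (X₁ + X₂) ^ 2 ≤ 4 * Y := by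
    have : X₁ + X₂ ≤ 2 * max X₁ X₂ := by
      rw [two_mul]; exact add_le_add (le_max_left _ _) (le_max_right _ _)
    calc _ ≤ (2 * max X₁ X₂) ^ 2 := by gcongr
      _ = 4 * max X₁ X₂ ^ 2 := by ring
      _ ≤ 4 * Y := by
        gcongr
        rcases max_choice X₁ X₂ with h | h <;> rw [h] <;> assumption
  calc _ ≤ (ENNReal.ofReal (κ ^ (2 + α) * boxConst α) * (X₁ + X₂)) ^ 2 := by gcongr
    _ = ENNReal.ofReal (κ ^ (2 + α) * boxConst α) ^ 2 * (X₁ + X₂) ^ 2 := by rw [mul_pow]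
    _ ≤ ENNReal.ofReal (κ ^ (2 + α) * boxConst α) ^ 2 * (4 * Y) := by gcongr
    _ = _ := by
        simp only [Y, ENNReal.ofReal]; push_cast; ring

/-! ### Mean value inequalities for holomorphic functions. -/

theorem enorm_mul_le_lintegral_circle {g : ℂ → ℂ} {z : ℂ} {R r : ℝ} (hr : 0 < r) (hrR : r < R)
    (hg : DifferentiableOn ℂ g (Metric.ball z R)) :
    ENNReal.ofReal (2 * Real.pi) * ‖g z‖ₑ ≤
      ∫⁻ θ in Set.Ioo (-Real.pi) Real.pi, ‖g (circleMap z r θ)‖ₑ := by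
  have h1 : Real.circleAverage g z r = g z := by
    refine DiffContOnCl.circleAverage ?_
    rw [abs_of_pos hr]
    refine DifferentiableOn.diffContOnCl (hg.mono ?_)
    exact Metric.closure_ball_subset_closedBall.trans (Metric.closedBall_subset_ball hrR)
  have hper : Function.Periodic (fun θ => g (circleMap z r θ)) (2 * Real.pi) := fun θ => by
    simp only [periodic_circleMap z r θ]
  rw [Real.circleAverage_def] at h1
  -- The circle average runs over `[0, 2π]`; it is moved to `(-π, π)`, the range of the angle in
  -- polar coordinates.
  have h2 := hper.intervalIntegral_add_eq 0 (-Real.pi)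
  rw [zero_add, show -Real.pi + 2 * Real.pi = Real.pi by ring] at h2
  rw [h2, intervalIntegral.integral_of_le (by linarith [Real.pi_pos]),
    integral_Ioc_eq_integral_Ioo] at h1
  have hpi : (2 * Real.pi) ≠ 0 := by positivity
  have h3 : (2 * Real.pi : ℝ) • g z =
      ∫ θ in Set.Ioo (-Real.pi) Real.pi, g (circleMap z r θ) := by
    rw [← h1, smul_smul, mul_inv_cancel₀ hpi, one_smul]
  refine le_trans (le_of_eq ?_) (enorm_integral_le_lintegral_enorm _)
  rw [← h3, enorm_smul, Real.enorm_eq_ofReal (by positivity)]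

/-- The sub-mean value property of `|g|` on discs, for holomorphic `g`. -/
theorem enorm_mul_le_setLIntegral_ball {g : ℂ → ℂ} {z : ℂ} {R : ℝ} (hR : 0 < R)
    (hg : DifferentiableOn ℂ g (Metric.ball z R)) :
    ENNReal.ofReal (Real.pi * R ^ 2) * ‖g z‖ₑ ≤ ∫⁻ w in Metric.ball z R, ‖g w‖ₑ := by
  have hpi := Real.pi_pos
  set f : ℂ → ℝ≥0∞ := (Metric.ball z R).indicator fun w => ‖g w‖ₑ with hf
  have e1 : ∫⁻ w in Metric.ball z R, ‖g w‖ₑ = ∫⁻ w, f (z + w) := by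
    rw [lintegral_add_left_eq_self f z, lintegral_indicator Metric.isOpen_ball.measurableSet]
  have hcm : ∀ p : ℝ × ℝ, z + Complex.polarCoord.symm p = circleMap z p.1 p.2 := by
    intro p
    rw [Complex.polarCoord_symm_apply, circleMap, Complex.exp_mul_I]
    push_cast; rfl
  set S : Set (ℝ × ℝ) := Set.Ioo 0 R ×ˢ Set.Ioo (-Real.pi) Real.pi with hS
  have hSm : MeasurableSet S := measurableSet_Ioo.prod measurableSet_Ioo
  have hmem : ∀ p ∈ S, circleMap z p.1 p.2 ∈ Metric.ball z R := by
    intro p hp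
    have h0 : 0 < p.1 := hp.1.1
    have h1 : p.1 < R := hp.1.2
    rw [Metric.mem_ball, dist_eq_norm, circleMap_sub_center, norm_circleMap_zero, abs_of_pos h0]
    exact h1
  have hcont : ContinuousOn (fun p : ℝ × ℝ => ‖g (circleMap z p.1 p.2)‖ₑ) S := by
    refine continuous_enorm.comp_continuousOn (hg.continuousOn.comp ?_ hmem)
    unfold circleMap
    fun_prop
  have haem : AEMeasurable (fun p : ℝ × ℝ => ENNReal.ofReal p.1 * ‖g (circleMap z p.1 p.2)‖ₑ)
      ((volume.restrict (Set.Ioo 0 R)).prod (volume.restrict (Set.Ioo (-Real.pi) Real.pi))) := by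
    rw [Measure.prod_restrict]
    exact (by fun_prop : Measurable fun p : ℝ × ℝ => ENNReal.ofReal p.1).aemeasurable.fun_mul
      (hcont.aemeasurable hSm)
  have e2 : ∫⁻ r in Set.Ioo 0 R, ENNReal.ofReal r = ENNReal.ofReal (R ^ 2 / 2) := by
    rw [← ofReal_integral_eq_lintegral_ofReal, ← integral_Ioc_eq_integral_Ioo,
      ← intervalIntegral.integral_of_le hR.le, integral_id]
    · congr 1; ring
    · exact (intervalIntegrable_iff_integrableOn_Ioo_of_le hR.le).1
        (continuous_id.intervalIntegrable 0 R)
    · exact (ae_restrict_iff' measurableSet_Ioo).2 (Filter.Eventually.of_forall fun y hy => hy.1.le)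
  rw [e1, ← Complex.lintegral_comp_polarCoord_symm]
  calc _ = (∫⁻ r in Set.Ioo 0 R, ENNReal.ofReal r) * (ENNReal.ofReal (2 * Real.pi) * ‖g z‖ₑ) := by
        rw [e2, ← mul_assoc, ← ENNReal.ofReal_mul (by positivity)]
        congr 2; ring
    _ = ∫⁻ r in Set.Ioo 0 R, ENNReal.ofReal r * (ENNReal.ofReal (2 * Real.pi) * ‖g z‖ₑ) := by
        rw [lintegral_mul_const _ (by fun_prop)]
    _ ≤ ∫⁻ r in Set.Ioo 0 R, ∫⁻ θ in Set.Ioo (-Real.pi) Real.pi,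
          ENNReal.ofReal r * ‖g (circleMap z r θ)‖ₑ := by
        refine setLIntegral_mono' measurableSet_Ioo fun r hr => ?_
        rw [lintegral_const_mul' _ _ ENNReal.ofReal_ne_top]
        gcongr
        exact enorm_mul_le_lintegral_circle hr.1 hr.2 hg
    _ = ∫⁻ p in S, ENNReal.ofReal p.1 * ‖g (circleMap z p.1 p.2)‖ₑ := by
        rw [hS, Measure.volume_eq_prod, ← Measure.prod_restrict, lintegral_prod _ haem]
    _ = ∫⁻ p in S, ENNReal.ofReal p.1 • f (z + Complex.polarCoord.symm p) := by
        refine setLIntegral_congr_fun hSm fun p hp => ?_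
        rw [hcm, hf, Set.indicator_of_mem (hmem p hp), smul_eq_mul]
    _ ≤ _ := by
        refine lintegral_mono_set fun p hp => ?_
        exact ⟨hp.1.1, hp.2⟩

theorem ball_half_im_bounds {z w : ℂ} (hw : w ∈ Metric.ball z (z.im / 2)) :
    |w.re - z.re| < z.im / 2 ∧ z.im / 2 < w.im ∧ w.im < 3 / 2 * z.im := by
  rw [Metric.mem_ball, dist_eq_norm] at hw
  have h1 := Complex.abs_re_le_norm (w - z)
  have h2 := abs_le.1 (Complex.abs_im_le_norm (w - z))
  simp only [Complex.sub_re, Complex.sub_im] at h1 h2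
  exact ⟨by linarith, by linarith, by linarith⟩

/-- On the disc of radius `Im z / 2` the ratio `2 Im w / Im z` stays in `[1, 3]`, so the density of
`dA_α` is at least a constant times `(Im z)^α` for either sign of `α`. -/
theorem exists_enorm_mul_le_setLIntegral_area {α : ℝ} (hα : -1 < α) :
    ∃ C : ℝ≥0, ∀ (g : ℂ → ℂ) (z : ℂ), z ∈ upperHalf → DifferentiableOn ℂ g upperHalf →
      ENNReal.ofReal (z.im ^ (2 + α)) * ‖g z‖ₑ ≤
        C * ∫⁻ w in Metric.ball z (z.im / 2), ‖g w‖ₑ ∂(areaMeasure α) := by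
  have hpi := Real.pi_pos
  have hα1 : 0 < α + 1 := by linarith
  set m : ℝ := (α + 1) / Real.pi * min 1 (3 ^ α) with hm
  have hm0 : 0 < m := by
    have : 0 < min 1 ((3 : ℝ) ^ α) := lt_min one_pos (by positivity)
    positivity
  refine ⟨(4 / (m * Real.pi)).toNNReal, fun g z hz hg => ?_⟩
  change _ ≤ ENNReal.ofReal _ * _
  have hy : 0 < z.im := hz
  set B := Metric.ball z (z.im / 2) with hB
  have hBm : MeasurableSet B := Metric.isOpen_ball.measurableSet
  have hsub : B ⊆ upperHalf := fun w hw => (half_pos hy).trans (ball_half_im_bounds hw).2.1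
  have hsm := enorm_mul_le_setLIntegral_ball (half_pos hy) (hg.mono hsub)
  have hdens : ∀ w ∈ B, ENNReal.ofReal (m * z.im ^ α) ≤
      ENNReal.ofReal (1 / Real.pi * (α + 1) * (2 * w.im) ^ α) := by
    intro w hw
    obtain ⟨-, h1, h2⟩ := ball_half_im_bounds hw
    refine ENNReal.ofReal_le_ofReal ?_
    have h0 : 0 < w.im := by linarith
    have h3 : (2 * w.im) ^ α = (2 * w.im / z.im) ^ α * z.im ^ α := by
      rw [← Real.mul_rpow (by positivity) hy.le, div_mul_cancel₀ _ hy.ne']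
    have h4 : min 1 ((3 : ℝ) ^ α) ≤ (2 * w.im / z.im) ^ α := by
      have h5 : 1 ≤ 2 * w.im / z.im := by rw [le_div_iff₀ hy]; linarith
      have h6 : 2 * w.im / z.im ≤ 3 := by rw [div_le_iff₀ hy]; linarith
      rcases le_total 0 α with h | h
      · exact (min_le_left _ _).trans (Real.one_le_rpow h5 h)
      · exact (min_le_right _ _).trans
          (Real.rpow_le_rpow_of_nonpos (by linarith) h6 h)
    rw [h3, hm]
    have h7 : 0 < z.im ^ α := by positivity
    calc _ = (1 / Real.pi * (α + 1)) * (min 1 ((3 : ℝ) ^ α) * z.im ^ α) := by ring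
      _ ≤ _ := by gcongr
  have hgm : AEMeasurable (fun w => ‖g w‖ₑ) (volume.restrict B) :=
    (continuous_enorm.comp_continuousOn (hg.continuousOn.mono hsub)).aemeasurable hBm
  have e1 : ∫⁻ w in B, ‖g w‖ₑ ∂(areaMeasure α) =
      ∫⁻ w in B, ENNReal.ofReal (1 / Real.pi * (α + 1) * (2 * w.im) ^ α) * ‖g w‖ₑ := by
    rw [areaMeasure, restrict_withDensity hBm, Measure.restrict_restrict hBm,
      Set.inter_eq_left.2 hsub,
      lintegral_withDensity_eq_lintegral_mul₀ (measurable_areaDensity α).aemeasurable hgm]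
    rfl
  have e2 : ENNReal.ofReal (m * z.im ^ α) * ∫⁻ w in B, ‖g w‖ₑ ≤
      ∫⁻ w in B, ‖g w‖ₑ ∂(areaMeasure α) := by
    rw [e1, ← lintegral_const_mul' _ _ ENNReal.ofReal_ne_top]
    refine setLIntegral_mono' hBm fun w hw => ?_
    exact mul_le_mul' (hdens w hw) le_rfl
  calc _ = ENNReal.ofReal (4 / (m * Real.pi)) * (ENNReal.ofReal (m * z.im ^ α) *
        (ENNReal.ofReal (Real.pi * (z.im / 2) ^ 2) * ‖g z‖ₑ)) := by
        rw [← mul_assoc, ← mul_assoc, ← ENNReal.ofReal_mul (by positivity),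
          ← ENNReal.ofReal_mul (by positivity)]
        congr 2
        rw [Real.rpow_add hy, Real.rpow_two]
        field_simp
        norm_num
    _ ≤ _ := by
        gcongr
        exact le_trans (by gcongr) e2

/-! ### The pointwise bound for the commutator kernel. -/

/-- A geometric series of ratio `2^{-c} ≤ 1/2` is at most twice its largest term. The maximum with
`y` makes the induction work, which passes from `y` to `2 y`. -/
theorem sum_dyadic_rpow_le {c : ℝ} (hc : 1 ≤ c) {ρ : ℝ} (hρ : 0 < ρ) (n : ℕ) :
    ∀ {y : ℝ}, 0 < y → ∑ k ∈ Finset.range n,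
      (if ρ ≤ 2 ^ k * y then (2 ^ k * y) ^ (-c) else 0) ≤ 2 * max ρ y ^ (-c) := by
  induction n with
  | zero =>
    intro y hy
    have : 0 < max ρ y := lt_max_of_lt_left hρ
    simp only [Finset.range_zero, Finset.sum_empty]
    positivity
  | succ n ih =>
    intro y hy
    rw [Finset.sum_range_succ']
    have h1 := ih (y := 2 * y) (by positivity)
    have h2 : ∀ k : ℕ, (2 : ℝ) ^ (k + 1) * y = 2 ^ k * (2 * y) := fun k => by ring
    simp only [h2, pow_zero, one_mul]
    have h3 : (2 * y) ^ (-c) ≤ 1 / 2 * y ^ (-c) := by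
      rw [Real.mul_rpow zero_le_two hy.le]
      gcongr
      calc (2 : ℝ) ^ (-c) ≤ 2 ^ (-1 : ℝ) :=
            Real.rpow_le_rpow_of_exponent_le one_le_two (by linarith)
        _ = 1 / 2 := by rw [Real.rpow_neg_one]; norm_num
    split_ifs with h
    · rw [max_eq_right h]
      rw [max_eq_right (by linarith)] at h1
      linarith
    · push Not at h
      rw [max_eq_left h.le, add_zero]
      refine h1.trans ?_
      gcongr 2 * ?_
      exact Real.rpow_le_rpow_of_nonpos hρ (le_max_left _ _) (by linarith)

/-- The function `r ↦ r^{-(2+α)}` with values in `[0, ∞]`. -/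
noncomputable def decay (α r : ℝ) : ℝ≥0∞ := ENNReal.ofReal (r ^ (-(2 + α)))

theorem kernelModulus_eq_decay (α : ℝ) (z w : ℂ) :
    kernelModulus α z w = decay α ‖z - (starRingEnd ℂ) w‖ := rfl

theorem decay_anti {α : ℝ} (hα : -1 < α) {r s : ℝ} (hr : 0 < r) (h : r ≤ s) :
    decay α s ≤ decay α r :=
  ENNReal.ofReal_le_ofReal (Real.rpow_le_rpow_of_nonpos hr h (by linarith))

theorem decay_mul (α : ℝ) {r s : ℝ} (hr : 0 ≤ r) (hs : 0 ≤ s) :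
    decay α (r * s) = decay α r * decay α s := by
  rw [decay, Real.mul_rpow hr hs, ENNReal.ofReal_mul (by positivity)]; rfl

theorem decay_ne_top (α r : ℝ) : decay α r ≠ ∞ := ENNReal.ofReal_ne_top

theorem decay_mul_ofReal (α : ℝ) {r : ℝ} (hr : 0 < r) :
    decay α r * ENNReal.ofReal (r ^ (2 + α)) = 1 := by
  rw [decay, ← ENNReal.ofReal_mul (by positivity), ← Real.rpow_add hr]; simp

/-- The total mass of `w` over the box above `I`. -/
noncomputable def boxMass (α : ℝ) (w : ℂ → ℝ≥0∞) (I : ℝ × ℝ) : ℝ≥0∞ :=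
  ∫⁻ z in carlesonBox I, w z ∂(areaMeasure α)

theorem carlesonBox_mono {I J : ℝ × ℝ} (hIJ : J.1 ≤ I.1 ∧ I.2 ≤ J.2) :
    carlesonBox I ⊆ carlesonBox J := fun z hz =>
  ⟨⟨hIJ.1.trans hz.1.1, hz.1.2.trans_le hIJ.2⟩, hz.2.1, by
    linarith [hz.2.2, hIJ.1, hIJ.2]⟩

section Oscillation

variable {α : ℝ} {b : ℂ → ℂ} {w : ℂ → ℝ≥0∞} {M : ℝ≥0∞}

/-- Integrate `|s - t| ≤ |b - s| + |b - t|` over the box above `[p, p + l)`, which lies in both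
boxes and has area `boxConst α * l^(2+α)`. This is one link of the chain of boxes. -/
theorem enorm_sub_le_of_common_box (hα : -1 < α) (hb : AEStronglyMeasurable b (areaMeasure α))
    {I J : ℝ × ℝ} {s t : ℂ} {p l : ℝ} (hl : 0 < l)
    (hI : ∫⁻ z in carlesonBox I, ‖b z - s‖ₑ ∂(areaMeasure α) ≤ M * boxMass α w I)
    (hJ : ∫⁻ z in carlesonBox J, ‖b z - t‖ₑ ∂(areaMeasure α) ≤ M * boxMass α w J)
    (hpI : I.1 ≤ p ∧ p + l ≤ I.2) (hpJ : J.1 ≤ p ∧ p + l ≤ J.2) :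
    ‖s - t‖ₑ ≤ ENNReal.ofReal (boxConst α)⁻¹ * M * decay α l * (boxMass α w I + boxMass α w J) := by
  have ha := boxConst_pos α
  have h1 : ‖s - t‖ₑ * areaMeasure α (carlesonBox (p, p + l)) ≤
      M * (boxMass α w I + boxMass α w J) := by
    rw [← setLIntegral_const, mul_add]
    refine le_trans ?_ (add_le_add
      ((lintegral_mono_set (carlesonBox_mono (I := (p, p + l)) hpI)).trans hI)
      ((lintegral_mono_set (carlesonBox_mono (I := (p, p + l)) hpJ)).trans hJ))
    rw [← lintegral_add_left' (hb.fun_sub aestronglyMeasurable_const).enorm.restrict]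
    refine lintegral_mono fun z => ?_
    have : s - t = -(b z - s) + (b z - t) := by ring
    calc ‖s - t‖ₑ ≤ ‖-(b z - s)‖ₑ + ‖b z - t‖ₑ := by rw [this]; exact enorm_add_le _ _
      _ = _ := by rw [enorm_neg]
  rw [areaMeasure_carlesonBox hα (by simpa using hl), add_sub_cancel_left,
    ENNReal.ofReal_mul ha.le] at h1
  calc ‖s - t‖ₑ = (ENNReal.ofReal (boxConst α)⁻¹ * ENNReal.ofReal (boxConst α)) *
        (decay α l * ENNReal.ofReal (l ^ (2 + α))) * ‖s - t‖ₑ := by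
        rw [decay_mul_ofReal α hl, ← ENNReal.ofReal_mul (by positivity), inv_mul_cancel₀ ha.ne']
        simp
    _ = ENNReal.ofReal (boxConst α)⁻¹ * decay α l *
        (‖s - t‖ₑ * (ENNReal.ofReal (boxConst α) * ENNReal.ofReal (l ^ (2 + α)))) := by ring
    _ ≤ ENNReal.ofReal (boxConst α)⁻¹ * decay α l * (M * (boxMass α w I + boxMass α w J)) := by
        gcongr
    _ = _ := by ring

/-- Only boxes of size at least comparable to `|z - ū|` contain `u`, so the geometric sum is of
order `|z - ū|^{-(2+α)}`; and a box containing `u` has size at most comparable to `|z - v̄|`, so `|u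
- v̄|` is bounded by a multiple of `|z - v̄|`. -/
theorem sum_decay_indicator_le (hα : -1 < α) {κ : ℝ} (hκ : 1 < κ) {I : ℕ → ℝ × ℝ} {z u v : ℂ}
    (hz : z ∈ upperHalf) (hu : u ∈ upperHalf) (hv : v ∈ upperHalf) {n : ℕ}
    (hn : 2 ^ n * z.im ≤ 2 * ‖z - (starRingEnd ℂ) v‖)
    (hI : ∀ k, z.re ∈ Set.Ico (I k).1 (I k).2 ∧ (I k).2 - (I k).1 ≤ 2 * κ * (2 ^ k * z.im)) :
    ∑ k ∈ Finset.range (n + 1), decay α (2 ^ k * z.im) *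
        (carlesonBox (I k)).indicator 1 u * kernelModulus α z v ≤
      2 * decay α (1 / (5 * κ)) * decay α (1 / (10 * κ)) *
        (kernelModulus α z u * kernelModulus α u v) := by
  have hy : 0 < z.im := hz
  have hκ0 : 0 < κ := by linarith
  set d := ‖z - (starRingEnd ℂ) v‖ with hd
  have hd0 : 0 < d := norm_sub_conj_pos hz hv
  have hzu := norm_sub_conj_pos hz hu
  have huv := norm_sub_conj_pos hu hv
  -- If `u` lies in box `k`, then `|z - ū| ≤ 4κ 2^k Im z + Im z ≤ 5κ 2^k Im z`.
  set ρ := 1 / (5 * κ) * ‖z - (starRingEnd ℂ) u‖ with hρ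
  have hρ0 : 0 < ρ := by positivity
  have geo : ∀ k, u ∈ carlesonBox (I k) → |z.re - u.re| ≤ 2 * κ * (2 ^ k * z.im) ∧
      u.im ≤ 2 * κ * (2 ^ k * z.im) := by
    intro k hk
    obtain ⟨⟨h1, h2⟩, h3⟩ := hI k
    have h4 := hk.1.1
    have h5 := hk.1.2
    exact ⟨abs_le.2 ⟨by linarith, by linarith⟩, hk.2.2.le.trans h3⟩
  have close : ∀ k, u ∈ carlesonBox (I k) → ρ ≤ 2 ^ k * z.im := by
    intro k hk
    obtain ⟨h1, h2⟩ := geo k hk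
    have h3 := norm_sub_conj_le z u
    have h4 : z.im ≤ 2 ^ k * z.im := le_mul_of_one_le_left hy.le (one_le_pow₀ one_le_two)
    have h5 : 2 ^ k * z.im ≤ κ * (2 ^ k * z.im) := le_mul_of_one_le_left (by positivity) hκ.le
    have h6 : |z.im + u.im| = z.im + u.im := abs_of_pos (add_pos hy hu)
    rw [hρ, div_mul_eq_mul_div, one_mul, div_le_iff₀ (by positivity)]
    nlinarith
  by_cases hex : ∃ k ∈ Finset.range (n + 1), u ∈ carlesonBox (I k)
  swap
  · push Not at hex
    rw [Finset.sum_eq_zero]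
    · exact zero_le
    · intro k hk
      simp [Set.indicator_of_notMem (hex k hk)]
  obtain ⟨k, hk, hku⟩ := hex
  -- Horizontal distance and height of `u` contribute at most `4κ 2^k Im z ≤ 8κ d`, and the position
  -- of `v` at most `2d ≤ 2κ d`.
  have h10 : ‖u - (starRingEnd ℂ) v‖ ≤ 10 * κ * d := by
    obtain ⟨h1, h2⟩ := geo k hku
    have h3 := norm_sub_conj_le u v
    have h4 : 2 ^ k * z.im ≤ 2 ^ n * z.im := mul_le_mul_of_nonneg_right
      (pow_le_pow_right₀ one_le_two (Nat.lt_succ_iff.1 (Finset.mem_range.1 hk))) hy.le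
    have h5 := abs_re_sub_re_le_norm_sub_conj z v
    have h6 := im_add_im_le_norm_sub_conj z v
    have h7 : |u.im + v.im| = u.im + v.im := abs_of_pos (add_pos hu hv)
    have h8 : |u.re - v.re| ≤ |z.re - u.re| + |z.re - v.re| := by
      have := abs_sub_le u.re z.re v.re
      rwa [abs_sub_comm u.re z.re] at this
    have h9 : d ≤ κ * d := le_mul_of_one_le_left hd0.le hκ.le
    have h11 : κ * (2 ^ k * z.im) ≤ κ * (2 * d) :=
      mul_le_mul_of_nonneg_left (h4.trans hn) hκ0.le
    rw [← hd] at h5 h6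
    nlinarith
  have hfar : kernelModulus α z v ≤ decay α (1 / (10 * κ)) * kernelModulus α u v := by
    rw [kernelModulus_eq_decay, kernelModulus_eq_decay, ← decay_mul α (by positivity) huv.le]
    refine decay_anti hα (by positivity) ?_
    rw [div_mul_eq_mul_div, one_mul, div_le_iff₀ (by positivity)]
    linarith
  have hsum : ∑ k ∈ Finset.range (n + 1), decay α (2 ^ k * z.im) *
      (carlesonBox (I k)).indicator 1 u ≤ 2 * decay α (1 / (5 * κ)) * kernelModulus α z u := by
    calc _ ≤ ∑ k ∈ Finset.range (n + 1), ENNReal.ofReal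
          (if ρ ≤ 2 ^ k * z.im then (2 ^ k * z.im) ^ (-(2 + α)) else 0) := by
          refine Finset.sum_le_sum fun k _ => ?_
          by_cases hku : u ∈ carlesonBox (I k)
          · rw [if_pos (close k hku), Set.indicator_of_mem hku]; simp [decay]
          · simp [Set.indicator_of_notMem hku]
      _ = ENNReal.ofReal (∑ k ∈ Finset.range (n + 1),
          (if ρ ≤ 2 ^ k * z.im then (2 ^ k * z.im) ^ (-(2 + α)) else 0)) := by
          rw [ENNReal.ofReal_sum_of_nonneg]
          intro k _
          split_ifs <;> positivity
      _ ≤ ENNReal.ofReal (2 * ρ ^ (-(2 + α))) := by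
          refine ENNReal.ofReal_le_ofReal
            ((sum_dyadic_rpow_le (by linarith) hρ0 _ hy).trans ?_)
          gcongr 2 * ?_
          exact Real.rpow_le_rpow_of_nonpos hρ0 (le_max_left _ _) (by linarith)
      _ = _ := by
          rw [ENNReal.ofReal_mul zero_le_two, ENNReal.ofReal_ofNat, kernelModulus_eq_decay,
            mul_assoc, ← decay_mul α (by positivity) hzu.le]
          rfl
  rw [← Finset.sum_mul]
  calc _ ≤ 2 * decay α (1 / (5 * κ)) * kernelModulus α z u *
        (decay α (1 / (10 * κ)) * kernelModulus α u v) := by gcongr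
    _ = _ := by ring

end Oscillation

theorem AdjacentSystems.exists_dyadic_cover {κ : ℝ} {D₁ D₂ : DyadicSystem}
    (h : AdjacentSystems κ D₁ D₂) (x : ℝ) {r : ℝ} (hr : 0 < r) :
    ∃ I ∈ D₁.intervals ∪ D₂.intervals, I.1 ≤ x - r ∧ x + r < I.2 ∧ I.2 - I.1 ≤ 2 * κ * r := by
  obtain ⟨I, hI, hsub, hlen⟩ := h (x - r) (x + r) (by linarith)
  exact ⟨I, hI, (hsub (Set.left_mem_Icc.2 (by linarith))).1,
    (hsub (Set.right_mem_Icc.2 (by linarith))).2, by linarith⟩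

/-- The oscillation of a holomorphic function between a point `z` and a box above `z` of size
comparable to `|z - v̄|`. -/
theorem exists_enorm_sub_box_mul_kernel_le {α : ℝ} (hα : -1 < α) (κ : ℝ) :
    ∃ C : ℝ≥0, ∀ D₁ D₂ : DyadicSystem, AdjacentSystems κ D₁ D₂ →
      ∀ (b : ℂ → ℂ) (w : ℂ → ℝ≥0∞) (M : ℝ≥0∞) (β : ℝ × ℝ → ℂ),
      AEStronglyMeasurable b (areaMeasure α) → AEMeasurable w (areaMeasure α) →
      DifferentiableOn ℂ b upperHalf →
      (∀ I ∈ D₁.intervals ∪ D₂.intervals,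
        ∫⁻ z in carlesonBox I, ‖b z - β I‖ₑ ∂(areaMeasure α) ≤ M * boxMass α w I) →
      ∀ z ∈ upperHalf, ∀ v ∈ upperHalf, ∃ J ∈ D₁.intervals ∪ D₂.intervals,
        J.1 ≤ z.re - ‖z - (starRingEnd ℂ) v‖ ∧ z.re + ‖z - (starRingEnd ℂ) v‖ ≤ J.2 ∧
        ‖b z - β J‖ₑ * kernelModulus α z v ≤
          C * M * (∫⁻ u, kernelModulus α z u * (w u * kernelModulus α u v) ∂(areaMeasure α)) ∧
        kernelModulus α z v * boxMass α w J * kernelModulus α z v ≤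
          C * ∫⁻ u, kernelModulus α z u * (w u * kernelModulus α u v) ∂(areaMeasure α) := by
  obtain ⟨C₀, hC₀⟩ := exists_enorm_mul_le_setLIntegral_area hα
  set a : ℝ≥0∞ := ENNReal.ofReal (boxConst α)⁻¹ with ha
  set G : ℝ≥0∞ := 2 * decay α (1 / (5 * κ)) * decay α (1 / (10 * κ)) with hG
  set C₁ : ℝ≥0∞ := C₀ + a with hC₁
  have hC : (2 * C₁ + decay α (1 / 2)) * G ≠ ∞ := by
    refine ENNReal.mul_ne_top (ENNReal.add_ne_top.2 ⟨ENNReal.mul_ne_top (by simp)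
      (ENNReal.add_ne_top.2 ⟨by simp, ENNReal.ofReal_ne_top⟩), decay_ne_top _ _⟩) ?_
    exact ENNReal.mul_ne_top (ENNReal.mul_ne_top (by simp) (decay_ne_top _ _)) (decay_ne_top _ _)
  refine ⟨((2 * C₁ + decay α (1 / 2)) * G).toNNReal, fun D₁ D₂ h b w M β hbm hw hb hosc z hz v hv => ?_⟩
  rw [ENNReal.coe_toNNReal hC]
  have hκ := h.one_lt
  have hy : 0 < z.im := hz
  have hd0 : 0 < ‖z - (starRingEnd ℂ) v‖ := norm_sub_conj_pos hz hv
  have hyd : z.im ≤ ‖z - (starRingEnd ℂ) v‖ := by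
    have h1 := im_add_im_le_norm_sub_conj z v
    have h2 : 0 < v.im := hv
    linarith
  have hr : ∀ k : ℕ, 0 < 2 ^ k * z.im := fun k => by positivity
  choose I hI hI1 hI2 hI3 using fun k : ℕ => h.exists_dyadic_cover z.re (hr k)
  -- The last scale `n = n₀ + 1` satisfies `d < 2^n Im z ≤ 2d` with `d = |z - v̄|`: the last box
  -- covers the horizontal distance `d` on both sides of `z`, yet has size comparable to `d`.
  obtain ⟨n₀, hn₀, hn₀'⟩ := exists_nat_pow_near
    (x := ‖z - (starRingEnd ℂ) v‖ / z.im) (y := 2) (by rwa [le_div_iff₀ hy, one_mul]) one_lt_two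
  rw [le_div_iff₀ hy] at hn₀
  rw [div_lt_iff₀ hy] at hn₀'
  set n := n₀ + 1 with hn
  have hn2 : 2 ^ n * z.im ≤ 2 * ‖z - (starRingEnd ℂ) v‖ := by
    rw [hn, pow_succ]; linarith
  set K := kernelModulus α z v with hK
  set Z := ∫⁻ u, kernelModulus α z u * (w u * kernelModulus α u v) ∂(areaMeasure α) with hZ
  set e : ℕ → ℝ≥0∞ := fun k => decay α (2 ^ k * z.im) with he
  set t : ℕ → ℝ≥0∞ := fun k => e k * boxMass α w (I k) with ht
  have hsum : (∑ k ∈ Finset.range (n + 1), t k) * K ≤ G * Z := by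
    have e1 : ∀ k, t k * K =
        ∫⁻ u, e k * (carlesonBox (I k)).indicator 1 u * K * w u ∂(areaMeasure α) := by
      intro k
      have : ∀ u, e k * (carlesonBox (I k)).indicator 1 u * K * w u =
          (e k * K) * (carlesonBox (I k)).indicator w u := by
        intro u
        by_cases hu : u ∈ carlesonBox (I k)
        · simp [hu, mul_assoc]
        · simp [hu]
      simp only [this, ht, boxMass]
      rw [lintegral_const_mul'' _ (hw.indicator (measurableSet_carlesonBox _)),
        lintegral_indicator (measurableSet_carlesonBox _)]
      ring
    rw [Finset.sum_mul, Finset.sum_congr rfl fun k _ => e1 k, ← lintegral_finsetSum', hZ,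
      ← lintegral_const_mul' _ _ (by
        exact ENNReal.mul_ne_top (ENNReal.mul_ne_top (by simp) (decay_ne_top _ _))
          (decay_ne_top _ _))]
    · refine lintegral_mono_ae ?_
      filter_upwards [ae_mem_upperHalf α] with u hu
      rw [← Finset.sum_mul]
      calc _ ≤ G * (kernelModulus α z u * kernelModulus α u v) * w u := by
            gcongr
            exact sum_decay_indicator_le hα hκ hz hu hv hn2 fun k =>
              ⟨⟨by linarith [hI1 k, hr k], by linarith [hI2 k, hr k]⟩, hI3 k⟩
        _ = _ := by ring
    · intro k _
      exact AEMeasurable.fun_mul (((measurable_const.indicator (measurableSet_carlesonBox _)).const_mul _).mul_const _).aemeasurable hw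
  -- The mean value property at `z` accounts for the first `t 0`; the link from scale `k` to `k + 1`
  -- adds `t k + t (k + 1)`, whence the two sums.
  have hchain : ∀ m, ‖b z - β (I m)‖ₑ ≤
      C₁ * M * (∑ k ∈ Finset.range (m + 1), t k + ∑ k ∈ Finset.range m, t k) := by
    intro m
    induction m with
    | zero =>
      have h1 := hC₀ (fun u => b u - β (I 0)) z hz (hb.sub_const _)
      have hsub : Metric.ball z (z.im / 2) ⊆ carlesonBox (I 0) := by
        intro u hu
        obtain ⟨h2, h3, h4⟩ := ball_half_im_bounds hu
        have h5 := hI1 0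
        have h6 := hI2 0
        rw [pow_zero, one_mul] at h5 h6
        have h7 := abs_lt.1 h2
        exact ⟨⟨by linarith, by linarith⟩, by linarith, by linarith⟩
      have h2 := h1.trans (mul_le_mul_right ((lintegral_mono_set hsub).trans (hosc _ (hI 0))) _)
      have e0 : e 0 = decay α z.im := by simp [he]
      simp only [zero_add, Finset.sum_range_one, Finset.range_zero, Finset.sum_empty, add_zero]
      calc ‖b z - β (I 0)‖ₑ = (decay α z.im * ENNReal.ofReal (z.im ^ (2 + α))) *
            ‖b z - β (I 0)‖ₑ := by rw [decay_mul_ofReal α hy, one_mul]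
        _ = decay α z.im * (ENNReal.ofReal (z.im ^ (2 + α)) * ‖b z - β (I 0)‖ₑ) := by ring
        _ ≤ decay α z.im * (C₀ * (M * boxMass α w (I 0))) := by gcongr
        _ = C₀ * M * t 0 := by simp only [ht, e0]; ring
        _ ≤ _ := by gcongr; exact le_self_add
    | succ m ih =>
      have hlink := enorm_sub_le_of_common_box hα hbm (p := z.re - 2 ^ m * z.im)
        (l := 2 ^ (m + 1) * z.im) (by positivity) (hosc _ (hI m)) (hosc _ (hI (m + 1)))
        ⟨hI1 m, by rw [pow_succ]; linarith [hI2 m]⟩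
        ⟨by have := hI1 (m + 1); rw [pow_succ] at this; linarith [hr m], by
          have := hI2 (m + 1); rw [pow_succ] at this ⊢; linarith [hr m]⟩
      have hanti : e (m + 1) ≤ e m := decay_anti hα (hr m) (by rw [pow_succ]; linarith [hr m])
      have hlink' : ‖β (I m) - β (I (m + 1))‖ₑ ≤ C₁ * M * (t m + t (m + 1)) := by
        calc _ ≤ a * M * e (m + 1) * (boxMass α w (I m) + boxMass α w (I (m + 1))) := hlink
          _ = a * M * (e (m + 1) * boxMass α w (I m) + t (m + 1)) := by
              simp only [ht]; ring
          _ ≤ C₁ * M * (e m * boxMass α w (I m) + t (m + 1)) := by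
              gcongr
              exact le_add_self
      calc ‖b z - β (I (m + 1))‖ₑ ≤ ‖b z - β (I m)‖ₑ + ‖β (I m) - β (I (m + 1))‖ₑ := by
            rw [← sub_add_sub_cancel (b z) (β (I m)) (β (I (m + 1)))]
            exact enorm_add_le _ _
        _ ≤ _ := add_le_add ih hlink'
        _ = _ := by
            rw [Finset.sum_range_succ t (m + 1)]
            rw [Finset.sum_range_succ t m]
            ring
  refine ⟨I n, hI n, by linarith [hI1 n], by linarith [hI2 n], ?_, ?_⟩
  · calc _ ≤ C₁ * M * (∑ k ∈ Finset.range (n + 1), t k + ∑ k ∈ Finset.range n, t k) * K := by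
          gcongr; exact hchain n
      _ ≤ C₁ * M * (∑ k ∈ Finset.range (n + 1), t k + ∑ k ∈ Finset.range (n + 1), t k) * K := by
          gcongr
          exact Nat.le_succ n
      _ = 2 * C₁ * M * ((∑ k ∈ Finset.range (n + 1), t k) * K) := by ring
      _ ≤ (2 * C₁ + decay α (1 / 2)) * M * (G * Z) := by
          gcongr
          exact le_self_add
      _ = _ := by ring
  · have h1 : K ≤ decay α (1 / 2) * e n := by
      rw [he, ← decay_mul α (by norm_num) (hr n).le]
      exact decay_anti hα (by positivity) (by linarith)
    calc _ ≤ decay α (1 / 2) * e n * boxMass α w (I n) * K := by gcongr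
      _ = decay α (1 / 2) * (t n * K) := by simp only [ht]; ring
      _ ≤ decay α (1 / 2) * ((∑ k ∈ Finset.range (n + 1), t k) * K) := by
          gcongr
          exact Finset.single_le_sum (f := t) (fun _ _ => zero_le) (Finset.self_mem_range_succ n)
      _ ≤ (2 * C₁ + decay α (1 / 2)) * (G * Z) := by
          gcongr
          exact le_add_self
      _ = _ := by ring

/-- The pointwise bound for the kernel of the commutator with a holomorphic symbol. -/
theorem exists_enorm_sub_mul_kernel_le {α : ℝ} (hα : -1 < α) (κ : ℝ) :
    ∃ C : ℝ≥0, ∀ D₁ D₂ : DyadicSystem, AdjacentSystems κ D₁ D₂ →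
      ∀ (b : ℂ → ℂ) (w : ℂ → ℝ≥0∞) (M : ℝ≥0∞) (β : ℝ × ℝ → ℂ),
      AEStronglyMeasurable b (areaMeasure α) → AEMeasurable w (areaMeasure α) →
      DifferentiableOn ℂ b upperHalf →
      (∀ I ∈ D₁.intervals ∪ D₂.intervals,
        ∫⁻ z in carlesonBox I, ‖b z - β I‖ₑ ∂(areaMeasure α) ≤ M * boxMass α w I) →
      ∀ z ∈ upperHalf, ∀ v ∈ upperHalf, ‖b z - b v‖ₑ * kernelModulus α z v ≤
        C * M * ∫⁻ u, kernelModulus α z u * (w u * kernelModulus α u v) ∂(areaMeasure α) := by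
  obtain ⟨C, hC⟩ := exists_enorm_sub_box_mul_kernel_le hα κ
  set a : ℝ≥0 := (boxConst α)⁻¹.toNNReal with ha
  refine ⟨2 * C + a * (2 * C), fun D₁ D₂ h b w M β hbm hw hb hosc z hz v hv => ?_⟩
  obtain ⟨J, hJ, hJ1, hJ2, hJ3, hJ4⟩ := hC D₁ D₂ h b w M β hbm hw hb hosc z hz v hv
  obtain ⟨J', hJ', hJ1', hJ2', hJ3', hJ4'⟩ := hC D₁ D₂ h b w M β hbm hw hb hosc v hv z hz
  have hZ : ∫⁻ u, kernelModulus α v u * (w u * kernelModulus α u z) ∂(areaMeasure α) =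
      ∫⁻ u, kernelModulus α z u * (w u * kernelModulus α u v) ∂(areaMeasure α) := by
    refine lintegral_congr fun u => ?_
    rw [kernelModulus_comm α v u, kernelModulus_comm α u z]; ring
  rw [hZ, kernelModulus_comm α v z] at hJ3' hJ4'
  rw [norm_sub_conj_comm] at hJ1' hJ2'
  have hd0 : 0 < ‖z - (starRingEnd ℂ) v‖ := norm_sub_conj_pos hz hv
  have hre := abs_le.1 (abs_re_sub_re_le_norm_sub_conj z v)
  have hm1 := le_max_left z.re v.re
  have hm2 := le_max_right z.re v.re
  have hm3 : max z.re v.re ≤ z.re + ‖z - (starRingEnd ℂ) v‖ := max_le (by linarith) (by linarith)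
  have hm4 : max z.re v.re ≤ v.re + ‖z - (starRingEnd ℂ) v‖ := max_le (by linarith) (by linarith)
  -- With `d = |z - v̄|`, the interval of length `d` ending at the larger real part is within `d` of
  -- both real parts, hence in `J` and in `J'`.
  have hlink := enorm_sub_le_of_common_box hα hbm
    (p := max z.re v.re - ‖z - (starRingEnd ℂ) v‖) hd0 (hosc _ hJ) (hosc _ hJ')
    ⟨by linarith, by linarith⟩ ⟨by linarith, by linarith⟩
  rw [← kernelModulus_eq_decay] at hlink
  set K := kernelModulus α z v
  set Z := ∫⁻ u, kernelModulus α z u * (w u * kernelModulus α u v) ∂(areaMeasure α)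
  have htri : ‖b z - b v‖ₑ ≤ ‖b z - β J‖ₑ + ‖β J - β J'‖ₑ + ‖b v - β J'‖ₑ := by
    have : b z - b v = (b z - β J) + (β J - β J') + -(b v - β J') := by ring
    rw [this]
    refine (enorm_add_le _ _).trans ?_
    rw [enorm_neg]
    gcongr
    exact enorm_add_le _ _
  calc _ ≤ (‖b z - β J‖ₑ + a * M * K * (boxMass α w J + boxMass α w J') + ‖b v - β J'‖ₑ) * K := by
        gcongr
        refine htri.trans ?_
        gcongr
        exact hlink
    _ = ‖b z - β J‖ₑ * K + ‖b v - β J'‖ₑ * K +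
        a * M * (K * boxMass α w J * K + K * boxMass α w J' * K) := by ring
    _ ≤ C * M * Z + C * M * Z + a * M * (C * Z + C * Z) := by gcongr
    _ = _ := by push_cast; ring

/-! ### Commutators with kernels of Bergman modulus. -/

/-- Measurable kernels with the modulus of the Bergman kernel. -/
structure HasBergmanModulus (α : ℝ) (k : ℂ → ℂ → ℂ) : Prop where
  measurable : Measurable (Function.uncurry k)
  enorm_eq : ∀ z ∈ upperHalf, ∀ w ∈ upperHalf, ‖k z w‖ₑ = kernelModulus α z w

theorem norm_bergmanKernel {α : ℝ} {z w : ℂ} :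
    ‖bergmanKernel α z w‖ = ‖z - (starRingEnd ℂ) w‖ ^ (-(2 + α)) := by
  rw [bergmanKernel, norm_div, Complex.norm_cpow_real, Complex.norm_cpow_real, Complex.norm_I,
    Real.one_rpow, Real.rpow_neg (norm_nonneg _), one_div]

theorem norm_berezinKernel {α : ℝ} {z w : ℂ} :
    ‖berezinKernel α z w‖ = ‖z - (starRingEnd ℂ) w‖ ^ (-(2 + α)) := by
  rw [berezinKernel, Complex.norm_real, Real.rpow_neg (norm_nonneg _), one_div, norm_inv,
    Real.norm_of_nonneg (by positivity)]

theorem hasBergmanModulus_of_eq {α : ℝ} {k : ℂ → ℂ → ℂ}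
    (hk : k = bergmanKernel α ∨ k = berezinKernel α) : HasBergmanModulus α k := by
  have hconj : Measurable fun w : ℂ => (starRingEnd ℂ) w := Complex.continuous_conj.measurable
  rcases hk with rfl | rfl
  · refine ⟨?_, fun z _ w _ => ?_⟩
    · unfold bergmanKernel Function.uncurry
      fun_prop
    · rw [← ofReal_norm, norm_bergmanKernel, kernelModulus]
  · refine ⟨?_, fun z _ w _ => ?_⟩
    · unfold berezinKernel Function.uncurry
      fun_prop
    · rw [← ofReal_norm, norm_berezinKernel, kernelModulus]

section Commutator

variable {α : ℝ} {k : ℂ → ℂ → ℂ}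

theorem HasBergmanModulus.measurable_right (hk : HasBergmanModulus α k) (z : ℂ) :
    Measurable (k z) :=
  hk.measurable.comp measurable_prodMk_left

theorem HasBergmanModulus.aestronglyMeasurable_integralOperator (hk : HasBergmanModulus α k)
    {f : ℂ → ℂ} (hf : AEStronglyMeasurable f (areaMeasure α)) :
    AEStronglyMeasurable (integralOperator α k f) (areaMeasure α) := by
  have e : integralOperator α k f = integralOperator α k (hf.mk f) := by
    funext z
    exact integral_congr_ae (hf.ae_eq_mk.mono fun w hw => by simp only [hw])
  rw [e]
  have h : StronglyMeasurable fun p : ℂ × ℂ => k p.1 p.2 * hf.mk f p.2 :=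
    hk.measurable.stronglyMeasurable.mul
      (hf.stronglyMeasurable_mk.comp_measurable measurable_snd)
  exact h.integral_prod_right'.aestronglyMeasurable

theorem HasBergmanModulus.aestronglyMeasurable_commutatorOp (hk : HasBergmanModulus α k)
    {b f : ℂ → ℂ} (hb : AEStronglyMeasurable b (areaMeasure α))
    (hf : AEStronglyMeasurable f (areaMeasure α)) :
    AEStronglyMeasurable (commutatorOp α k b f) (areaMeasure α) :=
  (hb.mul (hk.aestronglyMeasurable_integralOperator hf)).sub
    (hk.aestronglyMeasurable_integralOperator (hb.mul hf))

theorem commutatorOp_eq_integral {b f : ℂ → ℂ} {z : ℂ}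
    (h1 : Integrable (fun w => k z w * f w) (areaMeasure α))
    (h2 : Integrable (fun w => k z w * (b w * f w)) (areaMeasure α)) :
    commutatorOp α k b f z = ∫ w, (b z - b w) * k z w * f w ∂(areaMeasure α) := by
  rw [commutatorOp, integralOperator, integralOperator, ← integral_const_mul,
    ← integral_sub (h1.const_mul _) h2]
  congr 1
  funext w
  ring

theorem HasBergmanModulus.lintegral_kernel_mul_le (hk : HasBergmanModulus α k) {f : ℂ → ℂ} {z : ℂ}
    (hz : z ∈ upperHalf) :
    ∫⁻ w, ‖k z w * f w‖ₑ ∂(areaMeasure α) = positiveOp α (fun w => ‖f w‖ₑ) z := by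
  refine lintegral_congr_ae ?_
  filter_upwards [ae_mem_upperHalf α] with w hw
  rw [enorm_mul, hk.enorm_eq z hz w hw]

/-- If the kernel of the commutator is dominated by that of `P_α⁺ w P_α⁺`, so is the commutator. -/
theorem HasBergmanModulus.lintegral_commutator_kernel_le (hk : HasBergmanModulus α k)
    {b f : ℂ → ℂ} {w : ℂ → ℝ≥0∞} {N : ℝ≥0∞}
    (hf : AEStronglyMeasurable f (areaMeasure α)) (hw : AEMeasurable w (areaMeasure α))
    (hN : N ≠ ∞) {z : ℂ} (hz : z ∈ upperHalf)
    (hker : ∀ v ∈ upperHalf, ‖b z - b v‖ₑ * kernelModulus α z v ≤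
      N * ∫⁻ u, kernelModulus α z u * (w u * kernelModulus α u v) ∂(areaMeasure α)) :
    ∫⁻ v, ‖(b z - b v) * k z v * f v‖ₑ ∂(areaMeasure α) ≤
      N * positiveOp α (fun u => w u * positiveOp α (fun v => ‖f v‖ₑ) u) z := by
  have hF : AEMeasurable (fun v => ‖f v‖ₑ) (areaMeasure α) := hf.enorm
  have hm : AEMeasurable (fun p : ℂ × ℂ => kernelModulus α z p.2 *
      (w p.2 * kernelModulus α p.2 p.1) * ‖f p.1‖ₑ) ((areaMeasure α).prod (areaMeasure α)) := by
    refine ((((measurable_kernelModulus_right α z).comp measurable_snd).aemeasurable).fun_mul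
      ((hw.comp_snd).fun_mul ?_)).fun_mul hF.comp_fst
    exact ((measurable_kernelModulus α).comp measurable_swap).aemeasurable
  calc _ ≤ ∫⁻ v, N * ∫⁻ u, kernelModulus α z u * (w u * kernelModulus α u v) * ‖f v‖ₑ
        ∂(areaMeasure α) ∂(areaMeasure α) := by
        refine lintegral_mono_ae ?_
        filter_upwards [ae_mem_upperHalf α] with v hv
        rw [enorm_mul, enorm_mul, hk.enorm_eq z hz v hv, lintegral_mul_const' _ _ enorm_ne_top,
          ← mul_assoc]
        exact mul_le_mul' (hker v hv) le_rfl
    _ = N * ∫⁻ u, ∫⁻ v, kernelModulus α z u * (w u * kernelModulus α u v) * ‖f v‖ₑ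
        ∂(areaMeasure α) ∂(areaMeasure α) := by
        rw [lintegral_const_mul' _ _ hN, lintegral_lintegral_swap hm]
    _ = _ := by
        congr 1
        refine lintegral_congr fun u => ?_
        rw [← mul_assoc, positiveOp, ← lintegral_const_mul'' _
          ((measurable_kernelModulus_right α u).aemeasurable.fun_mul hF)]
        refine lintegral_congr fun v => ?_
        ring

/-- Weighted bound for commutators whose kernel is dominated by that of `P_α⁺ w P_α⁺`, where
`w² v = u`. -/
theorem HasBergmanModulus.commutator_bound (hk : HasBergmanModulus α k) {b f : ℂ → ℂ}
    {u u' v v' w : ℂ → ℝ≥0∞} {N : ℝ≥0∞} {B : ℝ≥0} {𝒟 : Set (ℝ × ℝ)} {K : ℝ≥0}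
    (hb : AEStronglyMeasurable b (areaMeasure α)) (hf : AEStronglyMeasurable f (areaMeasure α))
    (hu : DualWeights α 𝒟 K u u') (hv : DualWeights α 𝒟 K v v')
    (hw : AEMeasurable w (areaMeasure α)) (hN : N ≠ ∞)
    (hwu : ∀ᵐ z ∂(areaMeasure α), w z ^ 2 * v z = u z)
    (hBu : ∀ g : ℂ → ℝ≥0∞, AEMeasurable g (areaMeasure α) →
      ∫⁻ z, positiveOp α g z ^ 2 * u z ∂(areaMeasure α) ≤ B * ∫⁻ z, g z ^ 2 * u z ∂(areaMeasure α))
    (hBv : ∀ g : ℂ → ℝ≥0∞, AEMeasurable g (areaMeasure α) →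
      ∫⁻ z, positiveOp α g z ^ 2 * v z ∂(areaMeasure α) ≤ B * ∫⁻ z, g z ^ 2 * v z ∂(areaMeasure α))
    (hker : ∀ z ∈ upperHalf, ∀ v ∈ upperHalf, ‖b z - b v‖ₑ * kernelModulus α z v ≤
      N * ∫⁻ u, kernelModulus α z u * (w u * kernelModulus α u v) ∂(areaMeasure α))
    (hfin : ∫⁻ z, ‖f z‖ₑ ^ 2 * u z ∂(areaMeasure α) ≠ ∞) :
    (∀ᵐ z ∂(areaMeasure α), Integrable (fun w => k z w * f w) (areaMeasure α) ∧
      Integrable (fun w => k z w * (b w * f w)) (areaMeasure α)) ∧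
    ∫⁻ z, ‖commutatorOp α k b f z‖ₑ ^ 2 * v z ∂(areaMeasure α) ≤
      (N * B) ^ 2 * ∫⁻ z, ‖f z‖ₑ ^ 2 * u z ∂(areaMeasure α) := by
  set P := positiveOp α fun v => ‖f v‖ₑ with hP
  have hPm : Measurable P := measurable_positiveOp hf.enorm
  set Q := positiveOp α fun u => w u * P u with hQ
  have hwP : AEMeasurable (fun u => w u * P u) (areaMeasure α) := hw.fun_mul hPm.aemeasurable
  have hQm : Measurable Q := measurable_positiveOp hwP
  have hP2 : ∫⁻ z, P z ^ 2 * u z ∂(areaMeasure α) ≤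
      B * ∫⁻ z, ‖f z‖ₑ ^ 2 * u z ∂(areaMeasure α) := hBu _ hf.enorm
  have hQ2 : ∫⁻ z, Q z ^ 2 * v z ∂(areaMeasure α) ≤
      B * (B * ∫⁻ z, ‖f z‖ₑ ^ 2 * u z ∂(areaMeasure α)) := by
    refine (hBv _ hwP).trans ?_
    gcongr
    refine le_trans (le_of_eq ?_) hP2
    refine lintegral_congr_ae (hwu.mono fun z hz => ?_)
    simp only
    rw [← hz]; ring
  -- Finite weighted norms make `P` and `Q` finite almost everywhere, which is the absolute
  -- convergence of the integrals defining the commutator.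
  have fin : ∀ {g x x' : ℂ → ℝ≥0∞}, Measurable g → DualWeights α 𝒟 K x x' →
      ∫⁻ z, g z ^ 2 * x z ∂(areaMeasure α) ≠ ∞ → ∀ᵐ z ∂(areaMeasure α), g z < ∞ := by
    intro g x x' hg hx h
    filter_upwards [ae_lt_top' ((hg.pow_const 2).aemeasurable.fun_mul hx.left) h, hx.mul_eq_one]
      with z h1 h2
    rw [lt_top_iff_ne_top]
    intro h3
    have h4 : x z ≠ 0 := by rintro h4; simp [h4] at h2
    simp [h3, ENNReal.top_mul h4] at h1
  have hPfin := fin hPm hu (ne_top_of_le_ne_top (ENNReal.mul_ne_top (by simp) hfin) hP2)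
  have hQfin := fin hQm hv (ne_top_of_le_ne_top
    (ENNReal.mul_ne_top (by simp) (ENNReal.mul_ne_top (by simp) hfin)) hQ2)
  have main : ∀ᵐ z ∂(areaMeasure α), (Integrable (fun w => k z w * f w) (areaMeasure α) ∧
      Integrable (fun w => k z w * (b w * f w)) (areaMeasure α)) ∧
      ‖commutatorOp α k b f z‖ₑ ≤ N * Q z := by
    filter_upwards [hPfin, hQfin, ae_mem_upperHalf α] with z h1 h2 hz
    have i1 : Integrable (fun w => k z w * f w) (areaMeasure α) := by
      refine ⟨(hk.measurable_right z).aestronglyMeasurable.mul hf, ?_⟩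
      rw [hasFiniteIntegral_iff_enorm, hk.lintegral_kernel_mul_le hz]
      exact h1
    have h3 := hk.lintegral_commutator_kernel_le hf hw hN hz (hker z hz)
    have i2 : Integrable (fun w => (b z - b w) * k z w * f w) (areaMeasure α) := by
      refine ⟨((aestronglyMeasurable_const.sub hb).mul
        (hk.measurable_right z).aestronglyMeasurable).mul hf, ?_⟩
      rw [hasFiniteIntegral_iff_enorm]
      exact h3.trans_lt (ENNReal.mul_lt_top hN.lt_top h2)
    -- No size bound on `b` is available: this integrand is `b z` times that of `T f` minus the
    -- commutator integrand, and both are integrable.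
    have i3 : Integrable (fun w => k z w * (b w * f w)) (areaMeasure α) := by
      refine ((i1.const_mul (b z)).sub i2).congr (Filter.Eventually.of_forall fun w => ?_)
      simp only [Pi.sub_apply]
      ring
    refine ⟨⟨i1, i3⟩, ?_⟩
    rw [commutatorOp_eq_integral i1 i3]
    exact (enorm_integral_le_lintegral_enorm _).trans h3
  refine ⟨main.mono fun z hz => hz.1, ?_⟩
  calc _ ≤ ∫⁻ z, N ^ 2 * (Q z ^ 2 * v z) ∂(areaMeasure α) := by
        refine lintegral_mono_ae (main.mono fun z hz => ?_)
        calc _ ≤ (N * Q z) ^ 2 * v z := by gcongr; exact hz.2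
          _ = _ := by ring
    _ = N ^ 2 * ∫⁻ z, Q z ^ 2 * v z ∂(areaMeasure α) := by
        rw [lintegral_const_mul' _ _ (ENNReal.pow_ne_top hN)]
    _ ≤ N ^ 2 * (B * (B * ∫⁻ z, ‖f z‖ₑ ^ 2 * u z ∂(areaMeasure α))) := by gcongr
    _ = _ := by ring

end Commutator

/-! ### The weights `μ`, `λ`, `ν` and Bloom's inequality. -/

theorem ENNReal.le_of_sq_le_sq {x y : ℝ≥0∞} (h : x ^ 2 ≤ y ^ 2) : x ≤ y :=
  (ENNReal.pow_le_pow_left_iff two_ne_zero).1 h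

namespace IsWeight

variable {α : ℝ} {μ lam : ℂ → ℝ}

theorem aemeasurable_ofReal (h : IsWeight α μ) :
    AEMeasurable (fun z => ENNReal.ofReal (μ z)) (areaMeasure α) :=
  h.1.ennreal_ofReal

theorem absolutelyContinuous (h : IsWeight α μ) : areaMeasure α ≪ weightedMeasure α μ := by
  refine withDensity_absolutelyContinuous' h.aemeasurable_ofReal (h.2.mono fun z hz => ?_)
  simpa using hz

theorem weightedMeasure_absolutelyContinuous (α : ℝ) (μ : ℂ → ℝ) :
    weightedMeasure α μ ≪ areaMeasure α :=
  withDensity_absolutelyContinuous _ _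

theorem eLpNorm_sq (h : IsWeight α μ) {f : ℂ → ℂ} (hf : AEStronglyMeasurable f (areaMeasure α)) :
    eLpNorm f 2 (weightedMeasure α μ) ^ 2 =
      ∫⁻ z, ‖f z‖ₑ ^ 2 * ENNReal.ofReal (μ z) ∂(areaMeasure α) := by
  rw [eLpNorm_eq_lintegral_rpow_enorm_toReal two_ne_zero ENNReal.ofNat_ne_top]
  simp only [ENNReal.toReal_ofNat, ENNReal.rpow_two]
  rw [← ENNReal.rpow_two, ← ENNReal.rpow_mul, weightedMeasure,
    lintegral_withDensity_eq_lintegral_mul₀ h.aemeasurable_ofReal (hf.enorm.pow_const 2)]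
  norm_num
  exact lintegral_congr fun z => mul_comm _ _

theorem dualWeights (h : IsWeight α μ) {𝒟 : Set (ℝ × ℝ)} {K : ℝ≥0} (hK : b2Const α 𝒟 μ ≤ K) :
    DualWeights α 𝒟 K (fun z => ENNReal.ofReal (μ z)) fun z => ENNReal.ofReal (μ z)⁻¹ where
  left := h.aemeasurable_ofReal
  right := h.1.inv.ennreal_ofReal
  mul_eq_one := h.2.mono fun z hz => by
    rw [← ENNReal.ofReal_mul hz.le, mul_inv_cancel₀ hz.ne', ENNReal.ofReal_one]
  bound := fun I hI => (le_iSup₂ (f := fun I (_ : I ∈ 𝒟) =>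
    (weightMass α μ (carlesonBox I) / areaMeasure α (carlesonBox I)) *
    (weightMass α (fun z => (μ z)⁻¹) (carlesonBox I) / areaMeasure α (carlesonBox I))) I hI).trans hK

theorem aemeasurable_bloomWeight (hμ : IsWeight α μ) (hl : IsWeight α lam) :
    AEMeasurable (bloomWeight μ lam) (areaMeasure α) :=
  (hμ.1.pow_const _).mul (hl.1.pow_const _)

theorem bloomWeight_sq_mul (hμ : IsWeight α μ) (hl : IsWeight α lam) :
    ∀ᵐ z ∂(areaMeasure α), ENNReal.ofReal (bloomWeight μ lam z) ^ 2 * ENNReal.ofReal (lam z) =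
      ENNReal.ofReal (μ z) := by
  filter_upwards [hμ.2, hl.2] with z h1 h2
  have h3 : 0 < bloomWeight μ lam z := by unfold bloomWeight; positivity
  rw [← ENNReal.ofReal_pow h3.le, ← ENNReal.ofReal_mul (by positivity), bloomWeight, mul_pow,
    ← Real.rpow_two, ← Real.rpow_two, ← Real.rpow_mul h1.le, ← Real.rpow_mul h2.le]
  norm_num
  rw [Real.rpow_neg_one, mul_assoc, inv_mul_cancel₀ h2.ne', mul_one]

end IsWeight

/-- A pair of reciprocal weights `w, w'` with `w² = u v'`, where `u, u'` and `v, v'` are pairs of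
reciprocal `B₂` weights. -/
structure IntermediateWeight (α : ℝ) (u u' v v' w w' : ℂ → ℝ≥0∞) : Prop where
  left : AEMeasurable w (areaMeasure α)
  right : AEMeasurable w' (areaMeasure α)
  mul_eq_one : ∀ᵐ z ∂(areaMeasure α), w z * w' z = 1
  sq_left : ∀ᵐ z ∂(areaMeasure α), w z ^ 2 = u z * v' z
  sq_right : ∀ᵐ z ∂(areaMeasure α), w' z ^ 2 = u' z * v z

/-- Cauchy–Schwarz for `w = u^{1/2} v^{1/2}`. It is used for `ν` and `ν⁻¹`, for `1 = ν ν⁻¹`, and for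
the duality of `L²(λ)` and `L²(λ⁻¹)`. -/
theorem sq_setLIntegral_le_of_sq_eq {α : ℝ} {w u v : ℂ → ℝ≥0∞}
    (hu : AEMeasurable u (areaMeasure α))
    (hv : AEMeasurable v (areaMeasure α)) (h : ∀ᵐ z ∂(areaMeasure α), w z ^ 2 = u z * v z)
    (E : Set ℂ) :
    (∫⁻ z in E, w z ∂(areaMeasure α)) ^ 2 ≤
      (∫⁻ z in E, u z ∂(areaMeasure α)) * ∫⁻ z in E, v z ∂(areaMeasure α) := by
  have h1 := lintegral_mul_sq_le ((areaMeasure α).restrict E)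
    (f := fun z => u z ^ (1 / 2 : ℝ)) (g := fun z => v z ^ (1 / 2 : ℝ))
    (hu.restrict.pow_const _) (hv.restrict.pow_const _)
  have e : ∀ x : ℝ≥0∞, (x ^ (1 / 2 : ℝ)) ^ 2 = x := fun x => by
    rw [← ENNReal.rpow_two, ← ENNReal.rpow_mul]; norm_num
  simp only [e] at h1
  refine le_trans (le_of_eq ?_) h1
  congr 1
  refine lintegral_congr_ae (ae_restrict_of_ae ?_)
  filter_upwards [h] with z hz
  rw [← ENNReal.mul_rpow_of_nonneg _ _ (by norm_num), ← hz, ← ENNReal.rpow_two,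
    ← ENNReal.rpow_mul]
  norm_num

namespace IntermediateWeight

variable {α : ℝ} {𝒟 : Set (ℝ × ℝ)} {K : ℝ≥0} {u u' v v' w w' : ℂ → ℝ≥0∞}

/-- By Cauchy–Schwarz on each box the squared characteristic of `w` is at most the product of those
of `u` and `v`. In particular the masses of `ν` on boxes are finite and positive. -/
theorem dualWeights (h : IntermediateWeight α u u' v v' w w')
    (hu : DualWeights α 𝒟 K u u') (hv : DualWeights α 𝒟 K v v') : DualWeights α 𝒟 K w w' where
  left := h.left
  right := h.right
  mul_eq_one := h.mul_eq_one
  bound := fun I hI => by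
    have h1 := sq_setLIntegral_le_of_sq_eq hu.left hv.right h.sq_left (carlesonBox I)
    have h2 := sq_setLIntegral_le_of_sq_eq hu.right hv.left h.sq_right (carlesonBox I)
    have h3 := hu.bound I hI
    have h4 := hv.bound I hI
    refine ENNReal.le_of_sq_le_sq ?_
    set a := (areaMeasure α (carlesonBox I))⁻¹
    simp only [div_eq_mul_inv] at h3 h4 ⊢
    set U := ∫⁻ z in carlesonBox I, u z ∂(areaMeasure α)
    set U' := ∫⁻ z in carlesonBox I, u' z ∂(areaMeasure α)
    set V := ∫⁻ z in carlesonBox I, v z ∂(areaMeasure α)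
    set V' := ∫⁻ z in carlesonBox I, v' z ∂(areaMeasure α)
    set W := ∫⁻ z in carlesonBox I, w z ∂(areaMeasure α)
    set W' := ∫⁻ z in carlesonBox I, w' z ∂(areaMeasure α)
    calc (W * a * (W' * a)) ^ 2 = W ^ 2 * W' ^ 2 * a ^ 4 := by ring
      _ ≤ (U * V') * (U' * V) * a ^ 4 := by gcongr
      _ = (U * a * (U' * a)) * (V * a * (V' * a)) := by ring
      _ ≤ K * K := by gcongr
      _ = _ := by ring

/-- Bloom's inequality: `μ(Q_J) λ⁻¹(Q_J)` is controlled by `ν(Q_I)²` for `I ⊆ J`. -/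
theorem mass_mul_mass_le (h : IntermediateWeight α u u' v v' w w') (hα : -1 < α)
    (hu : DualWeights α 𝒟 K u u') (hv : DualWeights α 𝒟 K v v') {I J : ℝ × ℝ} (hI : I.1 < I.2)
    (hJ : J ∈ 𝒟) (hIJ : J.1 ≤ I.1 ∧ I.2 ≤ J.2) :
    boxMass α u J * boxMass α v' J * areaMeasure α (carlesonBox I) ^ 4 ≤
      (K * areaMeasure α (carlesonBox J) ^ 2 * boxMass α w I) ^ 2 := by
  have hJ' : J.1 < J.2 := by linarith [hIJ.1, hIJ.2]
  -- This bounds `A_α(Q_I)²` by `w(Q_I) w'(Q_I)`. Enlarging only the second box to `Q_J` keeps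
  -- `w(Q_I)` in the final bound; `w'(Q_J)` is then eliminated by the two `B₂` conditions on `J`.
  have h1 := sq_setLIntegral_le_of_sq_eq (w := fun _ => 1) h.left h.right
    (h.mul_eq_one.mono fun z hz => by rw [hz, one_pow]) (carlesonBox I)
  have h2 := sq_setLIntegral_le_of_sq_eq hu.right hv.left h.sq_right (carlesonBox J)
  have h3 := hu.mul_mass_le hα hJ' hJ
  have h4 := hv.mul_mass_le hα hJ' hJ
  have h5 : boxMass α w' I ≤ boxMass α w' J := lintegral_mono_set (carlesonBox_mono hIJ)
  rw [setLIntegral_one] at h1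
  change _ ≤ boxMass α w I * boxMass α w' I at h1
  change boxMass α w' J ^ 2 ≤ boxMass α u' J * boxMass α v J at h2
  change boxMass α u J * boxMass α u' J ≤ _ at h3
  change boxMass α v J * boxMass α v' J ≤ _ at h4
  set a := areaMeasure α (carlesonBox I)
  calc _ = boxMass α u J * boxMass α v' J * (a ^ 2) ^ 2 := by ring
    _ ≤ boxMass α u J * boxMass α v' J * (boxMass α w I * boxMass α w' J) ^ 2 := by
        gcongr; exact h1.trans (by gcongr)
    _ = boxMass α u J * boxMass α v' J * boxMass α w I ^ 2 * boxMass α w' J ^ 2 := by ring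
    _ ≤ boxMass α u J * boxMass α v' J * boxMass α w I ^ 2 * (boxMass α u' J * boxMass α v J) := by
        gcongr
    _ = (boxMass α u J * boxMass α u' J) * (boxMass α v J * boxMass α v' J) *
        boxMass α w I ^ 2 := by ring
    _ ≤ (K * areaMeasure α (carlesonBox J) ^ 2) * (K * areaMeasure α (carlesonBox J) ^ 2) *
        boxMass α w I ^ 2 := by gcongr
    _ = _ := by ring

end IntermediateWeight

theorem IsWeight.intermediateWeight {α : ℝ} {μ lam : ℂ → ℝ} (hμ : IsWeight α μ)
    (hl : IsWeight α lam) :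
    IntermediateWeight α (fun z => ENNReal.ofReal (μ z)) (fun z => ENNReal.ofReal (μ z)⁻¹)
      (fun z => ENNReal.ofReal (lam z)) (fun z => ENNReal.ofReal (lam z)⁻¹)
      (fun z => ENNReal.ofReal (bloomWeight μ lam z))
      (fun z => ENNReal.ofReal (bloomWeight μ lam z)⁻¹) := by
  have hm := hμ.aemeasurable_bloomWeight hl
  have hpos : ∀ᵐ z ∂(areaMeasure α), 0 < bloomWeight μ lam z ∧ 0 < μ z ∧ 0 < lam z ∧
      bloomWeight μ lam z ^ 2 = μ z * (lam z)⁻¹ := by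
    filter_upwards [hμ.2, hl.2] with z h1 h2
    refine ⟨by unfold bloomWeight; positivity, h1, h2, ?_⟩
    rw [bloomWeight, mul_pow,
      ← Real.rpow_two, ← Real.rpow_two, ← Real.rpow_mul h1.le, ← Real.rpow_mul h2.le]
    norm_num
    exact Or.inl (Real.rpow_neg_one _)
  refine ⟨hm.ennreal_ofReal, hm.inv.ennreal_ofReal, ?_, ?_, ?_⟩
  · filter_upwards [hpos] with z ⟨h1, _, _, _⟩
    rw [← ENNReal.ofReal_mul h1.le, mul_inv_cancel₀ h1.ne', ENNReal.ofReal_one]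
  · filter_upwards [hpos] with z ⟨h1, h2, h3, h4⟩
    rw [← ENNReal.ofReal_pow h1.le, ← ENNReal.ofReal_mul h2.le, h4]
  · filter_upwards [hpos] with z ⟨h1, h2, h3, h4⟩
    rw [← ENNReal.ofReal_pow (by positivity), ← ENNReal.ofReal_mul (by positivity), inv_pow, h4,
      mul_inv, inv_inv]

/-! ### The upper bound for holomorphic symbols. -/

theorem aestronglyMeasurable_of_locallyIntegrableOn_upperHalf {α : ℝ} {b : ℂ → ℂ}
    (hb : LocallyIntegrableOn b upperHalf (areaMeasure α)) :
    AEStronglyMeasurable b (areaMeasure α) := by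
  have h := hb.aestronglyMeasurable
  rwa [Measure.restrict_eq_self_of_ae_mem (ae_mem_upperHalf α)] at h

theorem lintegral_sub_average_le_bmoNorm {α : ℝ} {𝒟 : Set (ℝ × ℝ)} {K : ℝ≥0} {ν : ℂ → ℝ}
    {w' : ℂ → ℝ≥0∞} (hα : -1 < α) (hν : DualWeights α 𝒟 K (fun z => ENNReal.ofReal (ν z)) w')
    (h𝒟 : ∀ I ∈ 𝒟, I.1 < I.2) (b : ℂ → ℂ) {I : ℝ × ℝ} (hI : I ∈ 𝒟) :
    ∫⁻ z in carlesonBox I, ‖b z - ⨍ w in carlesonBox I, b w ∂(areaMeasure α)‖ₑ ∂(areaMeasure α) ≤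
      bmoNorm α 𝒟 ν b * boxMass α (fun z => ENNReal.ofReal (ν z)) I := by
  refine (ENNReal.div_le_iff (hν.mass_ne_zero hα (h𝒟 I hI))
    (hν.mass_ne_top hα (h𝒟 I hI) hI)).1 ?_
  exact le_iSup₂ (f := fun I (_ : I ∈ 𝒟) => (∫⁻ z in carlesonBox I,
    ‖b z - ⨍ w in carlesonBox I, b w ∂(areaMeasure α)‖ₑ ∂(areaMeasure α)) /
      weightMass α ν (carlesonBox I)) I hI

/-- Adjacency puts the compact support inside one Carleson box, where a `B₂` weight has finite mass.
-/
theorem IsTestFunction.lintegral_sq_ne_top {α κ : ℝ} (hα : -1 < α) {D₁ D₂ : DyadicSystem}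
    (h : AdjacentSystems κ D₁ D₂) {K : ℝ≥0} {u u' : ℂ → ℝ≥0∞}
    (hu : DualWeights α (D₁.intervals ∪ D₂.intervals) K u u') {f : ℂ → ℂ} (hf : IsTestFunction f) :
    ∫⁻ z, ‖f z‖ₑ ^ 2 * u z ∂(areaMeasure α) ≠ ∞ := by
  obtain ⟨hfm, ⟨M, hM⟩, S, hS, hSu, hfS⟩ := hf
  obtain ⟨R, hR, hSR⟩ := hS.isBounded.exists_pos_norm_le
  obtain ⟨I, hI, hI1, hI2, -⟩ := h.exists_dyadic_cover 0 hR
  have hlt : I.1 < I.2 := by linarith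
  have hsub : S ⊆ carlesonBox I := fun z hz => by
    have h1 := abs_le.1 ((Complex.abs_re_le_norm z).trans (hSR z hz))
    have h2 := abs_le.1 ((Complex.abs_im_le_norm z).trans (hSR z hz))
    exact ⟨⟨by linarith, by linarith⟩, hSu hz, by linarith⟩
  refine ne_top_of_le_ne_top (b := ENNReal.ofReal M ^ 2 * boxMass α u I) (ENNReal.mul_ne_top
    (ENNReal.pow_ne_top ENNReal.ofReal_ne_top) (hu.mass_ne_top hα hlt hI)) ?_
  rw [boxMass, ← lintegral_const_mul' _ _ (ENNReal.pow_ne_top ENNReal.ofReal_ne_top),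
    ← lintegral_indicator (measurableSet_carlesonBox I)]
  refine lintegral_mono fun z => ?_
  by_cases hz : z ∈ carlesonBox I
  · rw [Set.indicator_of_mem hz]
    gcongr
    rw [← ofReal_norm]
    exact ENNReal.ofReal_le_ofReal (hM z)
  · simp [hfS z fun h => hz (hsub h)]

theorem DyadicSystem.lt_of_mem_union {D₁ D₂ : DyadicSystem} :
    ∀ I ∈ D₁.intervals ∪ D₂.intervals, I.1 < I.2 := by
  rintro I (hI | hI) <;> exact lt_of_mem_intervals hI

/-- The upper bound for commutators with symbols in `BMOA_ν`. -/
theorem exists_commutator_upper_bound {α : ℝ} (hα : -1 < α) (κ : ℝ) (K : ℝ≥0) :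
    ∃ C : ℝ≥0, ∀ D₁ D₂ : DyadicSystem, AdjacentSystems κ D₁ D₂ → ∀ μ lam : ℂ → ℝ,
      IsWeight α μ → IsWeight α lam → b2Const α (D₁.intervals ∪ D₂.intervals) μ ≤ K →
      b2Const α (D₁.intervals ∪ D₂.intervals) lam ≤ K → ∀ k, HasBergmanModulus α k →
      ∀ b : ℂ → ℂ, LocallyIntegrableOn b upperHalf (areaMeasure α) →
      DifferentiableOn ℂ b upperHalf →
      bmoNorm α (D₁.intervals ∪ D₂.intervals) (bloomWeight μ lam) b ≠ ∞ →
      ∀ f : ℂ → ℂ, AEStronglyMeasurable f (areaMeasure α) →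
      eLpNorm f 2 (weightedMeasure α μ) ≠ ∞ →
      (∀ᵐ z ∂(areaMeasure α), Integrable (fun w => k z w * f w) (areaMeasure α) ∧
        Integrable (fun w => k z w * (b w * f w)) (areaMeasure α)) ∧
      eLpNorm (commutatorOp α k b f) 2 (weightedMeasure α lam) ≤
        C * bmoNorm α (D₁.intervals ∪ D₂.intervals) (bloomWeight μ lam) b *
          eLpNorm f 2 (weightedMeasure α μ) := by
  obtain ⟨B, hB⟩ := exists_lintegral_positiveOp_sq_le hα κ K
  obtain ⟨C, hC⟩ := exists_enorm_sub_mul_kernel_le hα κ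
  refine ⟨C * B, fun D₁ D₂ h μ lam hμ hl hμK hlK k hk b hb hbd hM f hf hfin => ?_⟩
  set M := bmoNorm α (D₁.intervals ∪ D₂.intervals) (bloomWeight μ lam) b
  have hbm := aestronglyMeasurable_of_locallyIntegrableOn_upperHalf hb
  have du := hμ.dualWeights hμK
  have dv := hl.dualWeights hlK
  have hν := hμ.intermediateWeight hl
  have dν := hν.dualWeights du dv
  have e1 := hμ.eLpNorm_sq hf
  have e2 := hl.eLpNorm_sq (hk.aestronglyMeasurable_commutatorOp hbm hf)
  obtain ⟨h1, h2⟩ := hk.commutator_bound (N := C * M) hbm hf du dv hν.left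
    (ENNReal.mul_ne_top (by simp) hM) (hμ.bloomWeight_sq_mul hl)
    (fun g hg => hB D₁ D₂ h _ _ g du hg) (fun g hg => hB D₁ D₂ h _ _ g dv hg)
    (hC D₁ D₂ h b _ M _ hbm hν.left hbd fun I hI =>
      lintegral_sub_average_le_bmoNorm hα dν DyadicSystem.lt_of_mem_union b hI)
    (by rw [← e1]; exact ENNReal.pow_ne_top hfin)
  refine ⟨h1, ENNReal.le_of_sq_le_sq ?_⟩
  rw [e2, mul_pow, e1]
  refine h2.trans (le_of_eq ?_)
  push_cast; ring

/-! ### From test functions to all of `L²_α(μ)`. -/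

/-- The infimum defining the norm is itself admissible. The norm of `f` is divided out when nonzero;
when it is zero, any admissible constant shows that the left side vanishes. -/
theorem eLpNorm_commutatorOp_le_commutatorNorm {α : ℝ} {k : ℂ → ℂ → ℂ} {b f : ℂ → ℂ}
    {μ lam : ℂ → ℝ} (hfin : commutatorNorm α k b μ lam ≠ ∞) (hf : IsTestFunction f)
    (hf' : eLpNorm f 2 (weightedMeasure α μ) ≠ ∞) :
    eLpNorm (commutatorOp α k b f) 2 (weightedMeasure α lam) ≤
      commutatorNorm α k b μ lam * eLpNorm f 2 (weightedMeasure α μ) := by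
  by_cases h0 : eLpNorm f 2 (weightedMeasure α μ) = 0
  · obtain ⟨N, hN, -⟩ := sInf_lt_iff.1 (lt_top_iff_ne_top.2 hfin)
    simpa [h0] using hN f hf
  · rw [← ENNReal.div_le_iff h0 hf']
    refine le_sInf fun N hN => ?_
    rw [ENNReal.div_le_iff h0 hf']
    exact hN f hf

/-- Truncations of a measurable function by test functions. -/
def truncationSet (f : ℂ → ℂ) (n : ℕ) : Set ℂ :=
  {z | ‖f z‖ ≤ n} ∩ (Set.Icc (-(n : ℝ)) n ×ℂ Set.Icc ((n : ℝ) + 1)⁻¹ n)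

theorem measurableSet_truncationSet {f : ℂ → ℂ} (hf : Measurable f) (n : ℕ) :
    MeasurableSet (truncationSet f n) :=
  (measurableSet_le hf.norm measurable_const).inter 
    ((Complex.measurable_re measurableSet_Icc).inter (Complex.measurable_im measurableSet_Icc))

theorem isTestFunction_truncation {f : ℂ → ℂ} (hf : Measurable f) (n : ℕ) :
    IsTestFunction ((truncationSet f n).indicator f) := by
  refine ⟨hf.indicator (measurableSet_truncationSet hf n), ⟨n, fun z => ?_⟩,
    Set.Icc (-(n : ℝ)) n ×ℂ Set.Icc ((n : ℝ) + 1)⁻¹ n, isCompact_Icc.reProdIm isCompact_Icc,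
    fun z hz => ?_, fun z hz => ?_⟩
  · by_cases hz : z ∈ truncationSet f n
    · rw [Set.indicator_of_mem hz]; exact hz.1
    · rw [Set.indicator_of_notMem hz]; simp
  · have h1 : ((n : ℝ) + 1)⁻¹ ≤ z.im := hz.2.1
    exact lt_of_lt_of_le (by positivity) h1
  · exact Set.indicator_of_notMem (fun h => hz h.2) _

theorem eventually_mem_truncationSet (f : ℂ → ℂ) {z : ℂ} (hz : z ∈ upperHalf) :
    ∀ᶠ n : ℕ in Filter.atTop, z ∈ truncationSet f n := by
  have hy : 0 < z.im := hz
  filter_upwards [Filter.eventually_ge_atTop ⌈‖f z‖⌉₊, Filter.eventually_ge_atTop ⌈‖z‖⌉₊,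
    Filter.eventually_ge_atTop ⌈z.im⁻¹⌉₊] with n h1 h2 h3
  have h1' : ‖f z‖ ≤ n := (Nat.le_ceil _).trans (by exact_mod_cast h1)
  have h2' : ‖z‖ ≤ n := (Nat.le_ceil _).trans (by exact_mod_cast h2)
  have h3' : z.im⁻¹ ≤ n := (Nat.le_ceil _).trans (by exact_mod_cast h3)
  have h4 := abs_le.1 ((Complex.abs_re_le_norm z).trans h2')
  have h5 := abs_le.1 ((Complex.abs_im_le_norm z).trans h2')
  refine ⟨h1', ⟨h4.1, h4.2⟩, ?_, h5.2⟩
  exact inv_le_of_inv_le₀ hy (h3'.trans (by linarith))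

/-- A commutator whose integrals converge absolutely on `L²(μ)` is bounded on all of `L²(μ)` with
its norm on test functions. -/
theorem commutatorBoundedOnL2_of_integrable {α : ℝ} {k : ℂ → ℂ → ℂ} (hk : HasBergmanModulus α k)
    {b : ℂ → ℂ} {μ lam : ℂ → ℝ} (hμ : IsWeight α μ)
    (hb : AEStronglyMeasurable b (areaMeasure α)) (hfin : commutatorNorm α k b μ lam ≠ ∞)
    (hint : ∀ f : ℂ → ℂ, AEStronglyMeasurable f (areaMeasure α) →
      eLpNorm f 2 (weightedMeasure α μ) ≠ ∞ →
      ∀ᵐ z ∂(areaMeasure α), Integrable (fun w => k z w * f w) (areaMeasure α) ∧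
        Integrable (fun w => k z w * (b w * f w)) (areaMeasure α)) :
    CommutatorBoundedOnL2 α k b μ lam (commutatorNorm α k b μ lam) := by
  intro f hf
  have hfm : AEStronglyMeasurable f (areaMeasure α) := hf.1.mono_ac hμ.absolutelyContinuous
  have hI := hint f hfm hf.2.ne
  have hcm := hk.aestronglyMeasurable_commutatorOp hb hfm
  have hac := IsWeight.weightedMeasure_absolutelyContinuous α lam
  set g := hfm.mk f with hg
  have hfg : f =ᵐ[areaMeasure α] g := hfm.ae_eq_mk
  have hgm : Measurable g := hfm.stronglyMeasurable_mk.measurable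
  set F : ℕ → ℂ → ℂ := fun n => (truncationSet g n).indicator g with hF
  have hFt : ∀ n, IsTestFunction (F n) := fun n => isTestFunction_truncation hgm n
  have hFle : ∀ n z, ‖F n z‖ ≤ ‖g z‖ := fun n z => norm_indicator_le_norm_self _ _
  have hFlim : ∀ z ∈ upperHalf, Filter.Tendsto (fun n => F n z) Filter.atTop (nhds (g z)) := by
    intro z hz
    refine tendsto_const_nhds.congr' ?_
    filter_upwards [eventually_mem_truncationSet g hz] with n hn
    rw [hF]; simp only [Set.indicator_of_mem hn]
  have hFnorm : ∀ n, eLpNorm (F n) 2 (weightedMeasure α μ) ≤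
      eLpNorm f 2 (weightedMeasure α μ) := by
    intro n
    refine eLpNorm_mono_ae ?_
    filter_upwards [(IsWeight.weightedMeasure_absolutelyContinuous α μ) hfg] with z hz
    rw [hz]; exact hFle n z
  -- Used with `a = 1` and `a = b`, the two integrals in the commutator; the integrand for `f`
  -- itself is the dominating function.
  have op_lim : ∀ (z : ℂ) (a : ℂ → ℂ), AEStronglyMeasurable a (areaMeasure α) →
      Integrable (fun w => k z w * (a w * f w)) (areaMeasure α) →
      Filter.Tendsto (fun n => integralOperator α k (fun w => a w * F n w) z) Filter.atTop
        (nhds (integralOperator α k (fun w => a w * f w) z)) := by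
    intro z a ham hi
    refine tendsto_integral_of_dominated_convergence (fun w => ‖k z w * (a w * f w)‖)
      (fun n => (hk.measurable_right z).aestronglyMeasurable.mul
        (ham.mul (hFt n).1.aestronglyMeasurable)) hi.norm (fun n => ?_) ?_
    · filter_upwards [hfg] with w hw
      rw [norm_mul, norm_mul, norm_mul, norm_mul, hw]
      gcongr
      exact hFle n w
    · filter_upwards [hfg, ae_mem_upperHalf α] with w hw hw'
      rw [hw]
      exact ((hFlim w hw').const_mul _).const_mul _
  have hlim : ∀ᵐ z ∂(weightedMeasure α lam), Filter.Tendsto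
      (fun n => commutatorOp α k b (F n) z) Filter.atTop (nhds (commutatorOp α k b f z)) := by
    refine hac ?_
    filter_upwards [hI] with z ⟨h1, h2⟩
    have h3 := op_lim z (fun _ => 1) aestronglyMeasurable_const (by simpa using h1)
    simp only [one_mul] at h3
    exact (h3.const_mul _).sub (op_lim z b hb h2)
  -- Fatou along the truncations, whose norms do not exceed that of `f`, so no constant is lost.
  have hle : eLpNorm (commutatorOp α k b f) 2 (weightedMeasure α lam) ≤
      commutatorNorm α k b μ lam * eLpNorm f 2 (weightedMeasure α μ) := by
    refine (Lp.eLpNorm_lim_le_liminf_eLpNorm (fun n => (hk.aestronglyMeasurable_commutatorOp hb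
      (hFt n).1.aestronglyMeasurable).mono_ac hac) _ hlim).trans ?_
    refine Filter.liminf_le_of_le (by isBoundedDefault) fun x hx => ?_
    obtain ⟨n, hn⟩ := hx.exists
    refine hn.trans ((eLpNorm_commutatorOp_le_commutatorNorm hfin (hFt n)
      (ne_top_of_le_ne_top hf.2.ne (hFnorm n))).trans ?_)
    gcongr
    exact hFnorm n
  exact ⟨hI, ⟨hcm.mono_ac hac, hle.trans_lt (ENNReal.mul_lt_top hfin.lt_top hf.2)⟩, hle⟩

/-! ### Kernels that are almost constant far from the diagonal. -/

/-- Kernels that are almost constant on pairs of boxes which are far apart compared with their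
size. -/
def IsAlmostConstantFar (α : ℝ) (k : ℂ → ℂ → ℂ) : Prop :=
  ∀ ε > 0, ∃ N : ℝ, 1 ≤ N ∧ ∀ s L : ℝ, 0 < L → ∃ k₀ k₁ : ℂ,
    ‖k₀‖ = (N * L) ^ (-(2 + α)) ∧ ‖k₁‖ = (N * L) ^ (-(2 + α)) ∧
    ∀ z ∈ carlesonBox (s, s + L), ∀ w ∈ carlesonBox (s - N * L, s - N * L + L),
      ‖k z w - k₀‖ ≤ ε * ‖k₀‖ ∧ ‖k w z - k₁‖ ≤ ε * ‖k₁‖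

/-- After division by `N L` the point `z - w̄` is within `4 / N` of the boundary point `1`, so
homogeneity and continuity of `φ` at `1` give `k z w ≈ (N L)^{-(2+α)} φ(1)`. The symmetry of `φ`
makes the kernel Hermitian, which settles the opposite order with the conjugate constant. -/
theorem isAlmostConstantFar_of_homogeneous {α : ℝ} {k : ℂ → ℂ → ℂ} {φ : ℂ → ℂ}
    (hk : ∀ z ∈ upperHalf, ∀ w ∈ upperHalf, k z w = φ (z - (starRingEnd ℂ) w))
    (hhom : ∀ r : ℝ, 0 < r → ∀ x ∈ upperHalf,
      φ (r * x) = ((r ^ (-(2 + α)) : ℝ) : ℂ) * φ x)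
    (hcont : ContinuousAt φ 1) (hone : ‖φ 1‖ = 1)
    (hsymm : ∀ x ∈ upperHalf, φ (-(starRingEnd ℂ) x) = (starRingEnd ℂ) (φ x)) :
    IsAlmostConstantFar α k := by
  intro ε hε
  obtain ⟨δ, hδ, hφ⟩ := Metric.continuousAt_iff.1 hcont ε hε
  refine ⟨max 1 (4 / δ), le_max_left _ _, fun s L hL => ?_⟩
  set N := max 1 (4 / δ) with hN
  have hN1 : 1 ≤ N := le_max_left _ _
  have hNδ : 4 ≤ N * δ := (div_le_iff₀ hδ).1 (le_max_right _ _)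
  have hNL : 0 < N * L := by positivity
  set r : ℝ := (N * L) ^ (-(2 + α)) with hr
  have hr0 : 0 < r := by positivity
  have hnorm : ‖(r : ℂ) * φ 1‖ = r := by
    rw [norm_mul, hone, mul_one, Complex.norm_real, Real.norm_of_nonneg hr0.le]
  refine ⟨r * φ 1, (starRingEnd ℂ) (r * φ 1), hnorm, by rw [Complex.norm_conj, hnorm],
    fun z hz w hw => ?_⟩
  have hzu : z ∈ upperHalf := hz.2.1
  have hwu : w ∈ upperHalf := hw.2.1
  have hzw : z - (starRingEnd ℂ) w ∈ upperHalf := by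
    have h1 : 0 < z.im := hzu
    have h2 : 0 < w.im := hwu
    simp only [upperHalf, Set.mem_ofPred_eq, Complex.sub_im, Complex.conj_im]
    linarith
  have hwz : k w z = (starRingEnd ℂ) (k z w) := by
    rw [hk w hwu z hzu, hk z hzu w hwu, ← hsymm _ hzw]
    congr 1
    simp
  have main : ‖k z w - r * φ 1‖ ≤ ε * r := by
    set x : ℂ := ((N * L)⁻¹ : ℝ) * (z - (starRingEnd ℂ) w) with hx
    have hxu : x ∈ upperHalf := by
      change 0 < x.im
      rw [hx, Complex.im_ofReal_mul]
      exact mul_pos (by positivity) hzw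
    have hzx : z - (starRingEnd ℂ) w = ((N * L : ℝ) : ℂ) * x := by
      rw [hx, ← mul_assoc, ← Complex.ofReal_mul, mul_inv_cancel₀ hNL.ne', Complex.ofReal_one,
        one_mul]
    have hdist : dist x 1 < δ := by
      have h1 : x - 1 = ((N * L)⁻¹ : ℝ) * (z - (starRingEnd ℂ) w - (N * L : ℝ)) := by
        rw [mul_sub, ← Complex.ofReal_mul, inv_mul_cancel₀ hNL.ne', Complex.ofReal_one]
      have h2 : ‖z - (starRingEnd ℂ) w - (N * L : ℝ)‖ < 4 * L := by
        refine (Complex.norm_le_abs_re_add_abs_im _).trans_lt ?_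
        have h3 := hz.1.1
        have h4 := hz.1.2
        have h5 := hz.2.2
        have h6 := hw.1.1
        have h7 := hw.1.2
        have h8 := hw.2.2
        have h9 : 0 < z.im := hzu
        have h10 : 0 < w.im := hwu
        simp only [Complex.sub_re, Complex.conj_re, Complex.ofReal_re, Complex.sub_im,
          Complex.conj_im, Complex.ofReal_im, sub_zero, sub_neg_eq_add] at *
        rw [abs_of_pos (add_pos h9 h10)]
        have : |z.re - w.re - N * L| ≤ L := abs_le.2 ⟨by linarith, by linarith⟩
        linarith
      rw [dist_eq_norm, h1, norm_mul, Complex.norm_real, Real.norm_of_nonneg (by positivity),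
        inv_mul_lt_iff₀ hNL]
      calc _ < 4 * L := h2
        _ ≤ (N * δ) * L := by gcongr
        _ = _ := by ring
    have h3 := hφ hdist
    rw [dist_eq_norm] at h3
    rw [hk z hzu w hwu, hzx, hhom _ hNL x hxu, ← mul_sub, norm_mul, Complex.norm_real,
      Real.norm_of_nonneg (by positivity), ← hr, mul_comm]
    gcongr
  refine ⟨by rwa [hnorm], ?_⟩
  rwa [hwz, ← map_sub, Complex.norm_conj, Complex.norm_conj, hnorm]

theorem isAlmostConstantFar_berezinKernel (α : ℝ) :
    IsAlmostConstantFar α (berezinKernel α) := by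
  refine isAlmostConstantFar_of_homogeneous (φ := fun x => ((‖x‖ ^ (-(2 + α)) : ℝ) : ℂ))
    (fun z _ w _ => ?_) (fun r hr x _ => ?_) ?_ (by simp) (fun x _ => ?_)
  · rw [berezinKernel, Real.rpow_neg (norm_nonneg _), one_div]
  · rw [norm_mul, Complex.norm_real, Real.norm_of_nonneg hr.le,
      Real.mul_rpow hr.le (norm_nonneg _), Complex.ofReal_mul]
  · refine Complex.continuous_ofReal.continuousAt.comp ?_
    exact ContinuousAt.rpow_const continuous_norm.continuousAt (Or.inl (by simp))
  · rw [norm_neg, Complex.norm_conj, Complex.conj_ofReal]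

/-- The principal logarithm is continuous at `1`, and `log (-x̄) = conj (log x) + π i` on the half
plane; with `log i = π i / 2` this makes `log i - log (-x̄)` the conjugate of `log i - log x`. -/
theorem isAlmostConstantFar_bergmanKernel (α : ℝ) :
    IsAlmostConstantFar α (bergmanKernel α) := by
  have hne : ∀ x ∈ upperHalf, x ≠ 0 := by
    rintro x hx rfl
    simp [upperHalf] at hx
  refine isAlmostConstantFar_of_homogeneous
    (φ := fun x => Complex.exp ((Complex.log Complex.I - Complex.log x) * ((2 + α : ℝ) : ℂ)))
    (fun z hz w hw => ?_) (fun r hr x hx => ?_) ?_ ?_ (fun x hx => ?_)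
  · have h0 : z - (starRingEnd ℂ) w ≠ 0 := norm_pos_iff.1 (norm_sub_conj_pos hz hw)
    rw [bergmanKernel, Complex.cpow_def_of_ne_zero Complex.I_ne_zero,
      Complex.cpow_def_of_ne_zero h0, ← Complex.exp_sub, sub_mul]
  · rw [Complex.log_ofReal_mul hr (hne x hx), Real.rpow_def_of_pos hr, Complex.ofReal_exp,
      ← Complex.exp_add]
    congr 1
    push_cast
    ring
  · have : ContinuousAt Complex.log 1 := continuousAt_clog Complex.one_mem_slitPlane
    fun_prop
  · rw [Complex.log_one, sub_zero, Complex.log_I, Complex.norm_exp]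
    simp
  · have him : ((starRingEnd ℂ) x).im < 0 := by
      have : 0 < x.im := hx
      simpa using this
    have harg : x.arg ≠ Real.pi := by
      intro h
      have := (Complex.arg_eq_pi_iff.1 h).2
      exact (ne_of_gt hx) this
    rw [← Complex.exp_conj]
    congr 1
    have h1 : Complex.log (-(starRingEnd ℂ) x) = (starRingEnd ℂ) (Complex.log x) + Real.pi * Complex.I := by
      rw [← Complex.log_conj x harg, Complex.log, Complex.log, norm_neg,
        Complex.arg_neg_eq_arg_add_pi_of_im_neg him]
      push_cast
      ring
    rw [h1, map_mul, map_sub, Complex.conj_ofReal, Complex.log_I]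
    simp only [map_mul, map_div₀, Complex.conj_ofReal, Complex.conj_I, map_ofNat]
    ring

/-! ### Mean oscillation on products of sets. -/

section Oscillation

variable {X : Type*} [MeasurableSpace X] {τ : Measure X} {b : X → ℂ} {E F : Set X}

theorem aemeasurable_setLIntegral_enorm_sub [SFinite τ] (hb : AEStronglyMeasurable b τ) (F : Set X) :
    AEMeasurable (fun z => ∫⁻ w in F, ‖b z - b w‖ₑ ∂τ) τ := by
  have h : AEMeasurable (fun p : X × X => ‖b p.1 - b p.2‖ₑ) (τ.prod (τ.restrict F)) :=
    (hb.comp_fst.fun_sub (hb.restrict.comp_snd)).enorm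
  exact h.lintegral_prod_right'

/-- Replacing the kernel by the constant `k₀` costs at most the fraction `ε` of `|k₀|` times the
full double oscillation. -/
theorem enorm_mul_lintegral_integral_sub_le [SFinite τ] {q : X → X → ℂ} {k₀ : ℂ} {ε : ℝ}
    (hbm : AEStronglyMeasurable b τ)
    (hE : MeasurableSet E) (hF : MeasurableSet F) (hFtop : τ F ≠ ∞) (hb : IntegrableOn b F τ)
    (hq : ∀ z, Measurable (q z)) (hqk : ∀ z ∈ E, ∀ w ∈ F, ‖q z w - k₀‖ ≤ ε * ‖k₀‖) :
    ‖k₀‖ₑ * ∫⁻ z in E, ‖∫ w in F, (b z - b w) ∂τ‖ₑ ∂τ ≤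
      ∫⁻ z in E, ‖∫ w in F, (b z - b w) * q z w ∂τ‖ₑ ∂τ +
        ENNReal.ofReal ε * (‖k₀‖ₑ * ∫⁻ z in E, ∫⁻ w in F, ‖b z - b w‖ₑ ∂τ ∂τ) := by
  rw [← lintegral_const_mul' _ _ enorm_ne_top, ← mul_assoc,
    ← lintegral_const_mul' _ _ (ENNReal.mul_ne_top ENNReal.ofReal_ne_top enorm_ne_top),
    ← lintegral_add_right' _ ((aemeasurable_setLIntegral_enorm_sub hbm F).restrict.const_mul _)]
  refine setLIntegral_mono' hE fun z hz => ?_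
  have hg : IntegrableOn (fun w => b z - b w) F τ := (integrableOn_const hFtop).sub hb
  have hd : IntegrableOn (fun w => (q z w - k₀) * (b z - b w)) F τ :=
    Integrable.bdd_mul (c := ε * ‖k₀‖) hg ((hq z).sub_const _).aestronglyMeasurable
      ((ae_restrict_iff' hF).2 (Filter.Eventually.of_forall fun w hw => hqk z hz w hw))
  have hq' : IntegrableOn (fun w => (b z - b w) * q z w) F τ :=
    (hd.add (hg.const_mul k₀)).congr (Filter.Eventually.of_forall fun w => by
      simp only [Pi.add_apply]; ring)
  have e : k₀ * ∫ w in F, (b z - b w) ∂τ = ∫ w in F, (b z - b w) * q z w ∂τ -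
      ∫ w in F, (q z w - k₀) * (b z - b w) ∂τ := by
    rw [← integral_sub hq' hd, ← integral_const_mul]
    congr 1
    funext w
    ring
  rw [← enorm_mul, e]
  refine (enorm_sub_le).trans ?_
  gcongr
  refine (enorm_integral_le_lintegral_enorm _).trans ?_
  rw [← lintegral_const_mul' _ _ (ENNReal.mul_ne_top ENNReal.ofReal_ne_top enorm_ne_top)]
  refine setLIntegral_mono' hF fun w hw => ?_
  rw [enorm_mul]
  gcongr
  have hε : 0 ≤ ε * ‖k₀‖ := (norm_nonneg _).trans (hqk z hz w hw)
  rw [← ofReal_norm (q z w - k₀), ← ofReal_norm k₀, ← ENNReal.ofReal_mul' (norm_nonneg _)]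
  exact ENNReal.ofReal_le_ofReal (hqk z hz w hw)

/-- The inner integrals carry no absolute values, so cancellation has to be undone. With `y z = ∫_F
(b z - b w)` and `y' w = ∫_E (b w - b z)`, one has `τ(E) τ(F) (b z - b w) = τ(E) y z - τ(F) y' w -
∫_E y`. Integration of absolute values counts `y` twice and `y'` once. -/
theorem lintegral_lintegral_sub_le (hbm : AEStronglyMeasurable b τ)
    (hE0 : τ E ≠ 0) (hF0 : τ F ≠ 0) (hE : τ E ≠ ∞) (hF : τ F ≠ ∞)
    (hbE : IntegrableOn b E τ) (hbF : IntegrableOn b F τ) :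
    ∫⁻ z in E, ∫⁻ w in F, ‖b z - b w‖ₑ ∂τ ∂τ ≤
      2 * ∫⁻ z in E, ‖∫ w in F, (b z - b w) ∂τ‖ₑ ∂τ +
        ∫⁻ w in F, ‖∫ z in E, (b w - b z) ∂τ‖ₑ ∂τ := by
  set B := ∫ z in E, b z ∂τ with hB
  set B' := ∫ w in F, b w ∂τ with hB'
  have sub : ∀ (G : Set X), τ G ≠ ∞ → IntegrableOn b G τ → ∀ z,
      ∫ w in G, (b z - b w) ∂τ = (τ.real G : ℂ) * b z - ∫ w in G, b w ∂τ := by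
    intro G hG hbG z
    rw [integral_sub (integrableOn_const hG : IntegrableOn (fun _ => b z) G τ) hbG, setIntegral_const]
    simp
  set y : X → ℂ := fun z => ∫ w in F, (b z - b w) ∂τ with hy
  set y' : X → ℂ := fun w => ∫ z in E, (b w - b z) ∂τ with hy'
  have hye : y = fun z => (τ.real F : ℂ) * b z - B' := funext fun z => sub F hF hbF z
  have hye' : y' = fun w => (τ.real E : ℂ) * b w - B := funext fun w => sub E hE hbE w
  have hym : AEStronglyMeasurable y τ := by
    rw [hye]; exact (hbm.const_mul _).sub aestronglyMeasurable_const
  have hym' : AEStronglyMeasurable y' τ := by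
    rw [hye']; exact (hbm.const_mul _).sub aestronglyMeasurable_const
  have hY : ∫ z in E, y z ∂τ = (τ.real F : ℂ) * B - (τ.real E : ℂ) * B' := by
    rw [hye, integral_sub (hbE.const_mul _) (integrableOn_const hE), integral_const_mul,
      setIntegral_const]
    simp [hB]
  set Y := ∫⁻ z in E, ‖y z‖ₑ ∂τ with hYdef
  set Y' := ∫⁻ w in F, ‖y' w‖ₑ ∂τ with hYdef'
  have henorm : ∀ G : Set X, τ G ≠ ∞ → ‖(τ.real G : ℂ)‖ₑ = τ G := by
    intro G hG
    rw [← ofReal_norm, Complex.norm_real, Real.norm_of_nonneg measureReal_nonneg,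
      ofReal_measureReal hG]
  have point : ∀ z w, τ E * τ F * ‖b z - b w‖ₑ ≤ τ E * ‖y z‖ₑ + τ F * ‖y' w‖ₑ + Y := by
    intro z w
    have e : (τ.real E : ℂ) * (τ.real F : ℂ) * (b z - b w) =
        ((τ.real E : ℂ) * y z - (τ.real F : ℂ) * y' w) - ∫ z in E, y z ∂τ := by
      rw [hY, hye, hye']; ring
    calc τ E * τ F * ‖b z - b w‖ₑ = ‖(τ.real E : ℂ) * (τ.real F : ℂ) * (b z - b w)‖ₑ := by
          rw [enorm_mul, enorm_mul, henorm E hE, henorm F hF]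
      _ ≤ (‖(τ.real E : ℂ) * y z‖ₑ + ‖(τ.real F : ℂ) * y' w‖ₑ) + Y := by
          rw [e]
          exact enorm_sub_le.trans (add_le_add enorm_sub_le (enorm_integral_le_lintegral_enorm _))
      _ = _ := by rw [enorm_mul, enorm_mul, henorm E hE, henorm F hF]
  have hEF0 : τ E * τ F ≠ 0 := mul_ne_zero hE0 hF0
  have hEFtop : τ E * τ F ≠ ∞ := ENNReal.mul_ne_top hE hF
  refine (ENNReal.mul_le_mul_iff_right hEF0 hEFtop).1 ?_
  calc _ = ∫⁻ z in E, ∫⁻ w in F, τ E * τ F * ‖b z - b w‖ₑ ∂τ ∂τ := by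
        rw [← lintegral_const_mul' _ _ hEFtop]
        exact lintegral_congr fun z => (lintegral_const_mul' _ _ hEFtop).symm
    _ ≤ ∫⁻ z in E, ∫⁻ w in F, (τ E * ‖y z‖ₑ + τ F * ‖y' w‖ₑ + Y) ∂τ ∂τ :=
        lintegral_mono fun z => lintegral_mono fun w => point z w
    _ = ∫⁻ z in E, (τ F * (τ E * ‖y z‖ₑ) + (τ F * Y' + τ F * Y)) ∂τ := by
        refine lintegral_congr fun z => ?_
        rw [lintegral_add_right _ measurable_const,
          lintegral_add_left' aemeasurable_const, lintegral_const_mul' _ _ hF]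
        simp only [setLIntegral_const]
        ring
    _ = τ F * (τ E * Y) + (τ F * Y' + τ F * Y) * τ E := by
        rw [lintegral_add_right _ measurable_const, setLIntegral_const,
          lintegral_const_mul' _ _ hF, lintegral_const_mul' _ _ hE]
    _ = _ := by ring

/-- Two-sided comparison of the mean oscillation of `b` on `E × F` with the commutators of `b` and
an integral operator whose kernel is almost constant on `E × F` and on `F × E`. -/
theorem lintegral_lintegral_sub_le_of_almost_constant [SFinite τ] {q : X → X → ℂ} {k₀ k₁ : ℂ} {r : ℝ}
    {Θ : ℝ≥0∞} (hbm : AEStronglyMeasurable b τ) (hE : MeasurableSet E) (hF : MeasurableSet F)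
    (hE0 : τ E ≠ 0) (hF0 : τ F ≠ 0) (hEtop : τ E ≠ ∞) (hFtop : τ F ≠ ∞)
    (hbE : IntegrableOn b E τ) (hbF : IntegrableOn b F τ) (hq : ∀ z, Measurable (q z))
    (hk₀ : ‖k₀‖ = r) (hk₁ : ‖k₁‖ = r)
    (hq₀ : ∀ z ∈ E, ∀ w ∈ F, ‖q z w - k₀‖ ≤ 1 / 6 * ‖k₀‖)
    (hq₁ : ∀ z ∈ E, ∀ w ∈ F, ‖q w z - k₁‖ ≤ 1 / 6 * ‖k₁‖)
    (hΘ₀ : ∫⁻ z in E, ‖∫ w in F, (b z - b w) * q z w ∂τ‖ₑ ∂τ ≤ Θ)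
    (hΘ₁ : ∫⁻ w in F, ‖∫ z in E, (b w - b z) * q w z ∂τ‖ₑ ∂τ ≤ Θ) :
    ENNReal.ofReal r * ∫⁻ z in E, ∫⁻ w in F, ‖b z - b w‖ₑ ∂τ ∂τ ≤ 6 * Θ := by
  have h₀ := enorm_mul_lintegral_integral_sub_le hbm hE hF hFtop hbF hq hq₀
  have h₁ := enorm_mul_lintegral_integral_sub_le hbm hF hE hEtop hbE hq
    fun w hw z hz => hq₁ z hz w hw
  have h2 := lintegral_lintegral_sub_le hbm hE0 hF0 hEtop hFtop hbE hbF
  have hswap : ∫⁻ w in F, ∫⁻ z in E, ‖b w - b z‖ₑ ∂τ ∂τ =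
      ∫⁻ z in E, ∫⁻ w in F, ‖b z - b w‖ₑ ∂τ ∂τ := by
    rw [lintegral_lintegral_swap]
    · simp only [enorm_sub_rev]
    · exact (hbm.restrict.comp_fst.fun_sub (hbm.restrict.comp_snd)).enorm
  rw [hswap] at h₁
  set S := ∫⁻ z in E, ∫⁻ w in F, ‖b z - b w‖ₑ ∂τ ∂τ with hS
  -- Finiteness of `S` is what permits the absorption below; it is the reason for requiring `b`
  -- integrable on both sets.
  have hSfin : S ≠ ∞ := by
    refine ne_top_of_le_ne_top (b := (∫⁻ z in E, ‖b z‖ₑ ∂τ) * τ F +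
      (∫⁻ w in F, ‖b w‖ₑ ∂τ) * τ E) (ENNReal.add_ne_top.2
      ⟨ENNReal.mul_ne_top hbE.2.ne hFtop, ENNReal.mul_ne_top hbF.2.ne hEtop⟩) ?_
    calc S ≤ ∫⁻ z in E, ∫⁻ w in F, (‖b z‖ₑ + ‖b w‖ₑ) ∂τ ∂τ :=
          lintegral_mono fun z => lintegral_mono fun w => enorm_sub_le
      _ = ∫⁻ z in E, (‖b z‖ₑ * τ F + ∫⁻ w in F, ‖b w‖ₑ ∂τ) ∂τ := by
          refine lintegral_congr fun z => ?_
          rw [lintegral_add_left measurable_const, setLIntegral_const]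
      _ = _ := by
          rw [lintegral_add_right _ measurable_const, setLIntegral_const,
            lintegral_mul_const' _ _ hFtop]
  have e₀ : ‖k₀‖ₑ = ENNReal.ofReal r := by rw [← ofReal_norm, hk₀]
  have e₁ : ‖k₁‖ₑ = ENNReal.ofReal r := by rw [← ofReal_norm, hk₁]
  rw [e₀] at h₀
  rw [e₁] at h₁
  have hrS : ENNReal.ofReal r * S ≠ ∞ := ENNReal.mul_ne_top ENNReal.ofReal_ne_top hSfin
  have h6 : ENNReal.ofReal (1 / 6) = 1 / 6 := by
    rw [ENNReal.ofReal_div_of_pos (by norm_num)]; simp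
  -- The preceding comparison uses three one-sided terms, each with error `1/6`, so half of `r S`
  -- remains to be absorbed.
  have h3 : ENNReal.ofReal r * S ≤ 3 * Θ + 1 / 2 * (ENNReal.ofReal r * S) := by
    calc ENNReal.ofReal r * S ≤ ENNReal.ofReal r *
          (2 * ∫⁻ z in E, ‖∫ w in F, (b z - b w) ∂τ‖ₑ ∂τ +
            ∫⁻ w in F, ‖∫ z in E, (b w - b z) ∂τ‖ₑ ∂τ) := by gcongr
      _ = 2 * (ENNReal.ofReal r * ∫⁻ z in E, ‖∫ w in F, (b z - b w) ∂τ‖ₑ ∂τ) +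
            ENNReal.ofReal r * ∫⁻ w in F, ‖∫ z in E, (b w - b z) ∂τ‖ₑ ∂τ := by ring
      _ ≤ 2 * (Θ + ENNReal.ofReal (1 / 6) * (ENNReal.ofReal r * S)) +
            (Θ + ENNReal.ofReal (1 / 6) * (ENNReal.ofReal r * S)) := by
          gcongr
          · exact h₀.trans (by gcongr)
          · exact h₁.trans (by gcongr)
      _ = 3 * Θ + 3 * ENNReal.ofReal (1 / 6) * (ENNReal.ofReal r * S) := by ring
      _ = _ := by
          congr 2
          rw [show (3 : ℝ≥0∞) = ENNReal.ofReal 3 by simp, ← ENNReal.ofReal_mul (by norm_num),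
            show (3 : ℝ) * (1 / 6) = 1 / 2 by norm_num, ENNReal.ofReal_div_of_pos (by norm_num)]
          simp
  set T := ENNReal.ofReal r * S
  have h4 : T = 1 / 2 * T + 1 / 2 * T := by
    rw [← add_mul, ENNReal.add_halves, one_mul]
  have h5 : 1 / 2 * T ≤ 3 * Θ := by
    have hfin : 1 / 2 * T ≠ ∞ := ENNReal.mul_ne_top (by simp) hrS
    refine (ENNReal.add_le_add_iff_right hfin).1 ?_
    rw [← h4]
    exact h3
  calc T = 2 * (1 / 2 * T) := by rw [two_mul, ← h4]
    _ ≤ 2 * (3 * Θ) := by gcongr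
    _ = _ := by ring

end Oscillation

/-! ### The lower bound for arbitrary symbols. -/

/-- A Carleson box truncated away from the real line. -/
def truncatedBox (I : ℝ × ℝ) (ε : ℝ) : Set ℂ := rectangle I.1 I.2 ε (I.2 - I.1)

theorem measurableSet_truncatedBox (I : ℝ × ℝ) (ε : ℝ) : MeasurableSet (truncatedBox I ε) :=
  measurableSet_rectangle _ _ _ _

theorem truncatedBox_subset {I : ℝ × ℝ} {ε : ℝ} (hε : 0 ≤ ε) :
    truncatedBox I ε ⊆ carlesonBox I := fun _ hz => ⟨hz.1, hε.trans_lt hz.2.1, hz.2.2⟩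

theorem truncatedBox_subset_reProdIm (I : ℝ × ℝ) (ε : ℝ) :
    truncatedBox I ε ⊆ Set.Icc I.1 I.2 ×ℂ Set.Icc ε (I.2 - I.1) := fun _ hz =>
  ⟨⟨hz.1.1, hz.1.2.le⟩, hz.2.1.le, hz.2.2.le⟩

theorem reProdIm_Icc_subset_upperHalf (I : ℝ × ℝ) {ε : ℝ} (hε : 0 < ε) (L : ℝ) :
    Set.Icc I.1 I.2 ×ℂ Set.Icc ε L ⊆ upperHalf := fun _ hz => hε.trans_le hz.2.1

theorem isTestFunction_indicator_truncatedBox (I : ℝ × ℝ) {ε : ℝ} (hε : 0 < ε) :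
    IsTestFunction ((truncatedBox I ε).indicator 1) := by
  refine ⟨measurable_const.indicator (measurableSet_truncatedBox I ε), ⟨1, fun z => ?_⟩,
    Set.Icc I.1 I.2 ×ℂ Set.Icc ε (I.2 - I.1), isCompact_Icc.reProdIm isCompact_Icc,
    reProdIm_Icc_subset_upperHalf I hε _, fun z hz =>
      Set.indicator_of_notMem (fun h => hz (truncatedBox_subset_reProdIm I ε h)) _⟩
  by_cases hz : z ∈ truncatedBox I ε <;> simp [hz]

theorem areaMeasure_truncatedBox_ne_zero {α : ℝ} (hα : -1 < α) {I : ℝ × ℝ} {ε : ℝ} (hε : 0 ≤ ε)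
    (hεI : ε < I.2 - I.1) : areaMeasure α (truncatedBox I ε) ≠ 0 := by
  rw [truncatedBox, areaMeasure_rectangle hα _ _ hε hεI.le, ← ENNReal.ofReal_mul (by linarith)]
  simp only [ne_eq, ENNReal.ofReal_eq_zero, not_le]
  have h1 : ε ^ (α + 1) < (I.2 - I.1) ^ (α + 1) := Real.rpow_lt_rpow hε hεI (by linarith)
  have h2 := boxConst_pos α
  rw [boxConst] at h2
  have h3 : 0 < I.2 - I.1 := by linarith
  have h4 : 0 < (I.2 - I.1) ^ (α + 1) - ε ^ (α + 1) := by linarith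
  positivity

section LowerBound

variable {α : ℝ} {k : ℂ → ℂ → ℂ} {b : ℂ → ℂ} {μ lam : ℂ → ℝ}

/-- The commutator applied to the indicator function of `F`. -/
theorem HasBergmanModulus.commutatorOp_indicator (hk : HasBergmanModulus α k) {F : Set ℂ}
    (hF : MeasurableSet F) (hFtop : areaMeasure α F ≠ ∞) (hb : IntegrableOn b F (areaMeasure α))
    {z : ℂ} {R : ℝ} (hR : ∀ w ∈ F, ‖k z w‖ ≤ R) :
    commutatorOp α k b (F.indicator 1) z =
      ∫ w in F, (b z - b w) * k z w ∂(areaMeasure α) := by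
  have hkm := (hk.measurable_right z).aestronglyMeasurable (μ := (areaMeasure α).restrict F)
  have hRae : ∀ᵐ w ∂(areaMeasure α).restrict F, ‖k z w‖ ≤ R :=
    (ae_restrict_iff' hF).2 (Filter.Eventually.of_forall hR)
  have i1 : IntegrableOn (fun w => k z w * 1) F (areaMeasure α) :=
    Integrable.bdd_mul (integrableOn_const hFtop : IntegrableOn (fun _ => (1 : ℂ)) F _) hkm hRae
  have i2 : IntegrableOn (fun w => k z w * b w) F (areaMeasure α) :=
    Integrable.bdd_mul hb hkm hRae
  have e : ∀ a : ℂ → ℂ, (fun w => a w * F.indicator 1 w) = F.indicator a := by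
    intro a
    funext w
    by_cases hw : w ∈ F <;> simp [hw]
  have e1 : (fun w => k z w * F.indicator 1 w) = F.indicator fun w => k z w * 1 := by
    rw [e]; simp
  have e2 : (fun w => k z w * (b w * F.indicator 1 w)) = F.indicator fun w => k z w * b w := by
    rw [← e fun w => k z w * b w]; funext w; ring
  have e3 : (fun w => (b z - b w) * k z w * F.indicator 1 w) =
      F.indicator fun w => (b z - b w) * k z w := e _
  rw [commutatorOp_eq_integral, e3, integral_indicator hF]
  · rw [e1]; exact i1.integrable_indicator hF
  · rw [e2]; exact i2.integrable_indicator hF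

/-- The `L¹` norm of the commutator over one set, applied to the indicator of another. -/
theorem HasBergmanModulus.sq_setLIntegral_commutatorOp_le (hk : HasBergmanModulus α k)
    {𝒟 : Set (ℝ × ℝ)} {K : ℝ≥0} (hα : -1 < α)
    (hμ : IsWeight α μ) (hl : IsWeight α lam) (hμK : b2Const α 𝒟 μ ≤ K)
    (hlK : b2Const α 𝒟 lam ≤ K)
    (hb : AEStronglyMeasurable b (areaMeasure α)) (hfin : commutatorNorm α k b μ lam ≠ ∞)
    {E F : Set ℂ} {J : ℝ × ℝ} (hJ : J.1 < J.2) (hJ' : J ∈ 𝒟) (hE : E ⊆ carlesonBox J)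
    (hF : F ⊆ carlesonBox J) (hFm : MeasurableSet F) (hFt : IsTestFunction (F.indicator 1)) :
    (∫⁻ z in E, ‖commutatorOp α k b (F.indicator 1) z‖ₑ ∂(areaMeasure α)) ^ 2 ≤
      commutatorNorm α k b μ lam ^ 2 * (boxMass α (fun z => ENNReal.ofReal (μ z)) J *
        boxMass α (fun z => ENNReal.ofReal (lam z)⁻¹) J) := by
  have du := hμ.dualWeights hμK
  have dv := hl.dualWeights hlK
  have hFae : AEStronglyMeasurable (F.indicator (1 : ℂ → ℂ)) (areaMeasure α) :=
    hFt.1.aestronglyMeasurable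
  have hcm := hk.aestronglyMeasurable_commutatorOp hb hFae
  have e1 : eLpNorm (F.indicator (1 : ℂ → ℂ)) 2 (weightedMeasure α μ) ^ 2 ≤
      boxMass α (fun z => ENNReal.ofReal (μ z)) J := by
    rw [hμ.eLpNorm_sq hFae, boxMass]
    refine le_trans (le_of_eq ?_) (lintegral_mono_set hF)
    rw [← lintegral_indicator hFm]
    refine lintegral_congr fun z => ?_
    by_cases hz : z ∈ F <;> simp [hz]
  have hne : eLpNorm (F.indicator (1 : ℂ → ℂ)) 2 (weightedMeasure α μ) ≠ ∞ := by
    intro h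
    rw [h] at e1
    have e0 : boxMass α (fun z => ENNReal.ofReal (μ z)) J = ∞ := top_le_iff.1 (by simpa using e1)
    exact du.mass_ne_top hα hJ hJ' e0
  have e2 := eLpNorm_commutatorOp_le_commutatorNorm hfin hFt hne
  have e3 := hl.eLpNorm_sq hcm
  -- Cauchy–Schwarz with the factors `|[b,T] 1_F|² λ` and `λ⁻¹`.
  have e4 := sq_setLIntegral_le_of_sq_eq
    (w := fun z => ‖commutatorOp α k b (F.indicator 1) z‖ₑ)
    ((hcm.enorm.pow_const 2).fun_mul dv.left) dv.right
    (dv.mul_eq_one.mono fun z hz => by rw [mul_assoc, hz, mul_one]) E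
  calc _ ≤ (∫⁻ z in E, ‖commutatorOp α k b (F.indicator 1) z‖ₑ ^ 2 * ENNReal.ofReal (lam z)
        ∂(areaMeasure α)) * ∫⁻ z in E, ENNReal.ofReal (lam z)⁻¹ ∂(areaMeasure α) := e4
    _ ≤ eLpNorm (commutatorOp α k b (F.indicator 1)) 2 (weightedMeasure α lam) ^ 2 *
        boxMass α (fun z => ENNReal.ofReal (lam z)⁻¹) J := by
        rw [e3]
        gcongr
        · exact Measure.restrict_le_self
        · exact lintegral_mono_set hE
    _ ≤ (commutatorNorm α k b μ lam * eLpNorm (F.indicator (1 : ℂ → ℂ)) 2 (weightedMeasure α μ)) ^ 2 *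
        boxMass α (fun z => ENNReal.ofReal (lam z)⁻¹) J := by gcongr
    _ = commutatorNorm α k b μ lam ^ 2 *
        (eLpNorm (F.indicator (1 : ℂ → ℂ)) 2 (weightedMeasure α μ) ^ 2 *
        boxMass α (fun z => ENNReal.ofReal (lam z)⁻¹) J) := by ring
    _ ≤ _ := by gcongr

theorem iUnion_truncatedBox (I : ℝ × ℝ) {L : ℝ} (hL : 0 < L) :
    ⋃ n : ℕ, truncatedBox I (L / (n + 2)) = carlesonBox I := by
  ext z
  simp only [Set.mem_iUnion]
  constructor
  · rintro ⟨n, hn⟩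
    exact truncatedBox_subset (by positivity) hn
  · intro hz
    have hy : 0 < z.im := hz.2.1
    obtain ⟨n, hn⟩ := exists_nat_gt (L / z.im)
    refine ⟨n, hz.1, ?_, hz.2.2⟩
    rw [div_lt_iff₀ hy] at hn
    rw [div_lt_iff₀ (by positivity)]
    nlinarith

theorem monotone_truncatedBox (I : ℝ × ℝ) {L : ℝ} (hL : 0 < L) :
    Monotone fun n : ℕ => truncatedBox I (L / (n + 2)) := by
  intro m n hmn z hz
  refine ⟨hz.1, lt_of_le_of_lt ?_ hz.2.1, hz.2.2⟩
  have : (m : ℝ) ≤ n := by exact_mod_cast hmn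
  gcongr

/-- Monotone convergence: the products of truncated boxes increase to the product of the full boxes.
It carries the bound to the full boxes, over which `b` is not known to be integrable. -/
theorem setLIntegral_truncatedBox_le {f : ℂ × ℂ → ℝ≥0∞} {I J : ℝ × ℝ} {L : ℝ} (hL : 0 < L)
    {S : ℝ≥0∞} (hf : AEMeasurable f ((areaMeasure α).prod (areaMeasure α)))
    (h : ∀ n : ℕ, ∫⁻ z in truncatedBox I (L / (n + 2)), ∫⁻ w in truncatedBox J (L / (n + 2)),
      f (z, w) ∂(areaMeasure α) ∂(areaMeasure α) ≤ S) :
    ∫⁻ z in carlesonBox I, ∫⁻ w in carlesonBox J, f (z, w) ∂(areaMeasure α) ∂(areaMeasure α) ≤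
      S := by
  have hf' : ∀ E F : Set ℂ, AEMeasurable f
      (((areaMeasure α).restrict E).prod ((areaMeasure α).restrict F)) := fun E F => by
    rw [Measure.prod_restrict]; exact hf.restrict
  have e : ∀ E F : Set ℂ, ∫⁻ z in E, ∫⁻ w in F, f (z, w) ∂(areaMeasure α) ∂(areaMeasure α) =
      ∫⁻ p in E ×ˢ F, f p ∂((areaMeasure α).prod (areaMeasure α)) := fun E F => by
    rw [← Measure.prod_restrict, lintegral_prod _ (hf' E F)]
  have hU : carlesonBox I ×ˢ carlesonBox J =
      ⋃ n : ℕ, truncatedBox I (L / (n + 2)) ×ˢ truncatedBox J (L / (n + 2)) := by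
    rw [← iUnion_truncatedBox I hL, ← iUnion_truncatedBox J hL,
      Set.iUnion_prod_of_monotone (monotone_truncatedBox I hL) (monotone_truncatedBox J hL)]
  rw [e, hU, setLIntegral_iUnion_of_directed _ (Monotone.directed_le fun m n hmn =>
    Set.prod_mono (monotone_truncatedBox I hL hmn) (monotone_truncatedBox J hL hmn))]
  refine iSup_le fun n => ?_
  rw [← e]
  exact h n

/-- The average differs from `c` by at most the mean of `|b - c|`. A finite bound `S` gives
integrability of `b` on `Q`, so the average is a genuine one. -/
theorem lintegral_sub_average_le_two_mul {A : Measure ℂ} {Q : Set ℂ} (hb : AEStronglyMeasurable b A)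
    (hQ0 : A Q ≠ 0) (hQ : A Q ≠ ∞) {c : ℂ} {S : ℝ≥0∞} (hS : S ≠ ∞)
    (h : ∫⁻ z in Q, ‖b z - c‖ₑ ∂A ≤ S) :
    ∫⁻ z in Q, ‖b z - ⨍ w in Q, b w ∂A‖ₑ ∂A ≤ 2 * S := by
  have hi : IntegrableOn (fun z => b z - c) Q A :=
    ⟨(hb.sub aestronglyMeasurable_const).restrict, by
      rw [hasFiniteIntegral_iff_enorm]; exact h.trans_lt hS.lt_top⟩
  have hc : IntegrableOn (fun _ => c) Q A := integrableOn_const hQ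
  have hbi : IntegrableOn b Q A := (hi.add hc).congr (Filter.Eventually.of_forall fun z => by simp)
  have hreal : (A.real Q : ℂ) ≠ 0 := by
    simpa [Measure.real, ENNReal.toReal_eq_zero_iff] using ⟨hQ0, hQ⟩
  have e : (A.real Q : ℂ) * (c - ⨍ w in Q, b w ∂A) = -∫ z in Q, (b z - c) ∂A := by
    rw [integral_sub hbi hc, setIntegral_const, setAverage_eq, mul_sub, Complex.real_smul,
      Complex.real_smul]
    push_cast
    rw [← mul_assoc, mul_inv_cancel₀ hreal]
    ring
  have h1 : ‖c - ⨍ w in Q, b w ∂A‖ₑ * A Q ≤ S := by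
    have h2 : ‖(A.real Q : ℂ)‖ₑ = A Q := by
      rw [← ofReal_norm, Complex.norm_real, Real.norm_of_nonneg measureReal_nonneg,
        ofReal_measureReal hQ]
    rw [mul_comm, ← h2, ← enorm_mul, e, enorm_neg]
    exact (enorm_integral_le_lintegral_enorm _).trans h
  calc _ ≤ ∫⁻ z in Q, (‖b z - c‖ₑ + ‖c - ⨍ w in Q, b w ∂A‖ₑ) ∂A := by
        refine lintegral_mono fun z => ?_
        rw [← sub_add_sub_cancel (b z) c]
        exact enorm_add_le _ _
    _ = (∫⁻ z in Q, ‖b z - c‖ₑ ∂A) + ‖c - ⨍ w in Q, b w ∂A‖ₑ * A Q := by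
        rw [lintegral_add_right _ measurable_const, setLIntegral_const]
    _ ≤ S + S := add_le_add h h1
    _ = _ := (two_mul S).symm

end LowerBound

/-- The lower bound for commutators, valid for arbitrary symbols. -/
theorem exists_bmoNorm_le_commutatorNorm {α : ℝ} (hα : -1 < α) (κ : ℝ) (K : ℝ≥0) {k : ℂ → ℂ → ℂ}
    (hk : HasBergmanModulus α k) (hkf : IsAlmostConstantFar α k) :
    ∃ C : ℝ≥0, 1 ≤ C ∧ ∀ D₁ D₂ : DyadicSystem, AdjacentSystems κ D₁ D₂ → ∀ μ lam : ℂ → ℝ,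
      IsWeight α μ → IsWeight α lam → b2Const α (D₁.intervals ∪ D₂.intervals) μ ≤ K →
      b2Const α (D₁.intervals ∪ D₂.intervals) lam ≤ K →
      ∀ b : ℂ → ℂ, LocallyIntegrableOn b upperHalf (areaMeasure α) →
      bmoNorm α (D₁.intervals ∪ D₂.intervals) (bloomWeight μ lam) b ≤
        C * commutatorNorm α k b μ lam := by
  obtain ⟨N, hN, hNk⟩ := hkf (1 / 6) (by norm_num)
  have ha := boxConst_pos α
  set G : ℝ := (κ * (N + 1)) ^ (2 + α) with hG
  set C₁ : ℝ≥0 := 12 * (K * G.toNNReal ^ 2) * (N ^ (2 + α) / boxConst α).toNNReal with hC₁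
  refine ⟨max 1 C₁, le_max_left _ _, fun D₁ D₂ h μ lam hμ hl hμK hlK b hb => ?_⟩
  have hκ := h.one_lt
  -- In this case `C ≥ 1` is needed, so that the right side is `∞` and not `0 * ∞ = 0`.
  by_cases hfin : commutatorNorm α k b μ lam = ∞
  · rw [hfin, ENNReal.mul_top]
    · exact le_top
    · have : (1 : ℝ≥0) ≤ max 1 C₁ := le_max_left _ _
      intro h0
      rw [ENNReal.coe_eq_zero] at h0
      rw [h0] at this
      exact absurd this (by norm_num)
  have hbm := aestronglyMeasurable_of_locallyIntegrableOn_upperHalf hb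
  have du := hμ.dualWeights hμK
  have dv := hl.dualWeights hlK
  have hν := hμ.intermediateWeight hl
  have dν := hν.dualWeights du dv
  refine iSup₂_le fun I hI => ?_
  have hI0 : I.1 < I.2 := DyadicSystem.lt_of_mem_union I hI
  refine ENNReal.div_le_of_le_mul ?_
  change _ ≤ _ * boxMass α (fun z => ENNReal.ofReal (bloomWeight μ lam z)) I
  obtain ⟨s, t⟩ := I
  simp only at hI0
  obtain ⟨L, rfl⟩ : ∃ L, t = s + L := ⟨t - s, by ring⟩
  have hL : 0 < L := by linarith
  have hNL : L ≤ N * L := le_mul_of_one_le_left hL.le hN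
  -- One interval of the family covers `I` and its translate `I'`, with length at most `κ (N + 1)
  -- L`; this is the origin of `G`.
  obtain ⟨J, hJ, hJsub, hJlen⟩ := h (s - N * L) (s + L) (by linarith)
  have hJ1 : J.1 ≤ s - N * L := (hJsub (Set.left_mem_Icc.2 (by linarith))).1
  have hJ2 : s + L < J.2 := (hJsub (Set.right_mem_Icc.2 (by linarith))).2
  have hJ0 : J.1 < J.2 := by linarith
  obtain ⟨k₀, k₁, hk₀, hk₁, hkk⟩ := hNk s L hL
  set I : ℝ × ℝ := (s, s + L) with hIdef
  have hI0 : I.1 < I.2 := hI0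
  set I' : ℝ × ℝ := (s - N * L, s - N * L + L) with hIdef'
  set A := areaMeasure α with hA
  set W := boxMass α (fun z => ENNReal.ofReal (bloomWeight μ lam z)) I with hW
  have hlenI : I.2 - I.1 = L := by simp [hIdef]
  have hlenI' : I'.2 - I'.1 = L := by simp [hIdef']
  have hI0' : I'.1 < I'.2 := by linarith
  have hWtop : W ≠ ∞ := dν.mass_ne_top hα hI0 hI
  have hareaI : A (carlesonBox I) = ENNReal.ofReal (boxConst α * L ^ (2 + α)) := by
    rw [hA, areaMeasure_carlesonBox hα hI0, hlenI]
  have hareaI' : A (carlesonBox I') = ENNReal.ofReal (boxConst α * L ^ (2 + α)) := by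
    rw [hA, areaMeasure_carlesonBox hα hI0', hlenI']
  have hareaJ : A (carlesonBox J) ≤ ENNReal.ofReal G * A (carlesonBox I) := by
    rw [hareaI, hA, areaMeasure_carlesonBox hα hJ0, ← ENNReal.ofReal_mul (by positivity)]
    refine ENNReal.ofReal_le_ofReal ?_
    have h1 : (J.2 - J.1) ^ (2 + α) ≤ (κ * (N + 1) * L) ^ (2 + α) :=
      Real.rpow_le_rpow (by linarith) (by linarith) (by linarith)
    rw [Real.mul_rpow (by positivity) hL.le, ← hG] at h1
    calc _ ≤ boxConst α * (G * L ^ (2 + α)) := by gcongr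
      _ = _ := by ring
  set Θ : ℝ≥0∞ := commutatorNorm α k b μ lam * (K * ENNReal.ofReal G ^ 2 * W) with hΘ
  have hΘtop : Θ ≠ ∞ := ENNReal.mul_ne_top hfin (ENNReal.mul_ne_top
    (ENNReal.mul_ne_top (by simp) (ENNReal.pow_ne_top ENNReal.ofReal_ne_top)) hWtop)
  have hAI0 : A (carlesonBox I) ≠ 0 := areaMeasure_carlesonBox_ne_zero hα hI0
  have hAItop : A (carlesonBox I) ≠ ∞ := areaMeasure_carlesonBox_ne_top hα hI0
  have hmass : boxMass α (fun z => ENNReal.ofReal (μ z)) J *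
      boxMass α (fun z => ENNReal.ofReal (lam z)⁻¹) J ≤ (K * ENNReal.ofReal G ^ 2 * W) ^ 2 := by
    have h1 := hν.mass_mul_mass_le hα du dv hI0 hJ
      ⟨by change J.1 ≤ s; linarith, by change s + L ≤ J.2; linarith⟩
    refine (ENNReal.mul_le_mul_iff_left (pow_ne_zero 4 hAI0) (ENNReal.pow_ne_top hAItop)).1
      (h1.trans ?_)
    calc _ ≤ (K * (ENNReal.ofReal G * A (carlesonBox I)) ^ 2 * W) ^ 2 := by gcongr
      _ = _ := by ring
  have hkk' : ∀ z ∈ carlesonBox I, ∀ w ∈ carlesonBox I',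
      ‖k z w‖ ≤ 2 * (N * L) ^ (-(2 + α)) ∧ ‖k w z‖ ≤ 2 * (N * L) ^ (-(2 + α)) := by
    intro z hz w hw
    obtain ⟨h1, h2⟩ := hkk z hz w hw
    rw [hk₀] at h1
    rw [hk₁] at h2
    have h3 := norm_sub_norm_le (k z w) k₀
    have h4 := norm_sub_norm_le (k w z) k₁
    have h5 : 0 < (N * L) ^ (-(2 + α)) := by positivity
    constructor <;> linarith
  have hsubJ : carlesonBox I ⊆ carlesonBox J :=
    carlesonBox_mono ⟨by change J.1 ≤ s; linarith, by change s + L ≤ J.2; linarith⟩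
  have hsubJ' : carlesonBox I' ⊆ carlesonBox J :=
    carlesonBox_mono ⟨by change J.1 ≤ s - N * L; linarith, by change s - N * L + L ≤ J.2; linarith⟩
  have hΘle : ∀ {E F : Set ℂ}, E ⊆ carlesonBox J → F ⊆ carlesonBox J → MeasurableSet F →
      IsTestFunction (F.indicator 1) →
      ∫⁻ z in E, ‖commutatorOp α k b (F.indicator 1) z‖ₑ ∂A ≤ Θ := by
    intro E F hE hF hFm hFt
    refine ENNReal.le_of_sq_le_sq ?_
    rw [hΘ, mul_pow]
    exact (hk.sq_setLIntegral_commutatorOp_le hα hμ hl hμK hlK hbm hfin hJ0 hJ hE hF hFm hFt).trans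
      (by gcongr)
  have hosc : ENNReal.ofReal ((N * L) ^ (-(2 + α))) *
      ∫⁻ w in carlesonBox I', ∫⁻ z in carlesonBox I, ‖b z - b w‖ₑ ∂A ∂A ≤ 6 * Θ := by
    have hr0 : ENNReal.ofReal ((N * L) ^ (-(2 + α))) ≠ 0 := by
      simp only [ne_eq, ENNReal.ofReal_eq_zero, not_le]; positivity
    have hm : AEMeasurable (fun p : ℂ × ℂ => ‖b p.1 - b p.2‖ₑ) (A.prod A) :=
      (hbm.comp_fst.fun_sub hbm.comp_snd).enorm
    have hswap : ∫⁻ w in carlesonBox I', ∫⁻ z in carlesonBox I, ‖b z - b w‖ₑ ∂A ∂A =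
        ∫⁻ z in carlesonBox I, ∫⁻ w in carlesonBox I', ‖b z - b w‖ₑ ∂A ∂A := by
      rw [lintegral_lintegral_swap]
      exact (hbm.restrict.comp_snd.fun_sub hbm.restrict.comp_fst).enorm
    rw [hswap, mul_comm, ← ENNReal.le_div_iff_mul_le (Or.inl hr0) (Or.inl ENNReal.ofReal_ne_top)]
    refine setLIntegral_truncatedBox_le (f := fun p => ‖b p.1 - b p.2‖ₑ) hL hm fun n => ?_
    rw [ENNReal.le_div_iff_mul_le (Or.inl hr0) (Or.inl ENNReal.ofReal_ne_top), mul_comm]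
    have hε : 0 < L / ((n : ℝ) + 2) := by positivity
    have hεL : L / ((n : ℝ) + 2) < L := div_lt_self hL (by linarith [n.cast_nonneg (α := ℝ)])
    have hint : ∀ I₀ : ℝ × ℝ, IntegrableOn b (truncatedBox I₀ (L / ((n : ℝ) + 2))) A := fun I₀ =>
      (hb.integrableOn_compact_subset (reProdIm_Icc_subset_upperHalf I₀ hε (I₀.2 - I₀.1))
        (isCompact_Icc.reProdIm isCompact_Icc)).mono_set (truncatedBox_subset_reProdIm I₀ _)
    have hsub : truncatedBox I (L / ((n : ℝ) + 2)) ⊆ carlesonBox I := truncatedBox_subset hε.le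
    have hsub' : truncatedBox I' (L / ((n : ℝ) + 2)) ⊆ carlesonBox I' :=
      truncatedBox_subset hε.le
    have htop : A (truncatedBox I (L / ((n : ℝ) + 2))) ≠ ∞ :=
      ne_top_of_le_ne_top hAItop (measure_mono hsub)
    have htop' : A (truncatedBox I' (L / ((n : ℝ) + 2))) ≠ ∞ :=
      ne_top_of_le_ne_top (areaMeasure_carlesonBox_ne_top hα hI0') (measure_mono hsub')
    refine lintegral_lintegral_sub_le_of_almost_constant (q := k) hbm
      (measurableSet_truncatedBox _ _) (measurableSet_truncatedBox _ _)
      (areaMeasure_truncatedBox_ne_zero hα hε.le (by rwa [hlenI]))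
      (areaMeasure_truncatedBox_ne_zero hα hε.le (by rwa [hlenI'])) htop htop' (hint _) (hint _)
      hk.measurable_right hk₀ hk₁ (fun z hz w hw => (hkk z (hsub hz) w (hsub' hw)).1)
      (fun z hz w hw => (hkk z (hsub hz) w (hsub' hw)).2) ?_ ?_
    · refine le_trans (le_of_eq ?_) (hΘle (hsub.trans hsubJ) (hsub'.trans hsubJ')
        (measurableSet_truncatedBox _ _) (isTestFunction_indicator_truncatedBox _ hε))
      refine setLIntegral_congr_fun (measurableSet_truncatedBox _ _) fun z hz => ?_
      rw [hk.commutatorOp_indicator (measurableSet_truncatedBox _ _) htop' (hint _)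
        fun w hw => (hkk' z (hsub hz) w (hsub' hw)).1]
    · refine le_trans (le_of_eq ?_) (hΘle (hsub'.trans hsubJ') (hsub.trans hsubJ)
        (measurableSet_truncatedBox _ _) (isTestFunction_indicator_truncatedBox _ hε))
      refine setLIntegral_congr_fun (measurableSet_truncatedBox _ _) fun w hw => ?_
      rw [hk.commutatorOp_indicator (measurableSet_truncatedBox _ _) htop (hint _)
        fun z hz => (hkk' z (hsub hz) w (hsub' hw)).2]
  have hAI0' : A (carlesonBox I') ≠ 0 := areaMeasure_carlesonBox_ne_zero hα hI0'
  have hAItop' : A (carlesonBox I') ≠ ∞ := areaMeasure_carlesonBox_ne_top hα hI0'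
  have hm' : AEMeasurable (fun w => ∫⁻ z in carlesonBox I, ‖b z - b w‖ₑ ∂A)
      (A.restrict (carlesonBox I')) := by
    have := (aemeasurable_setLIntegral_enorm_sub hbm (carlesonBox I)).restrict
      (s := carlesonBox I')
    simpa only [enorm_sub_rev] using this
  -- Some `w` in the translated box does no worse than the average, and `b w` serves as the
  -- comparison constant on `Q_I`.
  obtain ⟨w, hw, hwle⟩ := exists_le_setLAverage hAI0' hAItop' hm'
  rw [setLAverage_eq] at hwle
  have hfinal : ∫⁻ z in carlesonBox I, ‖b z - b w‖ₑ ∂A ≤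
      ENNReal.ofReal (N ^ (2 + α) / boxConst α) * (6 * Θ) := by
    refine hwle.trans (ENNReal.div_le_of_le_mul ?_)
    rw [hareaI']
    calc _ = (ENNReal.ofReal ((N * L) ^ (2 + α)) * ENNReal.ofReal ((N * L) ^ (-(2 + α)))) *
          ∫⁻ w in carlesonBox I', ∫⁻ z in carlesonBox I, ‖b z - b w‖ₑ ∂A ∂A := by
          rw [← ENNReal.ofReal_mul (by positivity), ← Real.rpow_add (by positivity)]
          simp
      _ ≤ ENNReal.ofReal ((N * L) ^ (2 + α)) * (6 * Θ) := by
          rw [mul_assoc]; gcongr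
      _ = _ := by
          rw [mul_right_comm, ← ENNReal.ofReal_mul (by positivity)]
          congr 2
          rw [Real.mul_rpow (by positivity) hL.le]
          field_simp
  refine (lintegral_sub_average_le_two_mul hbm hAI0 hAItop (ENNReal.mul_ne_top
    ENNReal.ofReal_ne_top (ENNReal.mul_ne_top (by simp) hΘtop)) hfinal).trans ?_
  calc _ = (C₁ : ℝ≥0∞) * commutatorNorm α k b μ lam * W := by
        rw [hΘ, hC₁]; simp only [ENNReal.ofReal]; push_cast; ring
    _ ≤ _ := by
        gcongr
        exact le_max_right _ _

/-! ### The characterization theorem. -/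

theorem theorem1p1 (α : ℝ) (hα : -1 < α) (κ : ℝ) (K : ℝ≥0) :
    ∃ C : ℝ≥0, ∀ D₁ D₂ : DyadicSystem, AdjacentSystems κ D₁ D₂ →
      ∀ 𝒟 : Set (ℝ × ℝ), 𝒟 = D₁.intervals ∪ D₂.intervals →
      ∀ μ lam : ℂ → ℝ, IsWeight α μ → IsWeight α lam →
        b2Const α 𝒟 μ ≤ K → b2Const α 𝒟 lam ≤ K →
      ∀ ν : ℂ → ℝ, ν = bloomWeight μ lam →
      ∀ k : ℂ → ℂ → ℂ, k = bergmanKernel α ∨ k = berezinKernel α →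
        -- holomorphic symbols: characterization and two-sided estimate
        (∀ b : ℂ → ℂ, LocallyIntegrableOn b upperHalf (areaMeasure α) →
          DifferentiableOn ℂ b upperHalf →
            (commutatorNorm α k b μ lam < ∞ ↔ MemBMOA α 𝒟 ν b) ∧
            bmoNorm α 𝒟 ν b ≤ C * commutatorNorm α k b μ lam ∧
            commutatorNorm α k b μ lam ≤ C * bmoNorm α 𝒟 ν b ∧
            (MemBMOA α 𝒟 ν b →
              CommutatorBoundedOnL2 α k b μ lam (commutatorNorm α k b μ lam))) ∧
        -- general symbols: lower bound
        (∀ b : ℂ → ℂ, LocallyIntegrableOn b upperHalf (areaMeasure α) →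
            bmoNorm α 𝒟 ν b ≤ C * commutatorNorm α k b μ lam) := by
  obtain ⟨C₁, hC₁⟩ := exists_commutator_upper_bound hα κ K
  obtain ⟨C₂, hC₂, hlow₂⟩ := exists_bmoNorm_le_commutatorNorm hα κ K
    (hasBergmanModulus_of_eq (k := bergmanKernel α) (Or.inl rfl))
    (isAlmostConstantFar_bergmanKernel α)
  obtain ⟨C₃, hC₃, hlow₃⟩ := exists_bmoNorm_le_commutatorNorm hα κ K
    (hasBergmanModulus_of_eq (k := berezinKernel α) (Or.inr rfl))
    (isAlmostConstantFar_berezinKernel α)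
  set C := C₁ + C₂ + C₃ with hC
  have hC1 : (1 : ℝ≥0) ≤ C := hC₂.trans ((le_add_self : C₂ ≤ C₁ + C₂).trans le_self_add)
  refine ⟨C, ?_⟩
  rintro D₁ D₂ h 𝒟 rfl μ lam hμ hl hμK hlK ν rfl k hk
  have hkm := hasBergmanModulus_of_eq hk
  have lower : ∀ b : ℂ → ℂ, LocallyIntegrableOn b upperHalf (areaMeasure α) →
      bmoNorm α (D₁.intervals ∪ D₂.intervals) (bloomWeight μ lam) b ≤
        C * commutatorNorm α k b μ lam := by
    intro b hb
    rcases hk with rfl | rfl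
    · refine (hlow₂ D₁ D₂ h μ lam hμ hl hμK hlK b hb).trans ?_
      gcongr
      exact (le_add_self : C₂ ≤ C₁ + C₂).trans le_self_add
    · refine (hlow₃ D₁ D₂ h μ lam hμ hl hμK hlK b hb).trans ?_
      gcongr
      exact le_add_self
  refine ⟨fun b hb hbd => ?_, lower⟩
  have upper : commutatorNorm α k b μ lam ≤
      C * bmoNorm α (D₁.intervals ∪ D₂.intervals) (bloomWeight μ lam) b := by
    -- An infinite `BMO_ν` norm makes the right side `∞` because `C ≠ 0`; the kernel bound is only
    -- applied with a finite norm.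
    by_cases hM : bmoNorm α (D₁.intervals ∪ D₂.intervals) (bloomWeight μ lam) b = ∞
    · have hC0 : (C : ℝ≥0∞) ≠ 0 := by
        simpa using (one_pos.trans_le hC1).ne'
      rw [hM, ENNReal.mul_top hC0]
      exact le_top
    · refine sInf_le fun f hf => ?_
      have hfae : AEStronglyMeasurable f (areaMeasure α) := hf.1.aestronglyMeasurable
      have hfin : eLpNorm f 2 (weightedMeasure α μ) ≠ ∞ := by
        intro h0
        have := hf.lintegral_sq_ne_top hα h (hμ.dualWeights hμK)
        rw [← hμ.eLpNorm_sq hfae, h0] at this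
        simp at this
      refine (hC₁ D₁ D₂ h μ lam hμ hl hμK hlK k hkm b hb hbd hM f hfae hfin).2.trans ?_
      gcongr
      rw [hC, add_assoc]
      exact le_self_add
  have iff_mem : commutatorNorm α k b μ lam < ∞ ↔
      MemBMOA α (D₁.intervals ∪ D₂.intervals) (bloomWeight μ lam) b :=
    ⟨fun hfin => ⟨⟨hb, (lower b hb).trans_lt (ENNReal.mul_lt_top ENNReal.coe_lt_top hfin)⟩, hbd⟩,
      fun hmem => upper.trans_lt (ENNReal.mul_lt_top ENNReal.coe_lt_top hmem.1.2)⟩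
  refine ⟨iff_mem, lower b hb, upper, fun hmem => ?_⟩
  exact commutatorBoundedOnL2_of_integrable hkm hμ
    (aestronglyMeasurable_of_locallyIntegrableOn_upperHalf hb) (iff_mem.2 hmem).ne
    fun f hf hfin => (hC₁ D₁ D₂ h μ lam hμ hl hμK hlK k hkm b hb hbd hmem.1.2.ne f hf hfin).1
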